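/- Let $n\ge 1$. For $z=(z',z_n)=x+iy\in\mathbb{C}^n$ put $\rho(z)=y_n-|y'|^2$ and let $T_B=\{z\in\mathbb{C}^n:\rho(z)>0\}$. For $z,w\in T_B$ put $$\rho(z,w)=\tfrac14\Big(\sum_{j=1}^{n-1}(z_j-\overline{w_j})^2-2i(z_n-\overline{w_n})\Big),$$ which has positive real part (so that its real powers are defined by the principal branch), and let $\mathbf i=(0',i)$. For $0<p<\infty$ and $\alpha>-1$, let $L^p_\alpha(T_B)$ be the space of measurable functions $f$ on $T_B$ with $\|f\|_{p,\alpha}=\big(\int_{T_B}|f|^p\rho^\alpha\,dV\big)^{1/p}<\infty$, where $dV$ is Lebesgue measure, and let $A^p_\alpha(T_B)$ be the subspace of holomorphic functions in $L^p_\alpha(T_B)$. Let $1<p_1\le p_2<\infty$, let $-1<\alpha_1,\alpha_2,\xi<\infty$, and let $\mu$ be a positive Borel measure on $T_B$ such that $\int_{T_B}|\rho(z,\mathbf i)|^{-t}\,d\mu(z)<\infty$ for some $t>0$. Suppose that $$n+1+\xi>n\max\Big(1,\frac1{p_i}\Big)+\frac{1+\alpha_i}{p_i},\qquad i=1,2,$$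 and let $$\lambda=1+\frac1{p_1}-\frac1{p_2},\qquad \gamma=\frac1\lambda\Big(\xi+\frac{\alpha_1}{p_1}-\frac{\alpha_2}{p_2}\Big).$$ For $f$ holomorphic on $T_B$ and $z\in T_B$ put $$B_\mu^\xi f(z)=\int_{T_B}\frac{|f(w)|}{|\rho(z,w)|^{n+1+\xi}}\,d\mu(w),\qquad T_\mu^\xi f(z)=\int_{T_B}\frac{f(w)}{\rho(z,w)^{n+1+\xi}}\,d\mu(w).$$ Then the following statements are equivalent: 1. $B_\mu^\xi$ is compact from $A^{p_1}_{\alpha_1}(T_B)$ to $L^{p_2}_{\alpha_2}(T_B)$; that is, $B_\mu^\xi f$ is finite almost everywhere and belongs to $L^{p_2}_{\alpha_2}(T_B)$ for every $f\in A^{p_1}_{\alpha_1}(T_B)$, and $B_\mu^\xi$ maps bounded sets to relatively compact sets. 2. $T_\mu^\xi$ is compact from $A^{p_1}_{\alpha_1}(T_B)$ to $A^{p_2}_{\alpha_2}(T_B)$; that is, for every $f\in A^{p_1}_{\alpha_1}(T_B)$ the integral defining $T_\mu^\xi f(z)$ converges absolutely for every $z\in T_B$ and $T_\mu^\xi f\in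 A^{p_2}_{\alpha_2}(T_B)$, and $T_\mu^\xi$ maps bounded sets to relatively compact sets. 3. $\mu$ is a vanishing $(\lambda,\gamma)$-Carleson measure; that is, for all real $p,q>0$ with $q/p=\lambda$ and every bounded sequence $(f_k)$ in $A^p_\gamma(T_B)$ that converges to $0$ uniformly on every compact subset of $T_B$, $\lim_{k\to\infty}\int_{T_B}|f_k|^q\,d\mu=0$. -/

import Mathlib

open MeasureTheory Filter Topology
open scoped ENNReal NNReal

noncomputable section

namespace TubeBergman

/-- The complex Euclidean space of dimension `n = m + 1 ≥ 1`. A point is `z = (z', z_n)`, where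
`z'` has the `m` coordinates `z (Fin.castSucc j)` and `z_n = z (Fin.last m)`. -/
abbrev Cn (m : ℕ) : Type := Fin (m + 1) → ℂ

/-- `ρ(z) = y_n - |y'|²`, where `y = Im z`. -/
def rho {m : ℕ} (z : Cn m) : ℝ :=
  (z (Fin.last m)).im - ∑ j : Fin m, (z j.castSucc).im ^ 2

/-- `ρ(z, w) = ((z' - conj w')² - 2 i (z_n - conj w_n)) / 4`, where `u² = u · u` (no conjugation). -/
def rho₂ {m : ℕ} (z w : Cn m) : ℂ :=
  (1 / 4) * ((∑ j : Fin m, (z j.castSucc - (starRingEnd ℂ) (w j.castSucc)) ^ 2)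
    - 2 * Complex.I * (z (Fin.last m) - (starRingEnd ℂ) (w (Fin.last m))))

/-- The tubular domain `T_B = {x + i y : |y'|² < y_n}`. -/
def tube (m : ℕ) : Set (Cn m) :=
  {z | ∑ j : Fin m, (z j.castSucc).im ^ 2 < (z (Fin.last m)).im}

/-- The base point `𝐢 = (0', i)`. -/
def basePoint (m : ℕ) : Cn m := Pi.single (Fin.last m) Complex.I

/-- `dV_α = ρ(z)^α dV` on the tubular domain, `dV` being Lebesgue measure. -/
def weightedVolume (m : ℕ) (α : ℝ) : Measure (Cn m) :=
  (volume.restrict (tube m)).withDensity fun z => ENNReal.ofReal (rho z ^ α)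

/-- A function on the tubular domain (its values elsewhere play no role) is in `A^p_α`: it is
holomorphic and in `L^p_α`. Here `0 < p < ∞` is any real number. -/
def MemBergman {m : ℕ} (p α : ℝ) (f : Cn m → ℂ) : Prop :=
  DifferentiableOn ℂ f (tube m) ∧ MemLp f (ENNReal.ofReal p) (weightedVolume m α)

instance fact_one_le_ofReal {p : ℝ} [h : Fact (1 < p)] : Fact (1 ≤ ENNReal.ofReal p) :=
  ⟨ENNReal.one_le_ofReal.2 h.out.le⟩

/-- The space `L^p_α(T_B)`. -/
abbrev weightedLp (m : ℕ) (p α : ℝ) : Type :=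
  Lp ℂ (ENNReal.ofReal p) (weightedVolume m α)

/-- The Bergman space `A^p_α(T_B)`, as the subspace of `L^p_α(T_B)` of the classes that contain a
function that is holomorphic on the tubular domain. It carries the norm of `L^p_α`. -/
def bergman (m : ℕ) (p α : ℝ) : Submodule ℂ (Lp ℂ (ENNReal.ofReal p) (weightedVolume m α)) where
  carrier := {f | ∃ g : Cn m → ℂ, DifferentiableOn ℂ g (tube m) ∧ f =ᵐ[weightedVolume m α] g}
  zero_mem' := ⟨0, differentiableOn_const 0, Lp.coeFn_zero _ _ _⟩
  add_mem' := by
    rintro a b ⟨g, hg, hag⟩ ⟨h, hh, hbh⟩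
    exact ⟨g + h, hg.add hh, (Lp.coeFn_add a b).trans (hag.add hbh)⟩
  smul_mem' := by
    rintro c a ⟨g, hg, hag⟩
    exact ⟨c • g, hg.const_smul c, (Lp.coeFn_smul c a).trans (hag.const_smul c)⟩

/-- The holomorphic function on the tubular domain that an element of the Bergman space is. -/
def rep {m : ℕ} {p α : ℝ} (f : bergman m p α) : Cn m → ℂ := f.2.choose

theorem rep_differentiableOn {m : ℕ} {p α : ℝ} (f : bergman m p α) :
    DifferentiableOn ℂ (rep f) (tube m) := f.2.choose_spec.1

theorem coe_ae_eq_rep {m : ℕ} {p α : ℝ} (f : bergman m p α) :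
    (f : Lp ℂ (ENNReal.ofReal p) (weightedVolume m α)) =ᵐ[weightedVolume m α] rep f :=
  f.2.choose_spec.2

/-- The class `𝓜₊`. A Borel measure on the tubular domain is represented by a Borel measure on the
ambient space, only the restriction of which to the tubular domain is ever used. -/
def MeasureClass {m : ℕ} (μ : Measure (Cn m)) : Prop :=
  ∃ t : ℝ, 0 < t ∧
    ∫⁻ z in tube m, ENNReal.ofReal (1 / ‖rho₂ z (basePoint m)‖ ^ t) ∂μ < ⊤

/-- The Berezin-type operator
`B f(z) = ∫ |f(w)| / |ρ(z, w)|^(n+1+ξ) dμ(w)`, with values in `[0, ∞]`. -/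
def berezinOp {m : ℕ} (μ : Measure (Cn m)) (ξ : ℝ) (f : Cn m → ℂ) (z : Cn m) : ℝ≥0∞ :=
  ∫⁻ w in tube m, ENNReal.ofReal (‖f w‖ / ‖rho₂ z w‖ ^ (((m + 1 : ℕ) : ℝ) + 1 + ξ)) ∂μ

/-- The integrand `f(w) / ρ(z, w)^(n+1+ξ)` of the Toeplitz operator (the principal branch: the real
part of `ρ(z, w)` is positive for `z, w` in the tubular domain). -/
def toeplitzIntegrand {m : ℕ} (ξ : ℝ) (f : Cn m → ℂ) (z w : Cn m) : ℂ :=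
  f w / rho₂ z w ^ (((((m + 1 : ℕ) : ℝ) + 1 + ξ : ℝ)) : ℂ)

/-- The Toeplitz operator `T f(z) = ∫ f(w) / ρ(z, w)^(n+1+ξ) dμ(w)`. -/
def toeplitzOp {m : ℕ} (μ : Measure (Cn m)) (ξ : ℝ) (f : Cn m → ℂ) (z : Cn m) : ℂ :=
  ∫ w in tube m, toeplitzIntegrand ξ f z w ∂μ

/-- A (linear or sublinear) operator is compact: the image of every bounded set is relatively
compact. -/
def MapsBoundedToRelCompact {X Y : Type*} [Bornology X] [TopologicalSpace Y] (F : X → Y) : Prop :=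
  ∀ S : Set X, Bornology.IsBounded S → IsCompact (closure (F '' S))

/-- `B` is a compact operator from `A^{p₁}_{α₁}` to `L^{p₂}_{α₂}`: it is defined on the whole space
(`B f` is finite almost everywhere and belongs to `L^{p₂}_{α₂}`), and it is compact. -/
def BerezinCompact {m : ℕ} (μ : Measure (Cn m)) (ξ p₁ α₁ p₂ α₂ : ℝ)
    [Fact (1 < p₁)] [Fact (1 < p₂)] : Prop :=
  ∃ B : bergman m p₁ α₁ → weightedLp m p₂ α₂,
    (∀ f, ∀ᵐ z ∂(weightedVolume m α₂),
      berezinOp μ ξ (rep f) z < ⊤ ∧ B f z = ((berezinOp μ ξ (rep f) z).toReal : ℂ)) ∧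
    MapsBoundedToRelCompact B

/-- `T` is a compact operator from `A^{p₁}_{α₁}` to `A^{p₂}_{α₂}`: it is defined on the whole space
(the integral converges absolutely at every point and `T f` belongs to `A^{p₂}_{α₂}`), and it is
compact. -/
def ToeplitzCompact {m : ℕ} (μ : Measure (Cn m)) (ξ p₁ α₁ p₂ α₂ : ℝ)
    [Fact (1 < p₁)] [Fact (1 < p₂)] : Prop :=
  ∃ T : bergman m p₁ α₁ → bergman m p₂ α₂,
    (∀ f, ∀ z ∈ tube m,
      IntegrableOn (toeplitzIntegrand ξ (rep f) z) (tube m) μ ∧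
        rep (T f) z = toeplitzOp μ ξ (rep f) z) ∧
    MapsBoundedToRelCompact T

/-- Vanishing `(lam, α)`-Carleson measures: for all `p, q > 0` with `q / p = lam`,
`∫ |f_k|^q dμ → 0` for every bounded sequence in `A^p_α` that converges to `0` uniformly on the
compact subsets of the tubular domain. -/
def IsVanishingCarleson {m : ℕ} (μ : Measure (Cn m)) (lam α : ℝ) : Prop :=
  ∀ p q : ℝ, 0 < p → 0 < q → q / p = lam →
    ∀ f : ℕ → Cn m → ℂ, (∀ k, MemBergman p α (f k)) →
      (∃ M : ℝ≥0, ∀ k, eLpNorm (f k) (ENNReal.ofReal p) (weightedVolume m α) ≤ M) →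
      (∀ K : Set (Cn m), K ⊆ tube m → IsCompact K → TendstoUniformlyOn f 0 atTop K) →
      Tendsto (fun k => ∫⁻ z in tube m, ‖f k z‖ₑ ^ q ∂μ) atTop (𝓝 0)

end TubeBergman

end

noncomputable section

namespace TubeBergman

/-! All three statements are equivalent to one geometric condition, `VanishingAverages`: the μ-mass
of the invariant ball about a is o(ρ(a)^c) as a leaves every compact subset of the tube, where c =
λ(n+1+γ) = (n+1) + ξ + (n+1+α₁)/p₁ − (n+1+α₂)/p₂. Here n = m+1, so n+1 appears as m+2.

The geometry is homogeneous. Affine automorphisms act transitively on the tube, multiply the kernel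
ρ(z,w) by ρ(a), and multiply volume by ρ(a)^(n+1). Estimates made at the base point therefore hold
everywhere: ρ and |ρ(·,w)| are almost constant on invariant balls, |f(a)|^q is bounded by a mean of
|f|^q over the ball about a (`exists_submean`), and ∫ ρ^s |ρ(z,·)|^(-t) dV is a constant times a
power of ρ(z) (`forelliRudin`, with `frConst_lt_top`).

Necessity. The normalized kernels `testFn` have norm independent of a. On the ball about a, B f_a is
at least a constant times μ(ball) times a power of ρ(a); the same holds for |T f_a| at the point a,
where the Toeplitz integrand is nonnegative. If the images lie in a compact subset of L^p, their
tails are uniformly small near the boundary and near infinity (`tail_small_of_isCompact`), and this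
forces the averages to vanish. For the Carleson condition, normalized kernels with poles escaping
every compact set tend to 0 locally uniformly, while their integrals would stay bounded below if the
averages did not vanish.

Sufficiency. The submean inequality and Tonelli let μ be replaced by its averages
(`exists_averaging`). A pointwise bound on part of |f| passes from p₁ to p₂, and a Schur test
(`exists_schur`) bounds B with constant proportional to the size of the averages
(`exists_bz_bound`). Cutting μ at a large compact set leaves an outer part with tiny averages, and
an inner part controlled by the supremum of |f| on that compact set: this is `HasSplitBound`.
Montel's theorem gives finite nets for the inner part, so images of bounded sets are totally
bounded. The operator B is only sublinear, but |Bf − Bg| and |Tf − Tg| are both at most B(f − g),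
which is all that the argument needs. The same cutting proves the Carleson condition. -/

variable {m : ℕ}

/-! ### The kernel ρ(z,w) and its real part -/

theorem mem_tube_iff {z : Cn m} : z ∈ tube m ↔ 0 < rho z := by
  simp [tube, rho]

theorem continuous_rho : Continuous (rho (m := m)) := by
  unfold rho; fun_prop

theorem continuous_rho₂ : Continuous fun p : Cn m × Cn m => rho₂ p.1 p.2 := by
  unfold rho₂; fun_prop

theorem isOpen_tube : IsOpen (tube m) := by
  have : tube m = {z | 0 < rho z} := by ext; exact mem_tube_iff
  rw [this]; exact isOpen_lt continuous_const continuous_rho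

theorem measurableSet_tube : MeasurableSet (tube m) := isOpen_tube.measurableSet

@[simp] theorem basePoint_castSucc (j : Fin m) : basePoint m j.castSucc = 0 := by
  simp [basePoint, (Fin.castSucc_lt_last j).ne]

@[simp] theorem basePoint_last : basePoint m (Fin.last m) = Complex.I := by
  simp [basePoint]

@[simp] theorem rho_basePoint : rho (basePoint m) = 1 := by simp [rho]

theorem basePoint_mem : basePoint m ∈ tube m := by simp [mem_tube_iff]

@[simp] theorem rho₂_basePoint : rho₂ (basePoint m) (basePoint m) = 1 := by
  simp [rho₂]; ring_nf; simp

/-- Coordinatewise, Re (z − conj w)² = |z − w|² − 2 (Im z)² − 2 (Im w)². This identity is the source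
of every lower bound for the kernel: positivity of the real part, ρ(z,z) = ρ(z), and |z' − w'|² ≤
4|ρ(z,w)|. -/
theorem rho₂_re (z w : Cn m) :
    4 * (rho₂ z w).re = ∑ j : Fin m, ‖z j.castSucc - w j.castSucc‖ ^ 2 + 2 * rho z + 2 * rho w := by
  have h : (rho₂ z w).re = (1 / 4) * ((∑ j : Fin m,
      ((z j.castSucc - (starRingEnd ℂ) (w j.castSucc)) ^ 2).re)
      + 2 * ((z (Fin.last m)).im + (w (Fin.last m)).im)) := by
    unfold rho₂
    rw [show (1 / 4 : ℂ) = ((1 / 4 : ℝ) : ℂ) by norm_num, Complex.re_ofReal_mul]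
    simp [Complex.mul_re, Complex.sub_re]
  rw [h]
  unfold rho
  have : ∀ j : Fin m, ((z j.castSucc - (starRingEnd ℂ) (w j.castSucc)) ^ 2).re
      = ‖z j.castSucc - w j.castSucc‖ ^ 2 - 2 * (z j.castSucc).im ^ 2
        - 2 * (w j.castSucc).im ^ 2 := by
    intro j
    rw [← Complex.normSq_eq_norm_sq, Complex.normSq_apply, sq]
    simp [Complex.mul_re]; ring
  simp only [this, Finset.sum_sub_distrib, ← Finset.mul_sum]
  ring

theorem rho₂_swap (z w : Cn m) : rho₂ w z = (starRingEnd ℂ) (rho₂ z w) := by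
  unfold rho₂
  simp only [map_mul, map_sub, map_sum, map_pow, Complex.conj_conj, Complex.conj_I, map_div₀,
    map_one, Complex.conj_ofNat]
  have : ∀ j : Fin m, (w j.castSucc - (starRingEnd ℂ) (z j.castSucc)) ^ 2
    = ((starRingEnd ℂ) (z j.castSucc) - w j.castSucc) ^ 2 := fun j => by ring
  simp only [this]
  ring

theorem norm_rho₂_swap (z w : Cn m) : ‖rho₂ w z‖ = ‖rho₂ z w‖ := by
  rw [rho₂_swap]; simp

theorem rho₂_re_lower (z w : Cn m) : rho z + rho w ≤ 2 * (rho₂ z w).re := by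
  have := rho₂_re z w
  have h : 0 ≤ ∑ j : Fin m, ‖z j.castSucc - w j.castSucc‖ ^ 2 :=
    Finset.sum_nonneg fun _ _ => by positivity
  linarith

theorem norm_rho₂_lower (z w : Cn m) : rho z + rho w ≤ 2 * ‖rho₂ z w‖ :=
  (rho₂_re_lower z w).trans (by have := Complex.re_le_norm (rho₂ z w); linarith)

theorem rho₂_re_pos {z w : Cn m} (hz : z ∈ tube m) (hw : w ∈ tube m) : 0 < (rho₂ z w).re := by
  have := rho₂_re_lower z w
  rw [mem_tube_iff] at hz hw
  linarith

theorem norm_rho₂_pos {z w : Cn m} (hz : z ∈ tube m) (hw : w ∈ tube m) : 0 < ‖rho₂ z w‖ :=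
  (rho₂_re_pos hz hw).trans_le (Complex.re_le_norm _)

theorem rho₂_ne_zero {z w : Cn m} (hz : z ∈ tube m) (hw : w ∈ tube m) : rho₂ z w ≠ 0 :=
  norm_pos_iff.1 (norm_rho₂_pos hz hw)

/-! ### Affine automorphisms of the tube and their action on kernel and volume -/

/-- The affine automorphism of the tubular domain that maps the base point to `a`. -/
def transl (a z : Cn m) : Cn m :=
  Fin.snoc (α := fun _ => ℂ) (fun j : Fin m => a j.castSucc + (√(rho a) : ℂ) * z j.castSucc)
    (a (Fin.last m) + (rho a : ℂ) * (z (Fin.last m) - Complex.I)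
      + 2 * (√(rho a) : ℂ) * ∑ j : Fin m, ((a j.castSucc).im : ℂ) * z j.castSucc)

@[simp] theorem transl_castSucc (a z : Cn m) (j : Fin m) :
    transl a z j.castSucc = a j.castSucc + (√(rho a) : ℂ) * z j.castSucc := by
  simp [transl]

@[simp] theorem transl_last (a z : Cn m) : transl a z (Fin.last m) =
    a (Fin.last m) + (rho a : ℂ) * (z (Fin.last m) - Complex.I)
      + 2 * (√(rho a) : ℂ) * ∑ j : Fin m, ((a j.castSucc).im : ℂ) * z j.castSucc := by
  simp [transl]

theorem continuous_transl (a : Cn m) : Continuous (transl a) := by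
  refine continuous_pi fun i => ?_
  refine Fin.lastCases ?_ (fun j => ?_) i
  · simp only [transl_last]; fun_prop
  · simp only [transl_castSucc]; fun_prop

theorem differentiable_transl (a : Cn m) : Differentiable ℂ (transl a) := by
  refine differentiable_pi.2 fun i => ?_
  refine Fin.lastCases ?_ (fun j => ?_) i
  · simp only [transl_last]; fun_prop
  · simp only [transl_castSucc]; fun_prop

@[simp] theorem transl_basePoint (a : Cn m) : transl a (basePoint m) = a := by
  ext i
  refine Fin.lastCases ?_ (fun j => ?_) i <;> simp

/-- The automorphism is an anisotropic dilation followed by a translation. Completing the square in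
z' produces cross terms with Im a', and the sum in the last coordinate of `transl` is there to
cancel them. -/
theorem rho₂_transl {a : Cn m} (ha : a ∈ tube m) (z w : Cn m) :
    rho₂ (transl a z) (transl a w) = rho a * rho₂ z w := by
  have hs : ((√(rho a) : ℝ) : ℂ) ^ 2 = (rho a : ℂ) := by
    rw [← Complex.ofReal_pow, Real.sq_sqrt (mem_tube_iff.1 ha).le]
  have him : ∀ x : ℂ, x - (starRingEnd ℂ) x = 2 * x.im * Complex.I := fun x => by
    rw [Complex.sub_conj]; push_cast; ring
  unfold rho₂
  simp only [transl_castSucc, transl_last, map_add, map_mul, map_sub, Complex.conj_ofReal,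
    Complex.conj_I, map_sum, map_ofNat]
  have e1 : ∀ j : Fin m, (a j.castSucc + (√(rho a) : ℂ) * z j.castSucc -
      ((starRingEnd ℂ) (a j.castSucc) + (√(rho a) : ℂ) * (starRingEnd ℂ) (w j.castSucc))) ^ 2
      = - (4 * ((a j.castSucc).im : ℂ) ^ 2)
        + 4 * Complex.I * (√(rho a) : ℂ) * (((a j.castSucc).im : ℂ) * z j.castSucc
          - ((a j.castSucc).im : ℂ) * (starRingEnd ℂ) (w j.castSucc))
        + (rho a : ℂ) * (z j.castSucc - (starRingEnd ℂ) (w j.castSucc)) ^ 2 := by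
    intro j
    have := him (a j.castSucc)
    rw [← hs]
    linear_combination (a j.castSucc - (starRingEnd ℂ) (a j.castSucc)
      + 2 * ((a j.castSucc).im : ℂ) * Complex.I
      + 2 * (√(rho a) : ℂ) * (z j.castSucc - (starRingEnd ℂ) (w j.castSucc))) * this
      + 4 * ((a j.castSucc).im : ℂ) ^ 2 * Complex.I_sq
  simp only [e1, Finset.sum_add_distrib, Finset.sum_neg_distrib, ← Finset.mul_sum,
    Finset.sum_sub_distrib]
  have hr : (rho a : ℂ) = (a (Fin.last m)).im - ∑ j : Fin m, ((a j.castSucc).im : ℂ) ^ 2 := by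
    unfold rho; push_cast; ring
  have := him (a (Fin.last m))
  linear_combination (-1/2 * Complex.I) * this
    + (- (((a (Fin.last m)).im : ℂ)) + (rho a : ℂ)) * Complex.I_sq - hr

theorem rho_eq_rho₂ (z : Cn m) : (rho z : ℝ) = (rho₂ z z).re := by
  have := rho₂_re z z
  simp at this; linarith

theorem rho_transl {a : Cn m} (ha : a ∈ tube m) (z : Cn m) :
    rho (transl a z) = rho a * rho z := by
  rw [rho_eq_rho₂, rho₂_transl ha, Complex.re_ofReal_mul, ← rho_eq_rho₂]

theorem norm_rho₂_transl {a : Cn m} (ha : a ∈ tube m) (z w : Cn m) :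
    ‖rho₂ (transl a z) (transl a w)‖ = rho a * ‖rho₂ z w‖ := by
  rw [rho₂_transl ha, norm_mul, Complex.norm_real, Real.norm_of_nonneg (mem_tube_iff.1 ha).le]

theorem transl_mem_tube {a : Cn m} (ha : a ∈ tube m) {z : Cn m} :
    transl a z ∈ tube m ↔ z ∈ tube m := by
  rw [mem_tube_iff, mem_tube_iff, rho_transl ha, mul_pos_iff_of_pos_left (mem_tube_iff.1 ha)]

theorem transl_injective {a : Cn m} (ha : a ∈ tube m) : Function.Injective (transl a) := by
  intro z w h
  have h1 : ((rho a : ℝ) : ℂ) ≠ 0 := by exact_mod_cast (mem_tube_iff.1 ha).ne'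
  have h2 : ((√(rho a) : ℝ) : ℂ) ≠ 0 := by
    exact_mod_cast (Real.sqrt_pos.2 (mem_tube_iff.1 ha)).ne'
  have h3 : ∀ j : Fin m, z j.castSucc = w j.castSucc := fun j => by
    have := congrFun h j.castSucc
    simpa [h2] using this
  ext i
  refine Fin.lastCases ?_ h3 i
  have := congrFun h (Fin.last m)
  simpa [h3, h1] using this

theorem exists_transl_eq {a : Cn m} (ha : a ∈ tube m) (w : Cn m) : ∃ z, transl a z = w := by
  have h1 : ((rho a : ℝ) : ℂ) ≠ 0 := by exact_mod_cast (mem_tube_iff.1 ha).ne'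
  have h2 : ((√(rho a) : ℝ) : ℂ) ≠ 0 := by
    exact_mod_cast (Real.sqrt_pos.2 (mem_tube_iff.1 ha)).ne'
  refine ⟨Fin.snoc (α := fun _ => ℂ)
    (fun j : Fin m => (w j.castSucc - a j.castSucc) / (√(rho a) : ℂ))
    (Complex.I + (w (Fin.last m) - a (Fin.last m)
      - 2 * ∑ j : Fin m, ((a j.castSucc).im : ℂ) * (w j.castSucc - a j.castSucc)) / rho a), ?_⟩
  ext i
  refine Fin.lastCases ?_ (fun j => ?_) i
  · simp only [transl_last, Fin.snoc_last, Fin.snoc_castSucc]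
    have : ∀ j : Fin m, ((a j.castSucc).im : ℂ) * ((w j.castSucc - a j.castSucc) / (√(rho a) : ℂ))
      = ((a j.castSucc).im : ℂ) * (w j.castSucc - a j.castSucc) / (√(rho a) : ℂ) :=
        fun j => by ring
    simp only [this, ← Finset.sum_div]
    field_simp
    ring
  · simp; field_simp; ring

theorem measurableEmbedding_transl {a : Cn m} (ha : a ∈ tube m) :
    MeasurableEmbedding (transl a) :=
  (continuous_transl a).measurableEmbedding (transl_injective ha)

/-- The matrix of the linear part of `transl a`. -/
def translMatrix (a : Cn m) : Matrix (Fin (m + 1)) (Fin (m + 1)) ℂ := fun i k =>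
  if i = k then (if i = Fin.last m then (rho a : ℂ) else (√(rho a) : ℂ))
  else if i = Fin.last m then 2 * (√(rho a) : ℂ) * ((a k).im : ℂ) else 0

theorem transl_eq_toLin' (a z : Cn m) :
    transl a z = Matrix.toLin' (translMatrix a) z + transl a 0 := by
  ext i
  refine Fin.lastCases ?_ (fun j => ?_) i
  · simp [Matrix.mulVec, dotProduct, Fin.sum_univ_castSucc, translMatrix,
      (Fin.castSucc_lt_last _).ne', Finset.mul_sum]
    rw [Finset.sum_congr rfl fun j _ => (mul_assoc (2 * (√(rho a) : ℂ)) _ (z (Fin.castSucc j)))]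
    ring
  · simp [Matrix.mulVec, dotProduct, translMatrix, (Fin.castSucc_lt_last _).ne]
    ring

theorem det_translMatrix {a : Cn m} (ha : a ∈ tube m) :
    (translMatrix a).det = (√(rho a) : ℂ) ^ (m + 2) := by
  rw [Matrix.det_of_isLowerTriangular]
  · have hs : ((√(rho a) : ℝ) : ℂ) ^ 2 = (rho a : ℂ) := by
      rw [← Complex.ofReal_pow, Real.sq_sqrt (mem_tube_iff.1 ha).le]
    simp [Fin.prod_univ_castSucc, translMatrix, (Fin.castSucc_lt_last _).ne, ← hs]
    ring
  · intro i j hij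
    have hij' : i < j := by simpa using hij
    have : i ≠ Fin.last m := (hij'.trans_le (Fin.le_last j)).ne
    simp [translMatrix, hij'.ne, this]

theorem map_transl_volume {a : Cn m} (ha : a ∈ tube m) :
    Measure.map (transl a) volume
      = ENNReal.ofReal (rho a ^ (-((m : ℝ) + 2))) • (volume : Measure (Cn m)) := by
  have hpos := mem_tube_iff.1 ha
  set f : Cn m →ₗ[ℝ] Cn m := (Matrix.toLin' (translMatrix a)).restrictScalars ℝ with hf
  -- The complex determinant is √ρ(a)^m · ρ(a); the real determinant is its squared modulus.
  have hdet : LinearMap.det f = rho a ^ (m + 2) := by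
    rw [hf, LinearMap.det_restrictScalars, LinearMap.det_toLin', det_translMatrix ha,
      map_pow, Algebra.norm_complex_apply, Complex.normSq_ofReal, Real.mul_self_sqrt hpos.le]
  have h1 : transl a = (fun z => z + transl a 0) ∘ f := by
    ext1 z; rw [transl_eq_toLin']; rfl
  have hf' : Continuous f := by
    have : (f : Cn m → Cn m) = fun z => transl a z - transl a 0 := by
      ext1 z; rw [transl_eq_toLin']; simp [hf]
    rw [this]; exact (continuous_transl a).sub continuous_const
  rw [h1, ← Measure.map_map (measurable_add_const _) hf'.measurable,
    Measure.map_linearMap_addHaar_eq_smul_addHaar _ (by rw [hdet]; positivity), Measure.map_smul,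
    map_add_right_eq_self, hdet, abs_of_pos (by positivity)]
  congr 2
  rw [Real.rpow_neg hpos.le]
  norm_cast

/-! ### Density and kernel with values in `ℝ≥0∞` -/

/-- `rho` as an extended nonnegative real. -/
def erho (z : Cn m) : ℝ≥0∞ := ENNReal.ofReal (rho z)

theorem erho_ne_zero {z : Cn m} (hz : z ∈ tube m) : erho z ≠ 0 := by
  simpa [erho] using mem_tube_iff.1 hz

theorem erho_ne_top (z : Cn m) : erho z ≠ ⊤ := ENNReal.ofReal_ne_top

theorem measurable_erho : Measurable (erho (m := m)) :=
  continuous_rho.measurable.ennreal_ofReal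

theorem erho_transl {a : Cn m} (ha : a ∈ tube m) (z : Cn m) :
    erho (transl a z) = erho a * erho z := by
  rw [erho, rho_transl ha, ENNReal.ofReal_mul (mem_tube_iff.1 ha).le]; rfl

theorem erho_rpow {z : Cn m} (hz : z ∈ tube m) (s : ℝ) :
    erho z ^ s = ENNReal.ofReal (rho z ^ s) :=
  ENNReal.ofReal_rpow_of_pos (mem_tube_iff.1 hz)

/-- `|ρ(z, w)|` as an extended nonnegative real. -/
def ek (z w : Cn m) : ℝ≥0∞ := ‖rho₂ z w‖ₑ

theorem ek_eq (z w : Cn m) : ek z w = ENNReal.ofReal ‖rho₂ z w‖ := by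
  rw [ek, ofReal_norm]

theorem ek_swap (z w : Cn m) : ek w z = ek z w := by
  rw [ek_eq, ek_eq, norm_rho₂_swap]

theorem ek_ne_zero {z w : Cn m} (hz : z ∈ tube m) (hw : w ∈ tube m) : ek z w ≠ 0 := by
  rw [ek]; simpa using rho₂_ne_zero hz hw

theorem ek_ne_top (z w : Cn m) : ek z w ≠ ⊤ := by simp [ek]

theorem ek_transl {a : Cn m} (ha : a ∈ tube m) (z w : Cn m) :
    ek (transl a z) (transl a w) = erho a * ek z w := by
  rw [ek, rho₂_transl ha, enorm_mul]
  congr 1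
  rw [← ofReal_norm, Complex.norm_real, Real.norm_of_nonneg (mem_tube_iff.1 ha).le]; rfl

theorem ek_rpow {z w : Cn m} (hz : z ∈ tube m) (hw : w ∈ tube m) (s : ℝ) :
    ek z w ^ s = ENNReal.ofReal (‖rho₂ z w‖ ^ s) := by
  rw [ek_eq, ENNReal.ofReal_rpow_of_pos (norm_rho₂_pos hz hw)]

theorem measurable_ek : Measurable fun p : Cn m × Cn m => ek p.1 p.2 :=
  continuous_rho₂.measurable.enorm

theorem lintegral_transl {a : Cn m} (ha : a ∈ tube m) (g : Cn m → ℝ≥0∞) :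
    ∫⁻ z, g (transl a z) = erho a ^ (-((m : ℝ) + 2)) * ∫⁻ z, g z := by
  rw [← (measurableEmbedding_transl ha).lintegral_map, map_transl_volume ha, lintegral_smul_measure,
    erho_rpow ha]; rfl

theorem setLIntegral_transl {a : Cn m} (ha : a ∈ tube m) (g : Cn m → ℝ≥0∞) {s : Set (Cn m)}
    (hs : MeasurableSet s) :
    ∫⁻ z in transl a ⁻¹' s, g (transl a z) = erho a ^ (-((m : ℝ) + 2)) * ∫⁻ z in s, g z := by
  rw [← lintegral_indicator hs, ← lintegral_indicator ((continuous_transl a).measurable hs),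
    ← lintegral_transl ha]
  rfl

theorem continuous_rho₂_left (w : Cn m) : Continuous fun z => rho₂ z w := by
  unfold rho₂; fun_prop

/-! ### Invariant balls and comparability of the kernel -/

/-- A ball of the invariant geometry of the tubular domain, with a fixed radius. -/
def nbhd (a : Cn m) : Set (Cn m) := {z | z ∈ tube m ∧ ‖rho₂ z a‖ ^ 2 < 2 * rho z * rho a}

theorem nbhd_subset_tube (a : Cn m) : nbhd a ⊆ tube m := fun _ h => h.1

theorem mem_nbhd_symm {a z : Cn m} (ha : a ∈ tube m) (h : z ∈ nbhd a) : a ∈ nbhd z :=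
  ⟨ha, by rw [norm_rho₂_swap]; linarith [h.2]⟩

theorem mem_nbhd_comm {a z : Cn m} (ha : a ∈ tube m) (hz : z ∈ tube m) :
    z ∈ nbhd a ↔ a ∈ nbhd z :=
  ⟨mem_nbhd_symm ha, mem_nbhd_symm hz⟩

theorem isOpen_nbhd (a : Cn m) : IsOpen (nbhd a) := by
  have h : nbhd a = tube m ∩ {z | ‖rho₂ z a‖ ^ 2 < 2 * rho z * rho a} := by ext; exact Iff.rfl
  rw [h]
  refine isOpen_tube.inter (isOpen_lt ?_ ?_)
  · have := continuous_rho₂_left a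
    fun_prop
  · have := continuous_rho (m := m)
    fun_prop

theorem measurableSet_nbhd (a : Cn m) : MeasurableSet (nbhd a) := (isOpen_nbhd a).measurableSet

theorem measurableSet_nbhd_prod : MeasurableSet {p : Cn m × Cn m | p.1 ∈ nbhd p.2} := by
  have h1 := continuous_rho₂ (m := m)
  have h2 := continuous_rho (m := m)
  have h : {p : Cn m × Cn m | p.1 ∈ nbhd p.2} = Prod.fst ⁻¹' tube m ∩
      {p | ‖rho₂ p.1 p.2‖ ^ 2 < 2 * rho p.1 * rho p.2} := by ext; exact Iff.rfl
  rw [h]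
  exact ((isOpen_tube.preimage continuous_fst).inter
    (isOpen_lt (by fun_prop) (by fun_prop))).measurableSet

theorem self_mem_nbhd {a : Cn m} (ha : a ∈ tube m) : a ∈ nbhd a := by
  refine ⟨ha, ?_⟩
  have hpos := mem_tube_iff.1 ha
  have h := norm_rho₂_transl ha (basePoint m) (basePoint m)
  simp only [transl_basePoint, rho₂_basePoint, norm_one, mul_one] at h
  rw [h]; nlinarith

theorem transl_mem_nbhd {a : Cn m} (ha : a ∈ tube m) {z w : Cn m} :
    transl a z ∈ nbhd (transl a w) ↔ z ∈ nbhd w := by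
  have hpos := mem_tube_iff.1 ha
  simp only [nbhd, Set.mem_ofPred_eq, transl_mem_tube ha, norm_rho₂_transl ha, rho_transl ha]
  refine and_congr_right fun _ => ?_
  rw [mul_pow, show 2 * (rho a * rho z) * (rho a * rho w) = rho a ^ 2 * (2 * rho z * rho w) by ring]
  exact mul_lt_mul_iff_right₀ (by positivity)

theorem transl_preimage_nbhd {a : Cn m} (ha : a ∈ tube m) :
    transl a ⁻¹' nbhd a = nbhd (basePoint m) := by
  ext z
  have h := transl_mem_nbhd ha (z := z) (w := basePoint m)
  rwa [transl_basePoint] at h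

/-- Since ρ(z) ≤ 2|ρ(z,a)|, membership gives ρ(z)²/4 < 2ρ(z)ρ(a), which is where 8 comes from. Then
|ρ(z,a)|² < 16ρ(a)² gives the 4 of the next lemma. -/
theorem rho_le_of_mem_nbhd {a z : Cn m} (ha : a ∈ tube m) (h : z ∈ nbhd a) :
    rho z ≤ 8 * rho a := by
  have h1 := norm_rho₂_lower z a
  have h2 := h.2
  have hz := mem_tube_iff.1 h.1
  have ha := mem_tube_iff.1 ha
  by_contra hc
  push Not at hc
  nlinarith [norm_nonneg (rho₂ z a)]

theorem norm_rho₂_le_of_mem_nbhd {a z : Cn m} (ha : a ∈ tube m) (h : z ∈ nbhd a) :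
    ‖rho₂ z a‖ ≤ 4 * rho a := by
  have h1 := rho_le_of_mem_nbhd ha h
  have h2 := h.2
  have ha := mem_tube_iff.1 ha
  by_contra hc
  push Not at hc
  nlinarith [norm_nonneg (rho₂ z a)]

theorem sum_sq_le (z w : Cn m) :
    ∑ j : Fin m, ‖z j.castSucc - w j.castSucc‖ ^ 2 + 2 * rho z + 2 * rho w ≤ 4 * ‖rho₂ z w‖ := by
  rw [← rho₂_re z w]
  linarith [Complex.re_le_norm (rho₂ z w)]

theorem norm_last_add_I_le (z : Cn m) :
    ‖z (Fin.last m) + Complex.I‖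
      ≤ 2 * ‖rho₂ z (basePoint m)‖ + (∑ j : Fin m, ‖z j.castSucc‖ ^ 2) / 2 := by
  have h : z (Fin.last m) + Complex.I = (2 * Complex.I) * rho₂ z (basePoint m)
      - (Complex.I / 2) * ∑ j : Fin m, (z j.castSucc) ^ 2 := by
    unfold rho₂; simp
    linear_combination (z (Fin.last m) + Complex.I) * Complex.I_sq
  rw [h]
  refine (norm_sub_le _ _).trans ?_
  have h2 : ‖∑ j : Fin m, (z j.castSucc) ^ 2‖ ≤ ∑ j : Fin m, ‖z j.castSucc‖ ^ 2 :=
    (norm_sum_le _ _).trans (by simp)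
  simp only [norm_mul, norm_div, Complex.norm_I, Complex.norm_ofNat]
  linarith

theorem half_le_norm_rho₂_basePoint {z : Cn m} (hz : z ∈ tube m) :
    1 / 2 ≤ ‖rho₂ z (basePoint m)‖ := by
  have h := norm_rho₂_lower z (basePoint m)
  have := mem_tube_iff.1 hz
  simp at h; linarith

/-- A quasi-triangle inequality. The difference ρ(z,w) − ρ(𝐢,w) involves w only through z'·conj w'.
This is bounded by |z'|² and |w'|², and |w'|² ≤ 4|ρ(𝐢,w)|. -/
theorem norm_rho₂_le_mul_basePoint {z w : Cn m} (hz : z ∈ tube m) (hw : w ∈ tube m) :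
    ‖rho₂ z w‖ ≤ (4 + 8 * ‖rho₂ z (basePoint m)‖) * ‖rho₂ (basePoint m) w‖ := by
  have h2 := sum_sq_le z (basePoint m)
  have h3 := sum_sq_le (basePoint m) w
  have h4 := norm_last_add_I_le z
  have hzr := mem_tube_iff.1 hz
  have hwr := mem_tube_iff.1 hw
  have hR := half_le_norm_rho₂_basePoint hw
  rw [norm_rho₂_swap] at hR
  simp only [basePoint_castSucc, sub_zero, zero_sub, norm_neg, rho_basePoint] at h2 h3
  have h5 : ‖z (Fin.last m) - Complex.I‖ ≤ ‖z (Fin.last m) + Complex.I‖ + 2 := by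
    calc ‖z (Fin.last m) - Complex.I‖ = ‖(z (Fin.last m) + Complex.I) - 2 * Complex.I‖ := by
          congr 1; ring
      _ ≤ _ := by refine (norm_sub_le _ _).trans ?_; simp
  have h6 : rho₂ z w = rho₂ (basePoint m) w + (1 / 4) * (∑ j : Fin m,
      ((z j.castSucc) ^ 2 - 2 * z j.castSucc * (starRingEnd ℂ) (w j.castSucc))
      - 2 * Complex.I * (z (Fin.last m) - Complex.I)) := by
    unfold rho₂
    simp only [basePoint_castSucc, basePoint_last, zero_sub, neg_sq, Finset.sum_sub_distrib, sub_sq,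
      Finset.sum_add_distrib]
    ring
  have h7 : ‖∑ j : Fin m, ((z j.castSucc) ^ 2 - 2 * z j.castSucc * (starRingEnd ℂ) (w j.castSucc))‖
      ≤ 2 * ∑ j : Fin m, ‖z j.castSucc‖ ^ 2 + ∑ j : Fin m, ‖w j.castSucc‖ ^ 2 := by
    rw [Finset.mul_sum, ← Finset.sum_add_distrib]
    refine (norm_sum_le _ _).trans (Finset.sum_le_sum fun j _ => (norm_sub_le _ _).trans ?_)
    simp only [norm_pow, norm_mul, RCLike.norm_conj, Complex.norm_ofNat]
    nlinarith [sq_nonneg (‖z j.castSucc‖ - ‖w j.castSucc‖)]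
  rw [h6]
  refine (norm_add_le _ _).trans ?_
  have h8 := norm_sub_le (∑ j : Fin m,
      ((z j.castSucc) ^ 2 - 2 * z j.castSucc * (starRingEnd ℂ) (w j.castSucc)))
      (2 * Complex.I * (z (Fin.last m) - Complex.I))
  simp only [norm_mul, Complex.norm_I, Complex.norm_ofNat, norm_div, norm_one] at h8 ⊢
  nlinarith [norm_nonneg (rho₂ z (basePoint m))]

theorem norm_rho₂_le_mul {a z w : Cn m} (ha : a ∈ tube m) (hz : z ∈ tube m) (hw : w ∈ tube m) :
    ‖rho₂ z w‖ ≤ (4 + 8 * (‖rho₂ z a‖ / rho a)) * ‖rho₂ a w‖ := by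
  obtain ⟨z, rfl⟩ := exists_transl_eq ha z
  obtain ⟨w, rfl⟩ := exists_transl_eq ha w
  have hpos := mem_tube_iff.1 ha
  have h1 := norm_rho₂_le_mul_basePoint ((transl_mem_tube ha).1 hz) ((transl_mem_tube ha).1 hw)
  have h2 := norm_rho₂_transl ha (basePoint m) w
  have h3 := norm_rho₂_transl ha z (basePoint m)
  rw [transl_basePoint] at h2 h3
  rw [norm_rho₂_transl ha, h2, h3, mul_div_cancel_left₀ _ hpos.ne']
  nlinarith

/-- On the invariant ball |ρ(z,a)|/ρ(a) ≤ 4, so the transported quasi-triangle inequality has the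
constant 4 + 8·4 = 36, uniformly in w. -/
theorem norm_rho₂_comparable {a z w : Cn m} (ha : a ∈ tube m) (hz : z ∈ nbhd a)
    (hw : w ∈ tube m) : ‖rho₂ z w‖ ≤ 36 * ‖rho₂ a w‖ := by
  refine (norm_rho₂_le_mul ha hz.1 hw).trans ?_
  have h1 : ‖rho₂ z a‖ / rho a ≤ 4 := by
    rw [div_le_iff₀ (mem_tube_iff.1 ha)]; exact norm_rho₂_le_of_mem_nbhd ha hz
  gcongr
  linarith

theorem erho_le_of_mem_nbhd {a z : Cn m} (ha : a ∈ tube m) (h : z ∈ nbhd a) :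
    erho z ≤ 8 * erho a := by
  rw [erho, erho, show (8 : ℝ≥0∞) = ENNReal.ofReal 8 by simp, ← ENNReal.ofReal_mul (by norm_num)]
  exact ENNReal.ofReal_le_ofReal (rho_le_of_mem_nbhd ha h)

theorem ek_le_of_mem_nbhd {a z w : Cn m} (ha : a ∈ tube m) (h : z ∈ nbhd a) (hw : w ∈ tube m) :
    ek z w ≤ 36 * ek a w := by
  rw [ek_eq, ek_eq, show (36 : ℝ≥0∞) = ENNReal.ofReal 36 by simp,
    ← ENNReal.ofReal_mul (by norm_num)]
  exact ENNReal.ofReal_le_ofReal (norm_rho₂_comparable ha h hw)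

/-- Exponents of both signs occur later, so comparability is needed in both directions and the
constant carries |s|. -/
theorem rpow_le_mul_rpow {x y C : ℝ≥0∞} (hC : C ≠ ⊤) (hC0 : C ≠ 0) (hxy : x ≤ C * y)
    (hyx : y ≤ C * x) (s : ℝ) : x ^ s ≤ C ^ |s| * y ^ s := by
  rcases le_total 0 s with hs | hs
  · rw [abs_of_nonneg hs, ← ENNReal.mul_rpow_of_nonneg _ _ hs]
    exact ENNReal.rpow_le_rpow hxy hs
  · have h := ENNReal.rpow_le_rpow hyx (neg_nonneg.2 hs)
    rw [ENNReal.mul_rpow_of_nonneg _ _ (neg_nonneg.2 hs), ENNReal.rpow_neg y, ENNReal.rpow_neg x,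
      ← abs_of_nonpos hs] at h
    have hc1 : C ^ |s| ≠ ⊤ := ENNReal.rpow_ne_top_of_nonneg (abs_nonneg _) hC
    have hc0 : C ^ |s| ≠ 0 := (ENNReal.rpow_pos (pos_iff_ne_zero.2 hC0) hC).ne'
    have h' := ENNReal.inv_le_inv.2 h
    rw [inv_inv, ENNReal.mul_inv (Or.inl hc0) (Or.inl hc1), inv_inv] at h'
    calc x ^ s = C ^ |s| * ((C ^ |s|)⁻¹ * x ^ s) := by
          rw [← mul_assoc, ENNReal.mul_inv_cancel hc0 hc1, one_mul]
      _ ≤ _ := by gcongr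

theorem erho_rpow_le {a z : Cn m} (ha : a ∈ tube m) (h : z ∈ nbhd a) (s : ℝ) :
    erho z ^ s ≤ 8 ^ |s| * erho a ^ s :=
  rpow_le_mul_rpow (by simp) (by simp) (erho_le_of_mem_nbhd ha h)
    (erho_le_of_mem_nbhd h.1 (mem_nbhd_symm ha h)) s

theorem ek_rpow_le {a z w : Cn m} (ha : a ∈ tube m) (h : z ∈ nbhd a) (hw : w ∈ tube m) (s : ℝ) :
    ek z w ^ s ≤ 36 ^ |s| * ek a w ^ s :=
  rpow_le_mul_rpow (by simp) (by simp) (ek_le_of_mem_nbhd ha h hw)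
    (ek_le_of_mem_nbhd h.1 (mem_nbhd_symm ha h) hw) s

theorem ek_self {a : Cn m} (ha : a ∈ tube m) : ek a a = erho a := by
  have h := ek_transl ha (basePoint m) (basePoint m)
  rw [transl_basePoint] at h
  rw [h, ek_eq]; simp

theorem erho_rpow_le_ek {a z : Cn m} (ha : a ∈ tube m) (h : z ∈ nbhd a) (s : ℝ) :
    erho a ^ s ≤ 36 ^ |s| * ek z a ^ s := by
  have := ek_rpow_le h.1 (mem_nbhd_symm ha h) ha s
  rwa [ek_self ha] at this

theorem exists_ball_subset_nbhd :
    ∃ r > 0, Metric.ball (basePoint m) r ⊆ nbhd (basePoint m) :=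
  Metric.isOpen_iff.1 (isOpen_nbhd _) _ (self_mem_nbhd basePoint_mem)

/-! ### Compact exhaustion of the tube -/

/-- The exhaustion of the tubular domain by closed invariant balls. -/
def exhaust (m : ℕ) (N : ℝ) : Set (Cn m) :=
  {z | z ∈ tube m ∧ ‖rho₂ z (basePoint m)‖ ^ 2 ≤ N * rho z}

theorem exhaust_subset_tube (N : ℝ) : exhaust m N ⊆ tube m := fun _ h => h.1

theorem exhaust_mono {N M : ℝ} (h : N ≤ M) : exhaust m N ⊆ exhaust m M := fun _ hz =>
  ⟨hz.1, hz.2.trans (mul_le_mul_of_nonneg_right h (mem_tube_iff.1 hz.1).le)⟩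

theorem exhaust_pos {N : ℝ} {z : Cn m} (hz : z ∈ exhaust m N) : 0 < N := by
  have h1 := half_le_norm_rho₂_basePoint hz.1
  have h2 := hz.2
  by_contra hc
  push Not at hc
  have h4 := mul_nonpos_of_nonpos_of_nonneg hc (mem_tube_iff.1 hz.1).le
  have h5 : 0 < ‖rho₂ z (basePoint m)‖ ^ 2 := by positivity
  linarith

theorem exhaust_bounds {N : ℝ} {z : Cn m} (hz : z ∈ exhaust m N) :
    1 / 4 ≤ N * rho z ∧ ‖rho₂ z (basePoint m)‖ ≤ 2 * N := by
  have h1 := half_le_norm_rho₂_basePoint hz.1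
  have h2 := hz.2
  have h3 := mem_tube_iff.1 hz.1
  have h4 := norm_rho₂_lower z (basePoint m)
  simp only [rho_basePoint] at h4
  have hN := exhaust_pos hz
  constructor
  · nlinarith
  · by_contra hc
    push Not at hc
    nlinarith

theorem isCompact_exhaust (N : ℝ) : IsCompact (exhaust m N) := by
  have hr := continuous_rho (m := m)
  have hk := continuous_rho₂_left (basePoint m)
  rcases le_or_gt N 0 with hN | hN
  · have : exhaust m N = ∅ :=
      Set.eq_empty_of_forall_notMem fun z hz => (exhaust_pos hz).not_ge hN
    rw [this]; exact isCompact_empty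
  have hclosed : IsClosed (exhaust m N) := by
    -- The open condition ρ > 0 is traded for the closed one Nρ ≥ 1/4, which is automatic because
    -- |ρ(z,𝐢)| ≥ 1/2.
    have : exhaust m N = {z | 1 / 4 ≤ N * rho z ∧ ‖rho₂ z (basePoint m)‖ ^ 2 ≤ N * rho z} := by
      ext z
      refine ⟨fun hz => ⟨(exhaust_bounds hz).1, hz.2⟩, fun hz => ⟨mem_tube_iff.2 ?_, hz.2⟩⟩
      by_contra hc
      push Not at hc
      have := hz.1
      nlinarith
    rw [this, Set.ofPred_and]
    exact (isClosed_le (by fun_prop) (by fun_prop)).inter (isClosed_le (by fun_prop) (by fun_prop))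
  refine Metric.isCompact_of_isClosed_isBounded hclosed ?_
  refine isBounded_iff_forall_norm_le.2 ⟨8 * N + 8 * N + 2, fun z hz => ?_⟩
  obtain ⟨-, h2⟩ := exhaust_bounds hz
  have h3 := sum_sq_le z (basePoint m)
  have h4 := norm_last_add_I_le z
  have h5 := mem_tube_iff.1 hz.1
  simp only [basePoint_castSucc, sub_zero, rho_basePoint] at h3
  refine (pi_norm_le_iff_of_nonneg (by linarith)).2 fun i => ?_
  refine Fin.lastCases ?_ (fun j => ?_) i
  · calc ‖z (Fin.last m)‖ = ‖(z (Fin.last m) + Complex.I) - Complex.I‖ := by congr 1; ring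
      _ ≤ ‖z (Fin.last m) + Complex.I‖ + 1 := (norm_sub_le _ _).trans (by simp)
      _ ≤ _ := by linarith
  · have := Finset.single_le_sum (f := fun j : Fin m => ‖z j.castSucc‖ ^ 2)
      (fun _ _ => by positivity) (Finset.mem_univ j)
    have h6 : ‖z j.castSucc‖ ≤ 1 + ‖z j.castSucc‖ ^ 2 := by
      nlinarith [sq_nonneg (‖z j.castSucc‖ - 1)]
    linarith

theorem measurableSet_exhaust (N : ℝ) : MeasurableSet (exhaust m N) :=
  (isCompact_exhaust N).measurableSet

/-- On a compact subset the kernel is comparable to its value at the base point. -/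
theorem norm_rho₂_basePoint_le {N : ℝ} {z w : Cn m} (hz : z ∈ exhaust m N) (hw : w ∈ tube m) :
    ‖rho₂ (basePoint m) w‖ ≤ (4 + 64 * N ^ 2) * ‖rho₂ z w‖ := by
  refine (norm_rho₂_le_mul hz.1 basePoint_mem hw).trans ?_
  obtain ⟨h1, h2⟩ := exhaust_bounds hz
  have h3 := mem_tube_iff.1 hz.1
  have hN := exhaust_pos hz
  -- From |ρ(z,𝐢)| ≤ 2N and 1/ρ(z) ≤ 4N; multiplied by 8 this gives the 64N² of the statement.
  have h4 : ‖rho₂ (basePoint m) z‖ / rho z ≤ 8 * N ^ 2 := by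
    rw [div_le_iff₀ h3, norm_rho₂_swap]
    nlinarith
  refine mul_le_mul_of_nonneg_right ?_ (norm_nonneg _)
  linarith

theorem exists_subset_exhaust {K : Set (Cn m)} (hK : K ⊆ tube m) (hKc : IsCompact K) :
    ∃ N : ℝ, 0 < N ∧ K ⊆ exhaust m N := by
  have hr := continuous_rho (m := m)
  have hk := continuous_rho₂_left (basePoint m)
  have hc : ContinuousOn (fun z => ‖rho₂ z (basePoint m)‖ ^ 2 / rho z) K :=
    ContinuousOn.div (by fun_prop) (by fun_prop) fun z hz => (mem_tube_iff.1 (hK hz)).ne'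
  obtain ⟨N, hN⟩ := hKc.bddAbove_image hc
  refine ⟨max N 1, by positivity, fun z hz => ⟨hK hz, ?_⟩⟩
  rw [← div_le_iff₀ (mem_tube_iff.1 (hK hz))]
  exact (hN ⟨z, hz, rfl⟩).trans (le_max_left _ _)

/-- Across an invariant ball |ρ(·,𝐢)| changes by a factor of at most 36 and ρ by at most 8, and
10368 = 36²·8. -/
theorem mem_exhaust_of_mem_nbhd {N : ℝ} (hN : 0 ≤ N) {a z : Cn m} (ha : a ∈ tube m)
    (hz : z ∈ nbhd a) (h : z ∈ exhaust m N) : a ∈ exhaust m (10368 * N) := by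
  refine ⟨ha, ?_⟩
  have h1 := norm_rho₂_comparable h.1 (mem_nbhd_symm ha hz) basePoint_mem
  have h2 := rho_le_of_mem_nbhd ha hz
  have h3 := h.2
  have h4 := mem_tube_iff.1 h.1
  calc ‖rho₂ a (basePoint m)‖ ^ 2 ≤ (36 * ‖rho₂ z (basePoint m)‖) ^ 2 := by gcongr
    _ = 1296 * ‖rho₂ z (basePoint m)‖ ^ 2 := by ring
    _ ≤ 1296 * (N * (8 * rho a)) := by nlinarith
    _ = _ := by ring

theorem exists_mem_exhaust {z : Cn m} (hz : z ∈ tube m) : ∃ N : ℕ, z ∈ exhaust m N := by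
  obtain ⟨N, hN⟩ := exists_nat_ge (‖rho₂ z (basePoint m)‖ ^ 2 / rho z)
  exact ⟨N, hz, by rwa [div_le_iff₀ (mem_tube_iff.1 hz)] at hN⟩

/-! ### Forelli–Rudin integrals -/

theorem integrableOn_rpow_mul_one_add_rpow {s t : ℝ} (hs : -1 < s) (ht : s + 1 < t) :
    IntegrableOn (fun y : ℝ => y ^ s * (1 + y) ^ (-t)) (Set.Ioi 0) := by
  have hc : ContinuousOn (fun y : ℝ => y ^ s * (1 + y) ^ (-t)) (Set.Ioi 0) := by
    refine ContinuousOn.mul ?_ ?_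
    · exact continuousOn_id.rpow_const fun y hy => Or.inl (ne_of_gt hy)
    · refine (continuousOn_const.add continuousOn_id).rpow_const fun y hy => Or.inl ?_
      have : (0 : ℝ) < y := hy
      exact (add_pos one_pos this).ne'
  rw [← Set.Ioc_union_Ioi_eq_Ioi zero_le_one]
  refine IntegrableOn.union ?_ ?_
  · have h1 : IntegrableOn (fun y : ℝ => y ^ s) (Set.Ioc 0 1) :=
      (intervalIntegral.intervalIntegrable_rpow' hs).1
    refine h1.mono' ((hc.mono Set.Ioc_subset_Ioi_self).aestronglyMeasurable measurableSet_Ioc) ?_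
    refine ae_restrict_of_forall_mem measurableSet_Ioc fun y hy => ?_
    have hy0 := hy.1
    rw [Real.norm_of_nonneg (by positivity)]
    refine mul_le_of_le_one_right (by positivity) ?_
    exact Real.rpow_le_one_of_one_le_of_nonpos (by linarith) (by linarith)
  · have h1 : IntegrableOn (fun y : ℝ => y ^ (s - t)) (Set.Ioi 1) :=
      integrableOn_Ioi_rpow_of_lt (by linarith) zero_lt_one
    refine h1.mono' ((hc.mono (Set.Ioi_subset_Ioi zero_le_one)).aestronglyMeasurable
      measurableSet_Ioi) ?_
    refine ae_restrict_of_forall_mem measurableSet_Ioi fun y hy => ?_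
    have hy0 : (0 : ℝ) < y := zero_lt_one.trans hy
    rw [Real.norm_of_nonneg (by positivity), sub_eq_add_neg, Real.rpow_add hy0]
    gcongr ?_ * ?_
    exact Real.rpow_le_rpow_of_nonpos hy0 (by linarith) (by linarith)

/-- A majorant of the kernel in the last variable. -/
def lastMajorant (s t r : ℝ) (ζ : ℂ) : ℝ≥0∞ :=
  ENNReal.ofReal ((1 + |ζ.re|) ^ (-r)) *
    (Set.Ioi (0 : ℝ)).indicator (fun y => ENNReal.ofReal (y ^ s * (1 + y) ^ (-t))) ζ.im

theorem measurable_lastMajorant (s t r : ℝ) : Measurable (lastMajorant s t r) := by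
  unfold lastMajorant
  refine Measurable.mul (by fun_prop) ?_
  refine Measurable.comp (g := (Set.Ioi (0 : ℝ)).indicator
    (fun y => ENNReal.ofReal (y ^ s * (1 + y) ^ (-t)))) ?_ Complex.measurable_im
  exact Measurable.indicator (by fun_prop) measurableSet_Ioi

theorem lintegral_lastMajorant_lt_top {s t r : ℝ} (hs : -1 < s) (ht : s + 1 < t) (hr : 1 < r) :
    ∫⁻ ζ, lastMajorant s t r ζ < ⊤ := by
  have h1 : ∫⁻ x : ℝ, ENNReal.ofReal ((1 + |x|) ^ (-r)) < ⊤ := by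
    have := finite_integral_one_add_norm (E := ℝ) (μ := volume) (r := r) (by simpa using hr)
    simpa only [Real.norm_eq_abs] using this
  have h2 : ∫⁻ y : ℝ, (Set.Ioi (0 : ℝ)).indicator
      (fun y => ENNReal.ofReal (y ^ s * (1 + y) ^ (-t))) y < ⊤ := by
    rw [lintegral_indicator measurableSet_Ioi]
    exact (integrableOn_rpow_mul_one_add_rpow hs ht).lintegral_lt_top
  have h3 : ∫⁻ ζ, lastMajorant s t r ζ = ∫⁻ p : ℝ × ℝ, ENNReal.ofReal ((1 + |p.1|) ^ (-r)) *
      (Set.Ioi (0 : ℝ)).indicator (fun y => ENNReal.ofReal (y ^ s * (1 + y) ^ (-t))) p.2 :=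
    (Complex.volume_preserving_equiv_real_prod.lintegral_comp_emb
      Complex.measurableEquivRealProd.measurableEmbedding
      (fun p : ℝ × ℝ => ENNReal.ofReal ((1 + |p.1|) ^ (-r)) *
      (Set.Ioi (0 : ℝ)).indicator (fun y => ENNReal.ofReal (y ^ s * (1 + y) ^ (-t))) p.2))
  rw [h3]
  have h4 := lintegral_prod_mul (μ := (volume : Measure ℝ)) (ν := (volume : Measure ℝ))
    (f := fun x => ENNReal.ofReal ((1 + |x|) ^ (-r)))
    (g := (Set.Ioi (0 : ℝ)).indicator (fun y => ENNReal.ofReal (y ^ s * (1 + y) ^ (-t))))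
    (by fun_prop) (Measurable.indicator (by fun_prop) measurableSet_Ioi).aemeasurable
  rw [Measure.volume_eq_prod, h4]
  exact ENNReal.mul_lt_top h1 h2

theorem lintegral_cn_eq (F : Cn m → ℝ≥0∞) :
    ∫⁻ w, F w = ∫⁻ p : ℂ × (Fin m → ℂ), F (Fin.snoc (α := fun _ => ℂ) p.2 p.1) := by
  have h := volume_preserving_piFinSuccAbove (fun _ : Fin (m + 1) => ℂ) (Fin.last m)
  rw [← h.lintegral_comp_emb (MeasurableEquiv.measurableEmbedding _)]
  refine lintegral_congr fun w => ?_
  congr 1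
  ext i
  refine Fin.lastCases ?_ (fun j => ?_) i <;> simp [Fin.init]

theorem lintegral_prod_one_add_lt_top {θ : ℝ} (hθ : 1 < θ) :
    ∫⁻ u : Fin m → ℂ, ENNReal.ofReal (∏ j, (1 + ‖u j‖ ^ 2) ^ (-θ)) < ⊤ := by
  have h : Integrable (fun ζ : ℂ => (1 + ‖ζ‖ ^ 2) ^ (-θ)) := by
    have := integrable_rpow_neg_one_add_norm_sq (E := ℂ) (μ := volume) (r := 2 * θ)
      (by simp; linarith)
    have e : -(2 * θ) / 2 = -θ := by ring
    rwa [e] at this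
  exact (Integrable.fintype_prod (f := fun (_ : Fin m) (ζ : ℂ) => (1 + ‖ζ‖ ^ 2) ^ (-θ))
    fun _ => h).lintegral_lt_top

/-- The real shear that straightens the tubular domain. -/
def shear (u : Fin m → ℂ) : ℂ :=
  ((∑ j, ((starRingEnd ℂ) (u j) ^ 2).im) / 2 : ℝ) - (∑ j, (u j).im ^ 2 : ℝ) * Complex.I

theorem measurable_shear : Measurable (shear (m := m)) := by
  unfold shear
  have : Continuous (shear (m := m)) := by unfold shear; fun_prop
  exact this.measurable

/-- For fixed w' the shear only translates w_n, so it drops out of the inner integral and the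
majorant becomes a product of convergent integrals in one complex or real variable. -/
theorem lintegral_shear_lt_top {s t r θ : ℝ} (hs : -1 < s) (ht : s + 1 < t) (hr : 1 < r)
    (hθ : 1 < θ) :
    ∫⁻ w : Cn m, ENNReal.ofReal (∏ j : Fin m, (1 + ‖w j.castSucc‖ ^ 2) ^ (-θ)) *
      lastMajorant s t r (w (Fin.last m) + shear fun j => w j.castSucc) < ⊤ := by
  rw [lintegral_cn_eq]
  simp only [Fin.snoc_castSucc, Fin.snoc_last]
  have hm := measurable_lastMajorant s t r
  have hsh := measurable_shear (m := m)
  rw [Measure.volume_eq_prod, lintegral_prod_symm _ (by fun_prop)]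
  have : ∀ u : Fin m → ℂ, ∫⁻ ζ : ℂ, ENNReal.ofReal (∏ j, (1 + ‖u j‖ ^ 2) ^ (-θ)) *
      lastMajorant s t r (ζ + shear u) = ENNReal.ofReal (∏ j, (1 + ‖u j‖ ^ 2) ^ (-θ)) *
      ∫⁻ ζ, lastMajorant s t r ζ := fun u => by
    rw [lintegral_const_mul _ (by fun_prop), lintegral_add_right_eq_self]
  simp only [this]
  rw [lintegral_mul_const _ (by fun_prop)]
  exact ENNReal.mul_lt_top (lintegral_prod_one_add_lt_top hθ)
    (lintegral_lastMajorant_lt_top hs ht hr)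

theorem abs_re_add_shear_le (w : Cn m) :
    |(w (Fin.last m) + shear fun j => w j.castSucc).re| ≤ 2 * ‖rho₂ (basePoint m) w‖ := by
  have h : (w (Fin.last m) + shear fun j => w j.castSucc).re = 2 * (rho₂ (basePoint m) w).im := by
    unfold rho₂ shear
    rw [show (1 / 4 : ℂ) = ((1 / 4 : ℝ) : ℂ) by norm_num, Complex.im_ofReal_mul]
    have : ∀ x : ℝ, ((x : ℂ) ^ 2).im = 0 := fun x => by rw [← Complex.ofReal_pow, Complex.ofReal_im]
    simp [Complex.mul_im, this]
    ring
  rw [h, abs_mul, abs_two]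
  have := Complex.abs_im_le_norm (rho₂ (basePoint m) w)
  linarith

theorem im_add_shear (w : Cn m) :
    (w (Fin.last m) + shear fun j => w j.castSucc).im = rho w := by
  unfold shear rho
  rw [Complex.add_im, Complex.sub_im, Complex.ofReal_im, Complex.im_ofReal_mul]
  simp; ring

/-- The quantity 4|ρ(𝐢,w)| dominates each 1 + |w_j|², and also 1 + ρ(w) and 1 + |Re(w_n + shear)|.
Distributing the exponent over these lower bounds bounds the kernel by separated factors. -/
theorem kernel_le_majorant {w : Cn m} (hw : w ∈ tube m) {s t r θ : ℝ} (ht : 0 ≤ t) (hr : 0 ≤ r)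
    (hθ : 0 ≤ θ) :
    erho w ^ s * ek (basePoint m) w ^ (-(m * θ + t + r)) ≤ ENNReal.ofReal (4 ^ (m * θ + t + r)) *
      (ENNReal.ofReal (∏ j : Fin m, (1 + ‖w j.castSucc‖ ^ 2) ^ (-θ)) *
      lastMajorant s t r (w (Fin.last m) + shear fun j => w j.castSucc)) := by
  have hpos := mem_tube_iff.1 hw
  have hR := norm_rho₂_pos basePoint_mem hw
  have hsum := sum_sq_le (basePoint m) w
  have hre := abs_re_add_shear_le w
  have hhalf := half_le_norm_rho₂_basePoint hw
  rw [norm_rho₂_swap] at hhalf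
  simp only [basePoint_castSucc, zero_sub, norm_neg, rho_basePoint] at hsum
  set R := ‖rho₂ (basePoint m) w‖ with hRdef
  have hj : ∀ j : Fin m, 1 + ‖w j.castSucc‖ ^ 2 ≤ 4 * R := fun j => by
    have := Finset.single_le_sum (f := fun j : Fin m => ‖w j.castSucc‖ ^ 2)
      (fun _ _ => by positivity) (Finset.mem_univ j)
    linarith
  have hsn : 0 ≤ ∑ j : Fin m, ‖w j.castSucc‖ ^ 2 := Finset.sum_nonneg fun _ _ => by positivity
  have h1 : (4 * R) ^ (-(m * θ)) ≤ ∏ j : Fin m, (1 + ‖w j.castSucc‖ ^ 2) ^ (-θ) := by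
    have : (4 * R) ^ (-(m * θ)) = ∏ j : Fin m, (4 * R) ^ (-θ) := by
      rw [Finset.prod_const, Finset.card_univ, Fintype.card_fin, ← Real.rpow_natCast,
        ← Real.rpow_mul (by positivity)]
      congr 1; ring
    rw [this]
    exact Finset.prod_le_prod (fun _ _ => by positivity) fun j _ =>
      Real.rpow_le_rpow_of_nonpos (by positivity) (hj j) (by linarith)
  have h2 : (4 * R) ^ (-t) ≤ (1 + rho w) ^ (-t) :=
    Real.rpow_le_rpow_of_nonpos (by positivity) (by linarith) (by linarith)
  have h3 : (4 * R) ^ (-r) ≤ (1 + |(w (Fin.last m) + shear fun j => w j.castSucc).re|) ^ (-r) :=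
    Real.rpow_le_rpow_of_nonpos (by positivity) (by linarith) (by linarith)
  have h4 : R ^ (-(m * θ + t + r))
      = 4 ^ (m * θ + t + r) * ((4 * R) ^ (-(m * θ)) * ((4 * R) ^ (-r) * (4 * R) ^ (-t))) := by
    rw [← Real.rpow_add (by positivity), ← Real.rpow_add (by positivity),
      Real.mul_rpow (by norm_num) hR.le, ← mul_assoc, ← Real.rpow_add (by norm_num)]
    rw [show m * θ + t + r + (-(m * θ) + (-r + -t)) = 0 by ring, Real.rpow_zero, one_mul]
    congr 1; ring
  rw [erho_rpow hw, ek_rpow basePoint_mem hw, lastMajorant, im_add_shear,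
    Set.indicator_of_mem (show rho w ∈ Set.Ioi 0 from hpos), ← ENNReal.ofReal_mul (by positivity),
    ← ENNReal.ofReal_mul (by positivity),
    ← ENNReal.ofReal_mul (Finset.prod_nonneg fun _ _ => by positivity),
    ← ENNReal.ofReal_mul (by positivity), ← hRdef, h4]
  refine ENNReal.ofReal_le_ofReal ?_
  calc rho w ^ s * (4 ^ (m * θ + t + r) *
        ((4 * R) ^ (-(m * θ)) * ((4 * R) ^ (-r) * (4 * R) ^ (-t))))
      = 4 ^ (m * θ + t + r) *
        ((4 * R) ^ (-(m * θ)) * ((4 * R) ^ (-r) * (rho w ^ s * (4 * R) ^ (-t)))) := by ring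
    _ ≤ _ := by gcongr

/-- The constant in the Forelli–Rudin type identity. -/
def frConst (m : ℕ) (s t : ℝ) : ℝ≥0∞ :=
  ∫⁻ w in tube m, erho w ^ s * ek (basePoint m) w ^ (-t)

theorem frConst_lt_top {s t : ℝ} (hs : -1 < s) (ht : (m : ℝ) + 2 + s < t) :
    frConst m s t < ⊤ := by
  -- The surplus of t over the critical exponent is shared equally by the m + 2 factors: m with
  -- exponent θ, one for the imaginary and one for the real part of the last variable.
  set δ := (t - (m + 2 + s)) / (m + 2) with hδ
  have hδ0 : 0 < δ := div_pos (by linarith) (by positivity)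
  have e : t = m * (1 + δ) + (s + 1 + δ) + (1 + δ) := by
    have : δ * (m + 2) = t - (m + 2 + s) := by rw [hδ]; field_simp
    linarith
  have h := lintegral_shear_lt_top (m := m) (s := s) (t := s + 1 + δ) (r := 1 + δ) (θ := 1 + δ) hs
    (by linarith) (by linarith) (by linarith)
  refine lt_of_le_of_lt ?_ (ENNReal.mul_lt_top
    (ENNReal.ofReal_lt_top (r := 4 ^ (m * (1 + δ) + (s + 1 + δ) + (1 + δ)))) h)
  rw [frConst, ← lintegral_const_mul' _ _ ENNReal.ofReal_ne_top, e]
  refine (setLIntegral_mono' measurableSet_tube fun w hw => ?_).trans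
    (setLIntegral_le_lintegral _ _)
  exact kernel_le_majorant hw (by linarith) (by linarith) (by linarith)

/-- Substitute the automorphism taking 𝐢 to z: the integrand contributes ρ(z)^(s−t) and the Jacobian
ρ(z)^(m+2). The identity is exact, and remains true when the constant is infinite. -/
theorem forelliRudin {z : Cn m} (hz : z ∈ tube m) (s t : ℝ) :
    ∫⁻ w in tube m, erho w ^ s * ek z w ^ (-t)
      = frConst m s t * erho z ^ ((m : ℝ) + 2 + s - t) := by
  have h := setLIntegral_transl hz (fun w => erho w ^ s * ek z w ^ (-t)) measurableSet_tube
  have hpre : transl z ⁻¹' tube m = tube m := by ext; exact transl_mem_tube hz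
  have e : ∀ w, erho (transl z w) ^ s * ek z (transl z w) ^ (-t)
      = erho z ^ (s - t) * (erho w ^ s * ek (basePoint m) w ^ (-t)) := fun w => by
    have := ek_transl hz (basePoint m) w
    rw [transl_basePoint] at this
    rw [this, erho_transl hz, ENNReal.mul_rpow_of_ne_top (erho_ne_top _) (erho_ne_top _),
      ENNReal.mul_rpow_of_ne_top (erho_ne_top _) (ek_ne_top _ _), sub_eq_add_neg,
      ENNReal.rpow_add _ _ (erho_ne_zero hz) (erho_ne_top _)]
    ring
  have hne : erho z ^ (s - t) ≠ ⊤ := by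
    rw [erho_rpow hz]; exact ENNReal.ofReal_ne_top
  simp only [e, hpre] at h
  rw [lintegral_const_mul' _ _ hne] at h
  calc _ = erho z ^ ((m : ℝ) + 2) * (erho z ^ (-((m : ℝ) + 2)) *
        ∫⁻ w in tube m, erho w ^ s * ek z w ^ (-t)) := by
        rw [← mul_assoc, ← ENNReal.rpow_add _ _ (erho_ne_zero hz) (erho_ne_top _)]; simp
    _ = _ := by
      rw [← h, ← mul_assoc, ← ENNReal.rpow_add _ _ (erho_ne_zero hz) (erho_ne_top _), mul_comm,
        frConst]
      congr 2; ring

/-! ### Submean value property of |f|^q for every q > 0 -/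

open Classical in
theorem measurable_indicator_of_continuousOn {X Y : Type*} [TopologicalSpace X] [MeasurableSpace X]
    [OpensMeasurableSpace X] [TopologicalSpace Y] [MeasurableSpace Y] [BorelSpace Y] [Zero Y]
    {f : X → Y} {s : Set X} (hf : ContinuousOn f s) (hs : MeasurableSet s) :
    Measurable (s.indicator f) := by
  rw [← Set.piecewise_eq_indicator]
  exact hf.measurable_piecewise continuousOn_const hs

-- Jensen's formula: the average exceeds log|g(0)| by a sum over the zeros u in the disc of
-- multiplicity times log(1/|u|), and every term is nonnegative.
open Metric Real in
theorem log_norm_le_circleAverage {g : ℂ → ℂ} (hg : AnalyticOnNhd ℂ g (closedBall 0 1))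
    (h0 : g 0 ≠ 0) : Real.log ‖g 0‖ ≤ circleAverage (fun z => Real.log ‖g z‖) 0 1 := by
  have hg' : AnalyticOnNhd ℂ g (closedBall 0 |1|) := by simpa using hg
  rw [hg'.circleAverage_log_norm one_ne_zero h0]
  refine le_add_of_nonneg_left (finsum_nonneg fun u => ?_)
  by_cases hu : u ∈ closedBall (0 : ℂ) |1|
  · refine mul_nonneg (mod_cast MeromorphicOn.AnalyticOnNhd.divisor_nonneg hg' u) ?_
    simp only [zero_sub, norm_neg, one_mul]
    have : ‖u‖ ≤ 1 := by simpa using hu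
    rw [Real.log_inv]
    exact neg_nonneg.2 (Real.log_nonpos (norm_nonneg _) this)
  · rw [Function.locallyFinsuppWithin.apply_eq_zero_of_notMem _ hu]; simp

-- The function log|g| satisfies the submean inequality and |g|^q = exp(q log|g|). Convexity of exp
-- is used through its tangent line at log A, where A = |g(0)|^q, so that one pointwise inequality
-- can be averaged.
open Metric Real in
theorem norm_rpow_le_circleAverage {g : ℂ → ℂ} (hg : AnalyticOnNhd ℂ g (closedBall 0 1))
    {q : ℝ} (hq : 0 < q) : ‖g 0‖ ^ q ≤ circleAverage (fun z => ‖g z‖ ^ q) 0 1 := by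
  have hcont : ContinuousOn (fun z => ‖g z‖ ^ q) (sphere 0 1) :=
    ((hg.continuousOn.mono sphere_subset_closedBall).norm).rpow_const fun _ _ => Or.inr hq.le
  have hint : CircleIntegrable (fun z => ‖g z‖ ^ q) 0 1 := hcont.circleIntegrable zero_le_one
  by_cases h0 : g 0 = 0
  · rw [h0, norm_zero, Real.zero_rpow hq.ne']
    exact circleAverage_nonneg_of_nonneg fun z _ => by positivity
  set A := ‖g 0‖ ^ q with hA
  have hA0 : 0 < A := Real.rpow_pos_of_pos (norm_pos_iff.2 h0) _
  -- At a zero of g `Real.log` is 0, so F is 1 there rather than 0. Zeros are isolated, so F and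
  -- |g|^q agree codiscretely, which suffices for the averages.
  set F : ℂ → ℝ := fun z => Real.exp (q * Real.log ‖g z‖) with hF
  have hae : (fun z => ‖g z‖ ^ q) =ᶠ[codiscreteWithin (sphere 0 |1|)] F := by
    have h1 : g ⁻¹' {0}ᶜ ∈ codiscreteWithin (closedBall (0 : ℂ) 1) :=
      hg.preimage_zero_mem_codiscreteWithin h0 (by simp)
        ⟨⟨0, by simp⟩, (convex_closedBall (0 : ℂ) 1).isPreconnected⟩
    have h2 : g ⁻¹' {0}ᶜ ∈ codiscreteWithin (sphere (0 : ℂ) |1|) :=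
      codiscreteWithin_mono (by rw [abs_one]; exact sphere_subset_closedBall) h1
    filter_upwards [h2] with z hz
    have hz' : 0 < ‖g z‖ := norm_pos_iff.2 (by simpa using hz)
    rw [hF, Real.rpow_def_of_pos hz', mul_comm]
  have hFint : CircleIntegrable F 0 1 := hint.congr_codiscreteWithin hae
  have hlog : CircleIntegrable (fun z => Real.log ‖g z‖) 0 1 := by
    apply MeromorphicOn.circleIntegrable_log_norm
    intro z hz
    exact (hg z (sphere_subset_closedBall (by simpa using hz))).meromorphicAt
  rw [circleAverage_congr_codiscreteWithin hae one_ne_zero]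
  have hle : ∀ z, A * (1 - Real.log A) + (A * q) * Real.log ‖g z‖ ≤ F z := by
    intro z
    have h1 := Real.add_one_le_exp (q * Real.log ‖g z‖ - Real.log A)
    have h2 : F z = A * Real.exp (q * Real.log ‖g z‖ - Real.log A) := by
      rw [Real.exp_sub, Real.exp_log hA0]; field_simp; rfl
    rw [h2]; nlinarith
  have h3 : CircleIntegrable (fun z => (A * q) * Real.log ‖g z‖) 0 1 := hlog.const_smul
  have h4 := circleAverage_mono (f₁ := fun z => A * (1 - Real.log A) + (A * q) * Real.log ‖g z‖)
    ((circleIntegrable_const _ _ _).add h3) hFint fun z _ => hle z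
  rw [circleAverage_fun_add (circleIntegrable_const _ _ _) h3, circleAverage_const] at h4
  have h5 : circleAverage (fun z => (A * q) * Real.log ‖g z‖) 0 1
      = (A * q) * circleAverage (fun z => Real.log ‖g z‖) 0 1 := by
    have := circleAverage_fun_smul (a := A * q) (f := fun z => Real.log ‖g z‖) (c := 0) (R := 1)
    simpa only [smul_eq_mul] using this
  rw [h5] at h4
  have h6 := mul_le_mul_of_nonneg_left (log_norm_le_circleAverage hg h0) (by positivity : 0 ≤ A * q)
  have h7 : Real.log A = q * Real.log ‖g 0‖ := Real.log_rpow (norm_pos_iff.2 h0) _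
  nlinarith

open Metric in
theorem enorm_rpow_le_lintegral_circle {g : ℂ → ℂ} (hg : AnalyticOnNhd ℂ g (closedBall 0 1))
    {q : ℝ} (hq : 0 < q) : ENNReal.ofReal (2 * Real.pi) * ‖g 0‖ₑ ^ q
      ≤ ∫⁻ θ in Set.Ioc 0 (2 * Real.pi), ‖g (circleMap 0 1 θ)‖ₑ ^ q := by
  have h := norm_rpow_le_circleAverage hg hq
  have hcont : ContinuousOn (fun z => ‖g z‖ ^ q) (sphere 0 1) :=
    ((hg.continuousOn.mono sphere_subset_closedBall).norm).rpow_const fun _ _ => Or.inr hq.le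
  have hint : CircleIntegrable (fun z => ‖g z‖ ^ q) 0 1 := hcont.circleIntegrable zero_le_one
  have hpi := Real.two_pi_pos
  rw [Real.circleAverage_def, smul_eq_mul, ← div_eq_inv_mul, le_div_iff₀ hpi,
    intervalIntegral.integral_of_le hpi.le] at h
  have e : ∀ z, ‖g z‖ₑ ^ q = ENNReal.ofReal (‖g z‖ ^ q) := fun z => by
    rw [← ENNReal.ofReal_rpow_of_nonneg (norm_nonneg _) hq.le, ofReal_norm]
  simp only [e]
  rw [← ofReal_integral_eq_lintegral_ofReal hint.1 (Eventually.of_forall fun _ => by positivity),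
    ← ENNReal.ofReal_mul hpi.le, mul_comm]
  exact ENNReal.ofReal_le_ofReal h

theorem measurePreserving_circle_smul (c : Circle) :
    MeasurePreserving (fun v : Cn m => (c : ℂ) • v) :=
  volume_preserving_pi (f := fun (_ : Fin (m + 1)) (z : ℂ) => (c : ℂ) * z)
    fun _ => (rotation c).measurePreserving

-- Apply the disc inequality to t ↦ f(a + tv) and integrate over v. For each θ the rotation v ↦
-- e^{iθ}v preserves volume and the ball, so the θ-integral only contributes 2π.
open Metric in
theorem submean_ball {f : Cn m → ℂ} {a : Cn m} {r : ℝ}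
    (hf : DifferentiableOn ℂ f (ball a r)) {q : ℝ} (hq : 0 < q) :
    volume (ball (0 : Cn m) r) * ‖f a‖ₑ ^ q ≤ ∫⁻ z in ball a r, ‖f z‖ₑ ^ q := by
  set G : Cn m → ℝ≥0∞ := (ball a r).indicator fun z => ‖f z‖ₑ ^ q with hG
  have hGm : Measurable G := by
    have h1 : ContinuousOn (fun z => ‖f z‖ₑ ^ q) (ball a r) :=
      ENNReal.continuous_rpow_const.comp_continuousOn hf.continuousOn.enorm
    exact measurable_indicator_of_continuousOn h1 measurableSet_ball
  have hpt : ∀ v ∈ ball (0 : Cn m) r, ENNReal.ofReal (2 * Real.pi) * ‖f a‖ₑ ^ q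
      ≤ ∫⁻ θ in Set.Ioc 0 (2 * Real.pi), G (a + circleMap 0 1 θ • v) := by
    intro v hv
    have hv' : ‖v‖ < r := by simpa using hv
    have hopen : IsOpen {t : ℂ | ‖t • v‖ < r} := isOpen_lt (by fun_prop) continuous_const
    have hd : DifferentiableOn ℂ (fun t : ℂ => f (a + t • v)) {t : ℂ | ‖t • v‖ < r} := by
      refine hf.comp (by fun_prop) fun t ht => ?_
      have : ‖t • v‖ < r := ht
      simpa [mem_ball_iff_norm] using this
    have hsub : closedBall (0 : ℂ) 1 ⊆ {t : ℂ | ‖t • v‖ < r} := fun t ht => by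
      have ht1 : ‖t‖ ≤ 1 := by simpa using ht
      change ‖t • v‖ < r
      rw [norm_smul]
      nlinarith [norm_nonneg v]
    have := enorm_rpow_le_lintegral_circle ((hd.analyticOnNhd hopen).mono hsub) hq
    simp only [zero_smul, add_zero] at this
    refine this.trans (lintegral_mono fun θ => ?_)
    have hmem : a + circleMap 0 1 θ • v ∈ ball a r := by
      rw [mem_ball_iff_norm, add_sub_cancel_left, norm_smul]; simpa using hv'
    simp only [hG, Set.indicator_of_mem hmem, le_refl]
  have hpi : ENNReal.ofReal (2 * Real.pi) ≠ 0 := by simpa using Real.pi_pos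
  have h1 : ENNReal.ofReal (2 * Real.pi) * (volume (ball (0 : Cn m) r) * ‖f a‖ₑ ^ q)
      ≤ ∫⁻ v in ball (0 : Cn m) r, ∫⁻ θ in Set.Ioc 0 (2 * Real.pi),
        G (a + circleMap 0 1 θ • v) := by
    calc _ = ∫⁻ _ in ball (0 : Cn m) r, ENNReal.ofReal (2 * Real.pi) * ‖f a‖ₑ ^ q := by
          rw [setLIntegral_const]; ring
      _ ≤ _ := setLIntegral_mono' measurableSet_ball hpt
  have hmeas : Measurable (Function.uncurry fun (v : Cn m) (θ : ℝ) =>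
      G (a + circleMap 0 1 θ • v)) := by
    refine hGm.comp (Continuous.measurable ?_)
    have := continuous_circleMap 0 1
    fun_prop
  rw [lintegral_lintegral_swap hmeas.aemeasurable] at h1
  have h2 : ∀ θ : ℝ, ∫⁻ v in ball (0 : Cn m) r, G (a + circleMap 0 1 θ • v)
      = ∫⁻ z in ball a r, ‖f z‖ₑ ^ q := by
    intro θ
    have e1 := (measurePreserving_circle_smul (m := m) (Circle.exp θ)).setLIntegral_comp_preimage
      (measurableSet_ball (x := (0 : Cn m)) (ε := r)) (f := fun v => G (a + v))
      (hGm.comp (measurable_const_add a))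
    have e2 : (fun v : Cn m => ((Circle.exp θ : Circle) : ℂ) • v) ⁻¹' ball 0 r = ball 0 r := by
      ext v; simp [norm_smul]
    have e3 : ∀ v : Cn m, ((Circle.exp θ : Circle) : ℂ) • v = circleMap 0 1 θ • v := fun v => by
      simp [circleMap]
    rw [e2] at e1
    simp only [e3] at e1
    rw [e1, ← lintegral_indicator measurableSet_ball, ← lintegral_indicator measurableSet_ball]
    rw [← lintegral_add_left_eq_self ((ball a r).indicator fun z => ‖f z‖ₑ ^ q) a]
    refine lintegral_congr fun v => ?_
    by_cases hv : v ∈ ball (0 : Cn m) r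
    · rw [Set.indicator_of_mem hv]
    · rw [Set.indicator_of_notMem hv, Set.indicator_of_notMem]
      simpa [mem_ball_iff_norm] using hv
  simp only [h2] at h1
  rw [setLIntegral_const, Real.volume_Ioc, sub_zero, mul_comm _ (ENNReal.ofReal (2 * Real.pi))] at h1
  exact (ENNReal.mul_le_mul_iff_right hpi ENNReal.ofReal_ne_top).1 h1

/-- The constant of the mean value inequality on invariant balls. -/
theorem exists_submean (m : ℕ) : ∃ C : ℝ≥0∞, C ≠ 0 ∧ C ≠ ⊤ ∧ ∀ (f : Cn m → ℂ),
    DifferentiableOn ℂ f (tube m) → ∀ q : ℝ, 0 < q → ∀ a ∈ tube m,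
      ‖f a‖ₑ ^ q ≤ C * erho a ^ (-((m : ℝ) + 2)) * ∫⁻ z in nbhd a, ‖f z‖ₑ ^ q := by
  obtain ⟨r, hr, hsub⟩ := exists_ball_subset_nbhd (m := m)
  have hv0 : volume (Metric.ball (0 : Cn m) r) ≠ 0 := (Metric.measure_ball_pos _ _ hr).ne'
  have hvt : volume (Metric.ball (0 : Cn m) r) ≠ ⊤ := measure_ball_lt_top.ne
  refine ⟨(volume (Metric.ball (0 : Cn m) r))⁻¹, ENNReal.inv_ne_zero.2 hvt,
    ENNReal.inv_ne_top.2 hv0, fun f hf q hq a ha => ?_⟩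
  -- Pulling f back to the base point makes one fixed Euclidean ball serve every a; its volume gives
  -- a constant independent of f, q and a.
  have hd : DifferentiableOn ℂ (fun z => f (transl a z)) (Metric.ball (basePoint m) r) :=
    hf.comp (differentiable_transl a).differentiableOn fun z hz =>
      (transl_mem_tube ha).2 (hsub hz).1
  have h := submean_ball hd hq
  rw [transl_basePoint] at h
  have h2 : ∫⁻ z in Metric.ball (basePoint m) r, ‖f (transl a z)‖ₑ ^ q
      ≤ erho a ^ (-((m : ℝ) + 2)) * ∫⁻ z in nbhd a, ‖f z‖ₑ ^ q := by
    rw [← setLIntegral_transl ha (fun z => ‖f z‖ₑ ^ q) (measurableSet_nbhd a),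
      transl_preimage_nbhd ha]
    exact lintegral_mono_set hsub
  rw [mul_assoc, ← ENNReal.div_eq_inv_mul, ENNReal.le_div_iff_mul_le (Or.inl hv0) (Or.inl hvt),
    mul_comm]
  exact h.trans h2

/-! ### Weighted integrals and the Schur test -/

theorem erho_rpow_ne_top {z : Cn m} (hz : z ∈ tube m) (s : ℝ) : erho z ^ s ≠ ⊤ := by
  rw [erho_rpow hz]; exact ENNReal.ofReal_ne_top

theorem erho_rpow_ne_zero {z : Cn m} (hz : z ∈ tube m) (s : ℝ) : erho z ^ s ≠ 0 :=
  (ENNReal.rpow_pos (pos_iff_ne_zero.2 (erho_ne_zero hz)) (erho_ne_top z)).ne'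

theorem erho_rpow_add {z : Cn m} (hz : z ∈ tube m) (s t : ℝ) :
    erho z ^ (s + t) = erho z ^ s * erho z ^ t :=
  ENNReal.rpow_add _ _ (erho_ne_zero hz) (erho_ne_top z)

theorem ek_rpow_add {z w : Cn m} (hz : z ∈ tube m) (hw : w ∈ tube m) (s t : ℝ) :
    ek z w ^ (s + t) = ek z w ^ s * ek z w ^ t :=
  ENNReal.rpow_add _ _ (ek_ne_zero hz hw) (ek_ne_top z w)

theorem lintegral_weightedVolume (α : ℝ) (g : Cn m → ℝ≥0∞) :
    ∫⁻ z, g z ∂(weightedVolume m α) = ∫⁻ z in tube m, erho z ^ α * g z := by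
  have hr := (continuous_rho (m := m)).measurable
  rw [weightedVolume, lintegral_withDensity_eq_lintegral_mul_non_measurable _ (by fun_prop)
    (Eventually.of_forall fun _ => ENNReal.ofReal_lt_top)]
  refine setLIntegral_congr_fun measurableSet_tube fun z hz => ?_
  simp only [Pi.mul_apply, erho_rpow hz]

/-- The `p`-th power of the norm of `L^p_α`. -/
def wint (p α : ℝ) (g : Cn m → ℝ≥0∞) : ℝ≥0∞ := ∫⁻ z in tube m, erho z ^ α * g z ^ p

theorem measurable_erho_rpow (s : ℝ) : Measurable fun z : Cn m => erho z ^ s :=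
  measurable_erho.pow_const s

theorem measurable_ek_right (z : Cn m) : Measurable fun w => ek z w := by
  have : Continuous fun w => rho₂ z w := by unfold rho₂; fun_prop
  exact this.measurable.enorm

/-- These inequalities are exactly the convergence conditions of the two Forelli–Rudin integrals in
the Schur test with weight ρ^(−τ). The hypothesis 1 + α < p(1 + ξ) is equivalent to (α − ξ)/p < (1 +
ξ)/q; the other comparisons follow from α, ξ > −1. -/
theorem exists_schur_exponent {p q α ξ : ℝ} (hpq : p.HolderConjugate q) (hα : -1 < α) (hξ : -1 < ξ)
    (h : 1 + α < p * (1 + ξ)) :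
    ∃ τ : ℝ, 0 < τ ∧ α - ξ < τ * p ∧ τ * q < 1 + ξ ∧ τ * p < 1 + α := by
  have hp := hpq.pos
  have hq := hpq.symm.pos
  have hpq' := hpq.inv_add_inv_eq_one
  have hlt : max 0 ((α - ξ) / p) < min ((1 + ξ) / q) ((1 + α) / p) := by
    refine max_lt (lt_min (div_pos (by linarith) hq) (div_pos (by linarith) hp)) (lt_min ?_ ?_)
    · have e : (1 + ξ) / q = (1 + ξ) * (1 - p⁻¹) := by
        rw [← hpq', add_sub_cancel_left, div_eq_mul_inv]
      have e2 : (1 + ξ) * (1 - p⁻¹) = (p * (1 + ξ) - (1 + ξ)) / p := by field_simp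
      rw [e, e2]
      exact div_lt_div_of_pos_right (by linarith) hp
    · exact div_lt_div_of_pos_right (by linarith) hp
  obtain ⟨τ, h1, h2⟩ := exists_between hlt
  obtain ⟨h1a, h1b⟩ := max_lt_iff.1 h1
  obtain ⟨h2a, h2b⟩ := lt_min_iff.1 h2
  exact ⟨τ, h1a, (div_lt_iff₀ hp).1 h1b, (lt_div_iff₀ hq).1 h2a, (lt_div_iff₀ hp).1 h2b⟩

/-- Schur test with ρ^(−τ): Hölder after inserting ρ^τ ρ^(−τ), Forelli–Rudin in w, then Tonelli and
Forelli–Rudin in z. -/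
theorem exists_schur {p α ξ : ℝ} (hp : 1 < p) (hα : -1 < α) (hξ : -1 < ξ)
    (h : 1 + α < p * (1 + ξ)) : ∃ C : ℝ≥0∞, C ≠ ⊤ ∧ ∀ g : Cn m → ℝ≥0∞, Measurable g →
      wint p α (fun z => ∫⁻ w in tube m, g w * (erho w ^ ξ * ek z w ^ (-((m : ℝ) + 2 + ξ))))
        ≤ C * wint p α g := by
  set q := p.conjExponent with hqdef
  have hpq : p.HolderConjugate q := Real.HolderConjugate.conjExponent hp
  have hp0 := hpq.pos
  have hq0 := hpq.symm.pos
  obtain ⟨τ, hτ0, hτ1, hτ2, hτ3⟩ := exists_schur_exponent hpq hα hξ h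
  set b : ℝ := (m : ℝ) + 2 + ξ with hb
  set A := frConst m (ξ - τ * q) b
  set A' := frConst m (α - τ * p) b
  have hA : A ≠ ⊤ := (frConst_lt_top (by linarith) (by rw [hb]; nlinarith)).ne
  have hA' : A' ≠ ⊤ := (frConst_lt_top (by linarith) (by rw [hb]; linarith)).ne
  have hpq1 : p / q = p - 1 := by
    have := hpq.inv_add_inv_eq_one
    field_simp at this ⊢
    linarith
  refine ⟨A ^ (p - 1) * A', ENNReal.mul_ne_top
    (ENNReal.rpow_ne_top_of_nonneg (by linarith) hA) hA', fun g hg => ?_⟩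
  have hρ := measurable_erho (m := m)
  have hek := measurable_ek (m := m)
  have key : ∀ z ∈ tube m,
      (∫⁻ w in tube m, g w * (erho w ^ ξ * ek z w ^ (-b))) ^ p
        ≤ A ^ (p - 1) * erho z ^ (-(τ * p)) *
          ∫⁻ w in tube m, g w ^ p * (erho w ^ (τ * p + ξ) * ek z w ^ (-b)) := by
    intro z hz
    have hez := measurable_ek_right z
    have h1 := ENNReal.lintegral_mul_le_Lp_mul_Lq (volume.restrict (tube m)) hpq
      (f := fun w => g w * (erho w ^ (τ + ξ / p) * ek z w ^ (-(b / p))))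
      (g := fun w => erho w ^ (-τ + ξ / q) * ek z w ^ (-(b / q))) (by fun_prop) (by fun_prop)
    have e1 : ∫⁻ w in tube m, ((fun w => g w * (erho w ^ (τ + ξ / p) * ek z w ^ (-(b / p)))) *
        fun w => erho w ^ (-τ + ξ / q) * ek z w ^ (-(b / q))) w
        = ∫⁻ w in tube m, g w * (erho w ^ ξ * ek z w ^ (-b)) := by
      refine setLIntegral_congr_fun measurableSet_tube fun w hw => ?_
      simp only [Pi.mul_apply]
      have c1 : ξ = (τ + ξ / p) + (-τ + ξ / q) := by
        have := hpq.inv_add_inv_eq_one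
        linear_combination (-ξ) * this
      have c2 : -b = -(b / p) + -(b / q) := by
        have := hpq.inv_add_inv_eq_one
        linear_combination b * this
      conv_rhs => rw [c1, erho_rpow_add hw, c2, ek_rpow_add hz hw]
      ring
    have e2 : ∫⁻ w in tube m, (g w * (erho w ^ (τ + ξ / p) * ek z w ^ (-(b / p)))) ^ p
        = ∫⁻ w in tube m, g w ^ p * (erho w ^ (τ * p + ξ) * ek z w ^ (-b)) := by
      refine setLIntegral_congr_fun measurableSet_tube fun w _ => ?_
      rw [ENNReal.mul_rpow_of_nonneg _ _ hp0.le, ENNReal.mul_rpow_of_nonneg _ _ hp0.le,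
        ← ENNReal.rpow_mul, ← ENNReal.rpow_mul]
      congr 3 <;> field_simp
    have e3 : ∫⁻ w in tube m, (erho w ^ (-τ + ξ / q) * ek z w ^ (-(b / q))) ^ q
        = A * erho z ^ (-(τ * q)) := by
      have := forelliRudin hz (ξ - τ * q) b
      rw [show (m : ℝ) + 2 + (ξ - τ * q) - b = -(τ * q) by rw [hb]; ring] at this
      rw [← this]
      refine setLIntegral_congr_fun measurableSet_tube fun w _ => ?_
      rw [ENNReal.mul_rpow_of_nonneg _ _ hq0.le, ← ENNReal.rpow_mul, ← ENNReal.rpow_mul]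
      congr 2 <;> field_simp
      ring
    rw [e1, e2, e3] at h1
    have h2 := ENNReal.rpow_le_rpow h1 hp0.le
    rw [ENNReal.mul_rpow_of_nonneg _ _ hp0.le, ← ENNReal.rpow_mul, ← ENNReal.rpow_mul,
      one_div_mul_cancel hp0.ne', ENNReal.rpow_one, one_div_mul_eq_div, hpq1,
      ENNReal.mul_rpow_of_nonneg _ _ (by linarith), ← ENNReal.rpow_mul,
      show -(τ * q) * (p - 1) = -(τ * p) by rw [← hpq1]; field_simp] at h2
    rw [mul_comm] at h2
    exact h2
  unfold wint
  calc _ ≤ ∫⁻ z in tube m, A ^ (p - 1) * (∫⁻ w in tube m, erho z ^ (α - τ * p) *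
          (g w ^ p * (erho w ^ (τ * p + ξ) * ek z w ^ (-b)))) := by
        refine setLIntegral_mono' measurableSet_tube fun z hz => ?_
        rw [lintegral_const_mul' _ _ (erho_rpow_ne_top hz _),
          show α - τ * p = α + -(τ * p) by ring, erho_rpow_add hz]
        calc _ ≤ erho z ^ α * _ := mul_le_mul_right (key z hz) _
          _ = _ := by ring
    _ = A ^ (p - 1) * ∫⁻ w in tube m, ∫⁻ z in tube m, erho z ^ (α - τ * p) *
          (g w ^ p * (erho w ^ (τ * p + ξ) * ek z w ^ (-b))) := by
        rw [lintegral_const_mul' _ _ (ENNReal.rpow_ne_top_of_nonneg (by linarith) hA)]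
        rw [lintegral_lintegral_swap]
        apply Measurable.aemeasurable
        simp only [Function.uncurry_def]
        fun_prop
    _ = A ^ (p - 1) * ∫⁻ w in tube m, A' * (erho w ^ α * g w ^ p) := by
        congr 1
        refine setLIntegral_congr_fun measurableSet_tube fun w hw => ?_
        have h1 := forelliRudin hw (α - τ * p) b
        have hel := measurable_ek_right w
        calc _ = ∫⁻ z in tube m, (g w ^ p * erho w ^ (τ * p + ξ)) *
                (erho z ^ (α - τ * p) * ek w z ^ (-b)) := by
              refine lintegral_congr fun z => ?_
              rw [ek_swap w z]; ring
          _ = (g w ^ p * erho w ^ (τ * p + ξ)) * (A' * erho w ^ (α - τ * p - ξ)) := by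
              rw [lintegral_const_mul _ (by fun_prop), h1]
              congr 3; rw [hb]; ring
          _ = _ := by
              have : α = (τ * p + ξ) + (α - τ * p - ξ) := by ring
              conv_rhs => rw [this, erho_rpow_add hw]
              ring
    _ = _ := by rw [lintegral_const_mul' _ _ hA', mul_assoc]

/-! ### Pointwise bounds and averaging of a measure over invariant balls -/

theorem lintegral_nbhd_le {a : Cn m} (ha : a ∈ tube m) (α : ℝ) (g : Cn m → ℝ≥0∞) :
    ∫⁻ z in nbhd a, g z ≤ 8 ^ |α| * erho a ^ (-α) * ∫⁻ z in nbhd a, erho z ^ α * g z := by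
  rw [← lintegral_const_mul' _ _ (ENNReal.mul_ne_top (by simp) (erho_rpow_ne_top ha _))]
  refine setLIntegral_mono' (measurableSet_nbhd a) fun z hz => ?_
  have h := erho_rpow_le hz.1 (mem_nbhd_symm ha hz) α
  calc g z = erho a ^ (-α) * erho a ^ α * g z := by
        rw [← erho_rpow_add ha]; simp
    _ ≤ erho a ^ (-α) * (8 ^ |α| * erho z ^ α) * g z := by gcongr
    _ = _ := by ring

theorem exists_weighted_submean (m : ℕ) (α : ℝ) : ∃ C : ℝ≥0∞, C ≠ 0 ∧ C ≠ ⊤ ∧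
    ∀ (f : Cn m → ℂ), DifferentiableOn ℂ f (tube m) → ∀ p : ℝ, 0 < p → ∀ a ∈ tube m,
      ‖f a‖ₑ ^ p ≤ C * erho a ^ (-((m : ℝ) + 2 + α)) *
        ∫⁻ z in nbhd a, erho z ^ α * ‖f z‖ₑ ^ p := by
  obtain ⟨C, hC0, hC, h⟩ := exists_submean m
  refine ⟨C * 8 ^ |α|, mul_ne_zero hC0 (by simp), ENNReal.mul_ne_top hC (by simp),
    fun f hf p hp a ha => ?_⟩
  refine (h f hf p hp a ha).trans ?_
  calc _ ≤ C * erho a ^ (-((m : ℝ) + 2)) *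
        (8 ^ |α| * erho a ^ (-α) * ∫⁻ z in nbhd a, erho z ^ α * ‖f z‖ₑ ^ p) := by
        gcongr; exact lintegral_nbhd_le ha α _
    _ = _ := by
      rw [show -((m : ℝ) + 2 + α) = -((m : ℝ) + 2) + -α by ring, erho_rpow_add ha]; ring

theorem exists_pointwise_bound (m : ℕ) (α : ℝ) : ∃ C : ℝ≥0∞, C ≠ 0 ∧ C ≠ ⊤ ∧
    ∀ (f : Cn m → ℂ), DifferentiableOn ℂ f (tube m) → ∀ p : ℝ, 0 < p → ∀ a ∈ tube m,
      ‖f a‖ₑ ^ p ≤ C * erho a ^ (-((m : ℝ) + 2 + α)) * wint p α fun z => ‖f z‖ₑ := by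
  obtain ⟨C, hC0, hC, h⟩ := exists_weighted_submean m α
  refine ⟨C, hC0, hC, fun f hf p hp a ha => (h f hf p hp a ha).trans ?_⟩
  gcongr
  exact lintegral_mono_set (nbhd_subset_tube a)

/-- Bound |f(w)|^q by its mean over the ball about w and exchange the integrals. Since u lies in the
ball about w exactly when w lies in the ball about u, only ν(ball about u) survives. The weight G
passes through because it is almost constant on balls. -/
theorem exists_averaging (m : ℕ) : ∃ C : ℝ≥0∞, C ≠ 0 ∧ C ≠ ⊤ ∧
    ∀ (ν : Measure (Cn m)) [SFinite ν] (f : Cn m → ℂ), DifferentiableOn ℂ f (tube m) →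
    ∀ q : ℝ, 0 < q → ∀ (G : Cn m → ℝ≥0∞) (D : ℝ≥0∞), Measurable G → D ≠ ⊤ →
    (∀ w ∈ tube m, ∀ u ∈ nbhd w, G w ≤ D * G u) → ∀ (M : ℝ≥0∞) (c : ℝ), M ≠ ⊤ →
    (∀ u ∈ tube m, ν (nbhd u) ≤ M * erho u ^ c) →
    ∫⁻ w in tube m, ‖f w‖ₑ ^ q * G w ∂ν
      ≤ C * D * M * ∫⁻ u in tube m, ‖f u‖ₑ ^ q * (G u * erho u ^ (c - ((m : ℝ) + 2))) := by
  obtain ⟨C, hC0, hC, h⟩ := exists_submean m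
  refine ⟨C * 8 ^ |-((m : ℝ) + 2)|, mul_ne_zero hC0 (by simp), ENNReal.mul_ne_top hC (by simp), ?_⟩
  intro ν _ f hf q hq G D hG hD hGD M c hM hν
  -- The indicator makes F measurable, since f is arbitrary off the tube.
  set F : Cn m → ℝ≥0∞ := fun u => (tube m).indicator (fun u => ‖f u‖ₑ ^ q) u *
    (G u * erho u ^ (-((m : ℝ) + 2))) with hF
  have hFm : Measurable F := by
    have h1 : Measurable ((tube m).indicator (fun u => ‖f u‖ₑ ^ q)) :=
      measurable_indicator_of_continuousOn
        (ENNReal.continuous_rpow_const.comp_continuousOn hf.continuousOn.enorm) measurableSet_tube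
    have h2 := measurable_erho_rpow (m := m) (-((m : ℝ) + 2))
    exact h1.mul (hG.mul h2)
  have hFt : ∀ u ∈ tube m, F u = ‖f u‖ₑ ^ q * (G u * erho u ^ (-((m : ℝ) + 2))) := fun u hu => by
    simp only [hF, Set.indicator_of_mem hu]
  set K : ℝ≥0∞ := C * 8 ^ |-((m : ℝ) + 2)| * D with hK
  have hKt : K ≠ ⊤ := ENNReal.mul_ne_top (ENNReal.mul_ne_top hC (by simp)) hD
  have h1 : ∀ w ∈ tube m, ‖f w‖ₑ ^ q * G w ≤ K * ∫⁻ u in tube m, (nbhd w).indicator F u := by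
    intro w hw
    rw [setLIntegral_indicator (measurableSet_nbhd w),
      Set.inter_eq_left.2 (nbhd_subset_tube w)]
    calc _ ≤ C * erho w ^ (-((m : ℝ) + 2)) * (∫⁻ u in nbhd w, ‖f u‖ₑ ^ q) * G w := by
          gcongr; exact h f hf q hq w hw
      _ ≤ C * erho w ^ (-((m : ℝ) + 2)) * (∫⁻ u in nbhd w, ‖f u‖ₑ ^ q * G w) := by
          rw [mul_assoc]
          gcongr
          exact lintegral_mul_const_le _ _
      _ ≤ C * ∫⁻ u in nbhd w, erho w ^ (-((m : ℝ) + 2)) * (‖f u‖ₑ ^ q * G w) := by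
          rw [lintegral_const_mul' _ _ (erho_rpow_ne_top hw _), mul_assoc]
      _ ≤ C * ∫⁻ u in nbhd w, (8 ^ |-((m : ℝ) + 2)| * D) * F u := by
          gcongr C * ?_
          refine setLIntegral_mono' (measurableSet_nbhd w) fun u hu => ?_
          rw [hFt u hu.1]
          calc _ ≤ (8 ^ |-((m : ℝ) + 2)| * erho u ^ (-((m : ℝ) + 2))) * (‖f u‖ₑ ^ q * (D * G u)) := by
                gcongr
                · exact erho_rpow_le hu.1 (mem_nbhd_symm hw hu) _
                · exact hGD w hw u hu
            _ = _ := by ring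
      _ = _ := by
          rw [lintegral_const_mul' _ _ (ENNReal.mul_ne_top (by simp) hD), hK]; ring
  have hmeas : Measurable (Function.uncurry fun (w u : Cn m) => (nbhd w).indicator F u) := by
    have h2 : (Function.uncurry fun (w u : Cn m) => (nbhd w).indicator F u)
        = {p : Cn m × Cn m | p.2 ∈ nbhd p.1}.indicator (fun p => F p.2) := by
      ext ⟨w, u⟩; rfl
    rw [h2]
    refine (hFm.comp measurable_snd).indicator ?_
    exact measurable_swap measurableSet_nbhd_prod
  calc _ ≤ ∫⁻ w in tube m, (K * ∫⁻ u in tube m, (nbhd w).indicator F u) ∂ν :=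
        setLIntegral_mono' measurableSet_tube h1
    _ = K * ∫⁻ u in tube m, (∫⁻ w in tube m, (nbhd w).indicator F u ∂ν) := by
        rw [lintegral_const_mul' _ _ hKt, lintegral_lintegral_swap hmeas.aemeasurable]
    _ ≤ K * ∫⁻ u in tube m, M * (‖f u‖ₑ ^ q * (G u * erho u ^ (c - ((m : ℝ) + 2)))) := by
        gcongr K * ?_
        refine setLIntegral_mono' measurableSet_tube fun u hu => ?_
        have e : ∫⁻ w in tube m, (nbhd w).indicator F u ∂ν = F u * ν (nbhd u) := by
          rw [← setLIntegral_const, ← lintegral_indicator measurableSet_tube,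
            ← lintegral_indicator (measurableSet_nbhd u)]
          refine lintegral_congr fun w => ?_
          by_cases hw : w ∈ tube m
          · rw [Set.indicator_of_mem hw]
            by_cases hwu : u ∈ nbhd w
            · rw [Set.indicator_of_mem hwu, Set.indicator_of_mem ((mem_nbhd_comm hw hu).1 hwu)]
            · rw [Set.indicator_of_notMem hwu,
                Set.indicator_of_notMem fun hh => hwu ((mem_nbhd_comm hw hu).2 hh)]
          · rw [Set.indicator_of_notMem hw, Set.indicator_of_notMem fun hh => hw hh.1]
        rw [e, hFt u hu]
        calc _ ≤ ‖f u‖ₑ ^ q * (G u * erho u ^ (-((m : ℝ) + 2))) * (M * erho u ^ c) := by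
              gcongr; exact hν u hu
          _ = _ := by rw [sub_eq_add_neg, erho_rpow_add hu]; ring
    _ = _ := by rw [lintegral_const_mul' _ _ hM, mul_assoc K M]

/-! ### Norm bound for the Berezin operator -/

/-- The Berezin-type operator on extended nonnegative reals. -/
def bz (ν : Measure (Cn m)) (b : ℝ) (f : Cn m → ℂ) (z : Cn m) : ℝ≥0∞ :=
  ∫⁻ w in tube m, ‖f w‖ₑ * ek z w ^ (-b) ∂ν

/-- The exponent in the Carleson condition that corresponds to a pair of weighted spaces. -/
def carlesonExp (m : ℕ) (p₁ α₁ p₂ α₂ ξ : ℝ) : ℝ :=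
  (m + 2) + ξ + (m + 2 + α₁) / p₁ - (m + 2 + α₂) / p₂

theorem wint_mono {p α : ℝ} (hp : 0 ≤ p) {g h : Cn m → ℝ≥0∞} (hgh : ∀ z ∈ tube m, g z ≤ h z) :
    wint p α g ≤ wint p α h :=
  setLIntegral_mono' measurableSet_tube fun z hz => by
    gcongr; exact hgh z hz

theorem wint_const_mul {p α : ℝ} (hp : 0 ≤ p) {c : ℝ≥0∞} (hc : c ≠ ⊤) (g : Cn m → ℝ≥0∞) :
    wint p α (fun z => c * g z) = c ^ p * wint p α g := by
  unfold wint
  rw [← lintegral_const_mul' _ _ (ENNReal.rpow_ne_top_of_nonneg hp hc)]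
  refine lintegral_congr fun z => ?_
  rw [ENNReal.mul_rpow_of_nonneg _ _ hp]; ring

/-- Averaging turns ν into M ρ^(c−(m+2)) dV. Write |f| = |f|^(p₁/p₂) |f|^(p₁e) with e = 1/p₁ − 1/p₂
≥ 0 and apply the pointwise bound to the second factor only. What remains is g ρ^ξ, where g has the
same integral in L^{p₂}_{α₂} as f in L^{p₁}_{α₁}, and the Schur test applies to g. The exponent c is
precisely the one that makes the powers of ρ match. -/
theorem exists_bz_bound (m : ℕ) {p₁ p₂ α₁ α₂ ξ : ℝ} (hp₁ : 1 < p₁) (hp : p₁ ≤ p₂) (hα₂ : -1 < α₂)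
    (hξ : -1 < ξ) (h : 1 + α₂ < p₂ * (1 + ξ)) : ∃ C : ℝ≥0∞, C ≠ ⊤ ∧
    ∀ (ν : Measure (Cn m)) [SFinite ν] (f : Cn m → ℂ), DifferentiableOn ℂ f (tube m) →
    ∀ M : ℝ≥0∞, M ≠ ⊤ → (∀ u ∈ tube m, ν (nbhd u) ≤ M * erho u ^ carlesonExp m p₁ α₁ p₂ α₂ ξ) →
    wint p₁ α₁ (fun z => ‖f z‖ₑ) ≠ ⊤ →
    wint p₂ α₂ (bz ν ((m : ℝ) + 2 + ξ) f)
      ≤ C * M ^ p₂ * wint p₁ α₁ (fun z => ‖f z‖ₑ) ^ (p₂ / p₁) := by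
  have hp₁0 : 0 < p₁ := by linarith
  have hp₂0 : 0 < p₂ := by linarith
  obtain ⟨A, -, hA, hav⟩ := exists_averaging m
  obtain ⟨P, -, hP, hpt⟩ := exists_pointwise_bound m α₁
  obtain ⟨S, hS, hschur⟩ := exists_schur (m := m) (by linarith : 1 < p₂) hα₂ hξ h
  set b : ℝ := (m : ℝ) + 2 + ξ with hb
  set e : ℝ := 1 / p₁ - 1 / p₂ with he
  have he0 : 0 ≤ e := sub_nonneg.2 (one_div_le_one_div_of_le hp₁0 hp)
  have hee : e = (1 - p₁ / p₂) / p₁ := by rw [he]; field_simp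
  refine ⟨(A * 36 ^ |-b| * P ^ e) ^ p₂ * S, ENNReal.mul_ne_top
    (ENNReal.rpow_ne_top_of_nonneg hp₂0.le (ENNReal.mul_ne_top (ENNReal.mul_ne_top hA (by simp))
      (ENNReal.rpow_ne_top_of_nonneg he0 hP))) hS, ?_⟩
  intro ν _ f hf M hM hν hN
  set N := wint p₁ α₁ (fun z => ‖f z‖ₑ) with hNdef
  set g : Cn m → ℝ≥0∞ := fun w => (tube m).indicator (fun u => ‖f u‖ₑ ^ (p₁ / p₂)) w *
    erho w ^ ((α₁ - α₂) / p₂) with hg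
  have hgm : Measurable g := (measurable_indicator_of_continuousOn
    (ENNReal.continuous_rpow_const.comp_continuousOn hf.continuousOn.enorm)
    measurableSet_tube).mul (measurable_erho_rpow _)
  have hgt : ∀ w ∈ tube m, g w = ‖f w‖ₑ ^ (p₁ / p₂) * erho w ^ ((α₁ - α₂) / p₂) := fun w hw => by
    simp only [hg, Set.indicator_of_mem hw]
  have hgN : wint p₂ α₂ g = N := by
    refine setLIntegral_congr_fun measurableSet_tube fun w hw => ?_
    simp only
    rw [hgt w hw, ENNReal.mul_rpow_of_nonneg _ _ hp₂0.le, ← ENNReal.rpow_mul, ← ENNReal.rpow_mul,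
      div_mul_cancel₀ _ hp₂0.ne', div_mul_cancel₀ _ hp₂0.ne', sub_eq_add_neg, erho_rpow_add hw]
    calc _ = (erho w ^ α₂ * erho w ^ (-α₂)) * (erho w ^ α₁ * ‖f w‖ₑ ^ p₁) := by ring
      _ = _ := by rw [← erho_rpow_add hw]; simp
  have hfle : ∀ w ∈ tube m, ‖f w‖ₑ * erho w ^ (carlesonExp m p₁ α₁ p₂ α₂ ξ - ((m : ℝ) + 2))
      ≤ (P ^ e * N ^ e) * (g w * erho w ^ ξ) := by
    intro w hw
    have h1 := ENNReal.rpow_le_rpow (hpt f hf p₁ hp₁0 w hw) he0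
    rw [← ENNReal.rpow_mul, ENNReal.mul_rpow_of_nonneg _ _ he0,
      ENNReal.mul_rpow_of_nonneg _ _ he0, ← ENNReal.rpow_mul] at h1
    have h2 : ‖f w‖ₑ = ‖f w‖ₑ ^ (p₁ / p₂) * ‖f w‖ₑ ^ (p₁ * e) := by
      rw [← ENNReal.rpow_add_of_nonneg _ _ (by positivity) (by positivity)]
      have : p₁ / p₂ + p₁ * e = 1 := by rw [he]; field_simp; ring
      rw [this, ENNReal.rpow_one]
    rw [hgt w hw]
    calc _ ≤ ‖f w‖ₑ ^ (p₁ / p₂) * (P ^ e * erho w ^ (-((m : ℝ) + 2 + α₁) * e) * N ^ e) *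
          erho w ^ (carlesonExp m p₁ α₁ p₂ α₂ ξ - ((m : ℝ) + 2)) := by
          conv_lhs => rw [h2]
          gcongr
      _ = (P ^ e * N ^ e) * (‖f w‖ₑ ^ (p₁ / p₂) * erho w ^ (-((m : ℝ) + 2 + α₁) * e +
          (carlesonExp m p₁ α₁ p₂ α₂ ξ - ((m : ℝ) + 2)))) := by
          rw [erho_rpow_add hw]; ring
      _ = (P ^ e * N ^ e) * (‖f w‖ₑ ^ (p₁ / p₂) * erho w ^ ((α₁ - α₂) / p₂ + ξ)) := by
          congr 3
          rw [carlesonExp, he]; field_simp; ring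
      _ = _ := by rw [erho_rpow_add hw]; ring
  have hbz : ∀ z ∈ tube m, bz ν b f z ≤ (A * 36 ^ |-b| * M * (P ^ e * N ^ e)) *
      ∫⁻ w in tube m, g w * (erho w ^ ξ * ek z w ^ (-b)) := by
    intro z hz
    have h1 := hav ν f hf 1 one_pos (fun w => ek z w ^ (-b)) (36 ^ |-b|)
      ((measurable_ek_right z).pow_const _) (by simp)
      (fun w hw u hu => by
        rw [← ek_swap z w, ← ek_swap z u]
        exact ek_rpow_le hu.1 (mem_nbhd_symm hw hu) hz _) M _ hM hν
    simp only [ENNReal.rpow_one] at h1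
    refine h1.trans ?_
    rw [mul_assoc _ (P ^ e * N ^ e)]
    gcongr
    rw [← lintegral_const_mul' _ _ (ENNReal.mul_ne_top (ENNReal.rpow_ne_top_of_nonneg he0 hP)
      (ENNReal.rpow_ne_top_of_nonneg he0 hN))]
    refine setLIntegral_mono' measurableSet_tube fun w hw => ?_
    calc _ = ‖f w‖ₑ * erho w ^ (carlesonExp m p₁ α₁ p₂ α₂ ξ - ((m : ℝ) + 2)) * ek z w ^ (-b) := by
          ring
      _ ≤ (P ^ e * N ^ e) * (g w * erho w ^ ξ) * ek z w ^ (-b) := mul_le_mul_left (hfle w hw) _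
      _ = _ := by ring
  have hKt : A * 36 ^ |-b| * M * (P ^ e * N ^ e) ≠ ⊤ := ENNReal.mul_ne_top
    (ENNReal.mul_ne_top (ENNReal.mul_ne_top hA (by simp)) hM)
    (ENNReal.mul_ne_top (ENNReal.rpow_ne_top_of_nonneg he0 hP)
      (ENNReal.rpow_ne_top_of_nonneg he0 hN))
  refine (wint_mono hp₂0.le hbz).trans ?_
  rw [wint_const_mul hp₂0.le hKt]
  refine (mul_le_mul_right (hschur g hgm) _).trans ?_
  rw [hgN]
  have hexp : N ^ (p₂ / p₁) = (N ^ e) ^ p₂ * N := by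
    rw [← ENNReal.rpow_mul]
    conv_rhs => rw [← ENNReal.rpow_one N, ← ENNReal.rpow_mul, one_mul]
    rw [← ENNReal.rpow_add_of_nonneg _ _ (by positivity) zero_le_one]
    congr 1
    rw [he]; field_simp; ring
  rw [hexp]
  simp only [ENNReal.mul_rpow_of_nonneg _ _ hp₂0.le]
  apply le_of_eq
  ring

/-! ### Weighted measures, norms and holomorphic representatives -/

theorem weightedVolume_absolutelyContinuous (α : ℝ) :
    weightedVolume m α ≪ volume.restrict (tube m) := withDensity_absolutelyContinuous _ _

theorem absolutelyContinuous_weightedVolume (α : ℝ) :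
    volume.restrict (tube m) ≪ weightedVolume m α := by
  have hr := (continuous_rho (m := m)).measurable
  refine withDensity_absolutelyContinuous' (by fun_prop) ?_
  refine ae_restrict_of_forall_mem measurableSet_tube fun z hz => ?_
  rw [← erho_rpow hz]
  exact erho_rpow_ne_zero hz α

theorem weightedVolume_compl_tube (α : ℝ) : weightedVolume m α (tube m)ᶜ = 0 :=
  weightedVolume_absolutelyContinuous α (by
    rw [Measure.restrict_apply measurableSet_tube.compl, Set.compl_inter_self, measure_empty])

theorem ae_mem_tube (α : ℝ) : ∀ᵐ z ∂(weightedVolume m α), z ∈ tube m :=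
  weightedVolume_compl_tube α

theorem setLIntegral_weightedVolume (α : ℝ) (g : Cn m → ℝ≥0∞) {s : Set (Cn m)}
    (hs : MeasurableSet s) (hst : s ⊆ tube m) :
    ∫⁻ z in s, g z ∂(weightedVolume m α) = ∫⁻ z in s, erho z ^ α * g z := by
  rw [← lintegral_indicator hs, lintegral_weightedVolume]
  have : ∀ z, erho z ^ α * s.indicator g z = s.indicator (fun z => erho z ^ α * g z) z := fun z => by
    by_cases h : z ∈ s <;> simp [h]
  simp only [this]
  rw [setLIntegral_indicator hs, Set.inter_eq_left.2 hst]

theorem wint_eq_lintegral (p α : ℝ) (g : Cn m → ℝ≥0∞) :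
    wint p α g = ∫⁻ z, g z ^ p ∂(weightedVolume m α) := (lintegral_weightedVolume α _).symm

theorem eLpNorm_eq_rpow {p : ℝ} (hp : 0 < p) (f : Cn m → ℂ) (ν : Measure (Cn m)) :
    eLpNorm f (ENNReal.ofReal p) ν = (∫⁻ z, ‖f z‖ₑ ^ p ∂ν) ^ (1 / p) := by
  rw [eLpNorm_eq_lintegral_rpow_enorm_toReal (by simpa using hp) ENNReal.ofReal_ne_top,
    ENNReal.toReal_ofReal hp.le]

theorem eLpNorm_eq_wint {p : ℝ} (hp : 0 < p) (α : ℝ) (f : Cn m → ℂ) :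
    eLpNorm f (ENNReal.ofReal p) (weightedVolume m α) = wint p α (fun z => ‖f z‖ₑ) ^ (1 / p) := by
  rw [eLpNorm_eq_rpow hp, wint_eq_lintegral]

theorem wint_eq_eLpNorm {p : ℝ} (hp : 0 < p) (α : ℝ) (f : Cn m → ℂ) :
    wint p α (fun z => ‖f z‖ₑ) = eLpNorm f (ENNReal.ofReal p) (weightedVolume m α) ^ p := by
  rw [eLpNorm_eq_wint hp, ← ENNReal.rpow_mul, one_div_mul_cancel hp.ne', ENNReal.rpow_one]

theorem aestronglyMeasurable_of_differentiableOn {f : Cn m → ℂ} (hf : DifferentiableOn ℂ f (tube m))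
    (α : ℝ) : AEStronglyMeasurable f (weightedVolume m α) :=
  (hf.continuousOn.aestronglyMeasurable measurableSet_tube).mono_ac
    (weightedVolume_absolutelyContinuous α)

theorem memLp_of_wint {p : ℝ} (hp : 0 < p) {α : ℝ} {f : Cn m → ℂ}
    (hf : DifferentiableOn ℂ f (tube m)) (h : wint p α (fun z => ‖f z‖ₑ) ≠ ⊤) :
    MemLp f (ENNReal.ofReal p) (weightedVolume m α) :=
  ⟨aestronglyMeasurable_of_differentiableOn hf α, by
    rw [eLpNorm_eq_wint hp]
    exact ENNReal.rpow_lt_top_of_nonneg (by positivity) h⟩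

/-- The element of the Bergman space given by a holomorphic function. -/
def mkBergman {p α : ℝ} (f : Cn m → ℂ) (hf : DifferentiableOn ℂ f (tube m))
    (h : MemLp f (ENNReal.ofReal p) (weightedVolume m α)) : bergman m p α :=
  ⟨h.toLp f, f, hf, h.coeFn_toLp⟩

theorem eqOn_tube_of_ae_eq {α : ℝ} {f g : Cn m → ℂ} (hf : DifferentiableOn ℂ f (tube m))
    (hg : DifferentiableOn ℂ g (tube m)) (h : f =ᵐ[weightedVolume m α] g) :
    Set.EqOn f g (tube m) :=
  Measure.eqOn_open_of_ae_eq ((absolutelyContinuous_weightedVolume α).ae_le h) isOpen_tube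
    hf.continuousOn hg.continuousOn

theorem rep_mkBergman {p α : ℝ} (f : Cn m → ℂ) (hf : DifferentiableOn ℂ f (tube m))
    (h : MemLp f (ENNReal.ofReal p) (weightedVolume m α)) :
    Set.EqOn (rep (mkBergman f hf h)) f (tube m) :=
  eqOn_tube_of_ae_eq (rep_differentiableOn _) hf
    ((coe_ae_eq_rep (mkBergman f hf h)).symm.trans h.coeFn_toLp)

theorem wint_rep {p : ℝ} [h : Fact (1 < p)] {α : ℝ} (f : bergman m p α) :
    wint p α (fun z => ‖rep f z‖ₑ) = ENNReal.ofReal ‖f‖ ^ p := by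
  have hp : 0 < p := by linarith [h.out]
  rw [wint_eq_eLpNorm hp, ← eLpNorm_congr_ae (coe_ae_eq_rep f), ← Lp.enorm_def, ← ofReal_norm]
  rfl

theorem wint_rep_ne_top {p : ℝ} [h : Fact (1 < p)] {α : ℝ} (f : bergman m p α) :
    wint p α (fun z => ‖rep f z‖ₑ) ≠ ⊤ := by
  rw [wint_rep]
  exact ENNReal.rpow_ne_top_of_nonneg (by linarith [h.out]) ENNReal.ofReal_ne_top

/-! ### Test functions -/

/-- The holomorphic test functions, normalized in the Bergman space with exponents `p, α`. -/
def testFn (p α b : ℝ) (a z : Cn m) : ℂ :=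
  ((rho a ^ (b - ((m : ℝ) + 2 + α) / p) : ℝ) : ℂ) * rho₂ z a ^ ((-b : ℝ) : ℂ)

theorem rho₂_mem_slitPlane {z w : Cn m} (hz : z ∈ tube m) (hw : w ∈ tube m) :
    rho₂ z w ∈ Complex.slitPlane := Or.inl (rho₂_re_pos hz hw)

theorem differentiable_rho₂ (w : Cn m) : Differentiable ℂ fun z => rho₂ z w := by
  unfold rho₂; fun_prop

theorem differentiableOn_testFn (p α b : ℝ) {a : Cn m} (ha : a ∈ tube m) :
    DifferentiableOn ℂ (testFn p α b a) (tube m) :=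
  ((differentiable_rho₂ a).differentiableOn.cpow_const fun _ hz =>
    rho₂_mem_slitPlane hz ha).const_mul _

theorem enorm_testFn (p α b : ℝ) {a z : Cn m} (ha : a ∈ tube m) (hz : z ∈ tube m) :
    ‖testFn p α b a z‖ₑ = erho a ^ (b - ((m : ℝ) + 2 + α) / p) * ek z a ^ (-b) := by
  have hpos := mem_tube_iff.1 ha
  rw [erho_rpow ha, ek_rpow hz ha, testFn, enorm_mul, ← ofReal_norm, ← ofReal_norm,
    Complex.norm_cpow_real, Complex.norm_real, Real.norm_of_nonneg (by positivity)]

/-- The power of ρ(a) in `testFn` is chosen to cancel the one that Forelli–Rudin produces, so the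
norm does not depend on a. -/
theorem wint_testFn {p : ℝ} (hp : 0 < p) (α b : ℝ) {a : Cn m} (ha : a ∈ tube m) :
    wint p α (fun z => ‖testFn p α b a z‖ₑ) = frConst m α (b * p) := by
  have h := forelliRudin ha α (b * p)
  calc wint p α (fun z => ‖testFn p α b a z‖ₑ)
      = ∫⁻ z in tube m, erho a ^ (b * p - ((m : ℝ) + 2 + α)) *
          (erho z ^ α * ek a z ^ (-(b * p))) := by
        refine setLIntegral_congr_fun measurableSet_tube fun z hz => ?_
        simp only
        rw [enorm_testFn p α b ha hz, ENNReal.mul_rpow_of_nonneg _ _ hp.le, ← ENNReal.rpow_mul,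
          ← ENNReal.rpow_mul, sub_mul, div_mul_cancel₀ _ hp.ne', ek_swap a z, neg_mul]
        ring
    _ = _ := by
        rw [lintegral_const_mul' _ _ (erho_rpow_ne_top ha _), h, mul_left_comm,
          ← erho_rpow_add ha]
        have : b * p - ((m : ℝ) + 2 + α) + ((m : ℝ) + 2 + α - b * p) = 0 := by ring
        rw [this, ENNReal.rpow_zero, mul_one]

theorem wint_testFn_ne_top {p : ℝ} (hp : 0 < p) {α b : ℝ} (hα : -1 < α)
    (hb : (m : ℝ) + 2 + α < b * p) {a : Cn m} (ha : a ∈ tube m) :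
    wint p α (fun z => ‖testFn p α b a z‖ₑ) ≠ ⊤ := by
  rw [wint_testFn hp α b ha]; exact (frConst_lt_top hα hb).ne

/-! ### Compactness of B or T forces vanishing averages -/

/-- The averages of `μ` over invariant balls are small relative to `ρ ^ c` near the boundary and
near infinity. -/
def VanishingAverages (μ : Measure (Cn m)) (c : ℝ) : Prop :=
  ∀ ε : ℝ≥0∞, 0 < ε → ∃ N : ℝ, ∀ a ∈ tube m, a ∉ exhaust m N → μ (nbhd a) ≤ ε * erho a ^ c

theorem tendsto_tail {α : ℝ} {h : Cn m → ℝ≥0∞} (hh : ∫⁻ z, h z ∂(weightedVolume m α) ≠ ⊤) :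
    Tendsto (fun N : ℕ => ∫⁻ z in (exhaust m N)ᶜ, h z ∂(weightedVolume m α)) atTop (𝓝 0) := by
  set κ := (weightedVolume m α).withDensity h with hκ
  have hfin : κ Set.univ ≠ ⊤ := by
    rw [hκ, withDensity_apply _ MeasurableSet.univ, Measure.restrict_univ]; exact hh
  have hac : κ ≪ weightedVolume m α := withDensity_absolutelyContinuous _ _
  have h1 : Tendsto (κ ∘ fun N : ℕ => (exhaust m N)ᶜ) atTop
      (𝓝 (κ (⋂ N : ℕ, (exhaust m (N : ℝ))ᶜ))) :=
    tendsto_measure_iInter_atTop (fun N => (measurableSet_exhaust _).compl.nullMeasurableSet)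
      (fun _ _ hij => Set.compl_subset_compl.2 (exhaust_mono (by exact_mod_cast hij)))
      ⟨0, ne_top_of_le_ne_top hfin (measure_mono (Set.subset_univ _))⟩
  have h2 : κ (⋂ N : ℕ, (exhaust m (N : ℝ))ᶜ) = 0 := by
    refine measure_mono_null (fun z hz => ?_) (hac (weightedVolume_compl_tube α))
    intro hzt
    obtain ⟨N, hN⟩ := exists_mem_exhaust hzt
    exact Set.mem_iInter.1 hz N hN
  rw [h2] at h1
  refine h1.congr fun N => ?_
  rw [Function.comp_apply, hκ, withDensity_apply _ (measurableSet_exhaust _).compl]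

/-- The easy half of Kolmogorov–Riesz: each member of a finite ε/2-net has a small tail from some N
on, and the net transfers this to all of K. -/
theorem tail_small_of_isCompact {p : ℝ} [hp : Fact (1 < p)] {α : ℝ} {K : Set (weightedLp m p α)}
    (hK : IsCompact K) {ε : ℝ≥0∞} (hε : 0 < ε) : ∃ N : ℕ, ∀ g ∈ K,
      eLpNorm g (ENNReal.ofReal p) ((weightedVolume m α).restrict (exhaust m N)ᶜ) ≤ ε := by
  have hp0 : 0 < p := by linarith [hp.out]
  obtain ⟨t, hfin, hcov⟩ := EMetric.totallyBounded_iff.1 hK.totallyBounded (ε / 2)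
    (ENNReal.half_pos hε.ne')
  have h1 : ∀ g ∈ t, ∀ᶠ N : ℕ in atTop,
      eLpNorm g (ENNReal.ofReal p) ((weightedVolume m α).restrict (exhaust m N)ᶜ) ≤ ε / 2 := by
    intro g _
    have hg : ∫⁻ z, ‖g z‖ₑ ^ p ∂(weightedVolume m α) ≠ ⊤ := by
      rw [← wint_eq_lintegral p α fun z => ‖g z‖ₑ, wint_eq_eLpNorm hp0]
      exact ENNReal.rpow_ne_top_of_nonneg hp0.le (Lp.eLpNorm_ne_top g)
    have h2 := ((ENNReal.continuous_rpow_const (y := 1 / p)).tendsto 0).comp (tendsto_tail hg)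
    rw [ENNReal.zero_rpow_of_pos (by positivity)] at h2
    filter_upwards [h2.eventually_le_const (ENNReal.half_pos hε.ne')] with N hN
    rw [eLpNorm_eq_rpow hp0]
    exact hN
  obtain ⟨N, hN⟩ := ((hfin.eventually_all).2 h1).exists
  refine ⟨N, fun g hg => ?_⟩
  obtain ⟨g', hg', hgg'⟩ := Set.mem_iUnion₂.1 (hcov hg)
  have h3 : eLpNorm (⇑g - ⇑g') (ENNReal.ofReal p)
      ((weightedVolume m α).restrict (exhaust m N)ᶜ) ≤ ε / 2 := by
    refine (eLpNorm_restrict_le _ _ _ _).trans ?_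
    rw [← Lp.edist_def]
    exact le_of_lt hgg'
  have h4 : (g : Cn m → ℂ) = (⇑g - ⇑g') + ⇑g' := by ext; simp
  rw [h4]
  refine (eLpNorm_add_le ?_ ?_ Fact.out).trans ?_
  · exact ((Lp.aestronglyMeasurable g).sub (Lp.aestronglyMeasurable g')).restrict
  · exact (Lp.aestronglyMeasurable g').restrict
  · exact (add_le_add h3 (hN g' hg')).trans (ENNReal.add_halves ε).le

theorem nbhd_subset_exhaust_compl {N : ℝ} (hN : 0 ≤ N) {a : Cn m} (ha : a ∈ tube m)
    (h : a ∉ exhaust m (10368 * N)) : nbhd a ⊆ (exhaust m N)ᶜ :=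
  fun _ hz hzN => h (mem_exhaust_of_mem_nbhd hN ha hz hzN)

/-- If the averages of `μ` are controlled by local norms of a relatively compact family, then they
vanish. -/
theorem vanishingAverages_of_isCompact {p : ℝ} [hp : Fact (1 < p)] {α : ℝ} {μ : Measure (Cn m)}
    {K : Set (weightedLp m p α)} (hK : IsCompact K) {κ : ℝ} {C : ℝ≥0∞} (hC : C ≠ ⊤)
    (h : ∀ a ∈ tube m, ∃ F ∈ K, (μ (nbhd a) * erho a ^ κ) ^ p ≤ C * erho a ^ (-((m : ℝ) + 2 + α)) *
      ∫⁻ z in nbhd a, ‖F z‖ₑ ^ p ∂(weightedVolume m α)) :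
    VanishingAverages μ (-κ - ((m : ℝ) + 2 + α) / p) := by
  have hp0 : 0 < p := by linarith [hp.out]
  intro ε hε
  -- The summand 1 keeps D nonzero, so that ε / D can be used even if C = 0.
  set D := C ^ (1 / p) + 1 with hD
  have hDt : D ≠ ⊤ := by
    simpa [hD] using (ENNReal.rpow_ne_top_of_nonneg (by positivity) hC)
  have hD0 : D ≠ 0 := by simp [hD]
  obtain ⟨N, hN⟩ := tail_small_of_isCompact hK (ENNReal.div_pos hε.ne' hDt)
  refine ⟨10368 * N, fun a ha haN => ?_⟩
  obtain ⟨F, hF, hle⟩ := h a ha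
  have h1 := ENNReal.rpow_le_rpow hle (by positivity : 0 ≤ 1 / p)
  rw [← ENNReal.rpow_mul, mul_one_div_cancel hp0.ne', ENNReal.rpow_one,
    ENNReal.mul_rpow_of_nonneg _ _ (by positivity), ENNReal.mul_rpow_of_nonneg _ _ (by positivity),
    ← ENNReal.rpow_mul, ← eLpNorm_eq_rpow hp0] at h1
  have h2 : eLpNorm F (ENNReal.ofReal p) ((weightedVolume m α).restrict (nbhd a)) ≤ ε / D :=
    (eLpNorm_mono_measure _ (Measure.restrict_mono
      (nbhd_subset_exhaust_compl N.cast_nonneg ha haN) le_rfl)).trans (hN F hF)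
  calc μ (nbhd a) = μ (nbhd a) * erho a ^ κ * erho a ^ (-κ) := by
        rw [mul_assoc, ← erho_rpow_add ha]; simp
    _ ≤ D * erho a ^ (-((m : ℝ) + 2 + α) * (1 / p)) * (ε / D) * erho a ^ (-κ) := by
        refine mul_le_mul_left (h1.trans ?_) _
        gcongr
        exact le_self_add
    _ = (D * (ε / D)) * (erho a ^ (-κ) * erho a ^ (-((m : ℝ) + 2 + α) * (1 / p))) := by ring
    _ = _ := by
        rw [ENNReal.mul_div_cancel hD0 hDt, ← erho_rpow_add ha]
        congr 2; ring

theorem exp_eq (m : ℕ) (ξ : ℝ) : ((m + 1 : ℕ) : ℝ) + 1 + ξ = (m : ℝ) + 2 + ξ := by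
  push_cast; ring

theorem berezinOp_eq_bz (μ : Measure (Cn m)) (ξ : ℝ) (f : Cn m → ℂ) {z : Cn m} (hz : z ∈ tube m) :
    berezinOp μ ξ f z = bz μ ((m : ℝ) + 2 + ξ) f z := by
  refine setLIntegral_congr_fun measurableSet_tube fun w hw => ?_
  rw [exp_eq, div_eq_mul_inv, ← Real.rpow_neg (norm_nonneg _), ENNReal.ofReal_mul (norm_nonneg _),
    ofReal_norm, ek_rpow hz hw]

theorem bz_congr (μ : Measure (Cn m)) (b : ℝ) {f g : Cn m → ℂ} (h : Set.EqOn f g (tube m))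
    (z : Cn m) : bz μ b f z = bz μ b g z :=
  setLIntegral_congr_fun measurableSet_tube fun w hw => by simp only [h hw]

/-- Restrict the integral to the ball about a, where every kernel value is comparable to ρ(a). The
cube counts three comparisons: ρ(a) with ρ(w,a) twice, and ρ(a,w) with ρ(z,w) once. -/
theorem bz_testFn_lower (μ : Measure (Cn m)) (p α b : ℝ) {a z : Cn m} (ha : a ∈ tube m)
    (hz : z ∈ nbhd a) : μ (nbhd a) * erho a ^ (-b - ((m : ℝ) + 2 + α) / p)
      ≤ (36 ^ |-b|) ^ 3 * bz μ b (testFn p α b a) z := by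
  have hpt : ∀ w ∈ nbhd a, erho a ^ (-b - ((m : ℝ) + 2 + α) / p)
      ≤ (36 ^ |-b|) ^ 3 * (‖testFn p α b a w‖ₑ * ek z w ^ (-b)) := by
    intro w hw
    have h1 := erho_rpow_le_ek ha hw (-b)
    have h2 := ek_rpow_le hz.1 (mem_nbhd_symm ha hz) hw.1 (-b)
    rw [ek_swap w a] at h2
    rw [enorm_testFn p α b ha hw.1]
    calc erho a ^ (-b - ((m : ℝ) + 2 + α) / p)
        = erho a ^ (b - ((m : ℝ) + 2 + α) / p) * (erho a ^ (-b) * erho a ^ (-b)) := by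
          rw [← erho_rpow_add ha, ← erho_rpow_add ha]; congr 1; ring
      _ ≤ erho a ^ (b - ((m : ℝ) + 2 + α) / p) * ((36 ^ |-b| * ek w a ^ (-b)) *
            (36 ^ |-b| * (36 ^ |-b| * ek z w ^ (-b)))) := by
          gcongr; exact h1.trans (by gcongr)
      _ = _ := by ring
  calc _ = ∫⁻ _ in nbhd a, erho a ^ (-b - ((m : ℝ) + 2 + α) / p) ∂μ := by
        rw [setLIntegral_const, mul_comm]
    _ ≤ ∫⁻ w in nbhd a, (36 ^ |-b|) ^ 3 * (‖testFn p α b a w‖ₑ * ek z w ^ (-b)) ∂μ :=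
        setLIntegral_mono' (measurableSet_nbhd a) hpt
    _ ≤ ∫⁻ w in tube m, (36 ^ |-b|) ^ 3 * (‖testFn p α b a w‖ₑ * ek z w ^ (-b)) ∂μ :=
        lintegral_mono_set (nbhd_subset_tube a)
    _ = _ := by rw [lintegral_const_mul' _ _ (by simp), bz]

/-- The elements of the Bergman space given by the test functions. -/
def testElt {p : ℝ} [hp : Fact (1 < p)] {α b : ℝ} (hα : -1 < α) (hb : (m : ℝ) + 2 + α < b * p)
    {a : Cn m} (ha : a ∈ tube m) : bergman m p α :=
  mkBergman (testFn p α b a) (differentiableOn_testFn p α b ha)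
    (memLp_of_wint (by linarith [hp.out]) (differentiableOn_testFn p α b ha)
      (wint_testFn_ne_top (by linarith [hp.out]) hα hb ha))

theorem rep_testElt {p : ℝ} [hp : Fact (1 < p)] {α b : ℝ} (hα : -1 < α)
    (hb : (m : ℝ) + 2 + α < b * p) {a : Cn m} (ha : a ∈ tube m) :
    Set.EqOn (rep (testElt hα hb ha)) (testFn p α b a) (tube m) :=
  rep_mkBergman _ _ _

theorem norm_testElt {p : ℝ} [hp : Fact (1 < p)] {α b : ℝ} (hα : -1 < α)
    (hb : (m : ℝ) + 2 + α < b * p) {a : Cn m} (ha : a ∈ tube m) :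
    ‖testElt hα hb ha‖ = (frConst m α (b * p) ^ (1 / p)).toReal := by
  have hp0 : 0 < p := by linarith [hp.out]
  rw [← wint_testFn hp0 α b ha, ← eLpNorm_eq_wint hp0]
  exact Lp.norm_toLp (testFn p α b a) (memLp_of_wint hp0 (differentiableOn_testFn p α b ha)
    (wint_testFn_ne_top hp0 hα hb ha))

theorem isBounded_range_testElt {p : ℝ} [hp : Fact (1 < p)] {α b : ℝ} (hα : -1 < α)
    (hb : (m : ℝ) + 2 + α < b * p) :
    Bornology.IsBounded (Set.range fun a : tube m => testElt hα hb a.2) := by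
  refine isBounded_iff_forall_norm_le.2 ⟨(frConst m α (b * p) ^ (1 / p)).toReal, ?_⟩
  rintro _ ⟨a, rfl⟩
  exact (norm_testElt hα hb a.2).le

/-- The submean inequality for the constant function 1. -/
theorem one_le_weighted_volume_nbhd (m : ℕ) (α : ℝ) : ∃ C : ℝ≥0∞, C ≠ ⊤ ∧ ∀ a ∈ tube m,
    1 ≤ C * erho a ^ (-((m : ℝ) + 2 + α)) * weightedVolume m α (nbhd a) := by
  obtain ⟨C, -, hC, h⟩ := exists_weighted_submean m α
  refine ⟨C, hC, fun a ha => ?_⟩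
  have := h (fun _ => 1) (differentiableOn_const _) 1 one_pos a ha
  rw [← setLIntegral_one, setLIntegral_weightedVolume α _ (measurableSet_nbhd a)
    (nbhd_subset_tube a)]
  simpa using this

theorem BerezinCompact.vanishingAverages {μ : Measure (Cn m)} {ξ p₁ α₁ p₂ α₂ : ℝ}
    [hp₁ : Fact (1 < p₁)] [hp₂ : Fact (1 < p₂)] (hα₁ : -1 < α₁)
    (hb : (m : ℝ) + 2 + α₁ < ((m : ℝ) + 2 + ξ) * p₁) (h : BerezinCompact μ ξ p₁ α₁ p₂ α₂) :
    VanishingAverages μ (carlesonExp m p₁ α₁ p₂ α₂ ξ) := by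
  have hp0 : 0 < p₂ := by linarith [hp₂.out]
  obtain ⟨B, hB, hBc⟩ := h
  obtain ⟨C, hC, hvol⟩ := one_le_weighted_volume_nbhd m α₂
  set b : ℝ := (m : ℝ) + 2 + ξ with hbdef
  have hK := hBc _ (isBounded_range_testElt (m := m) (p := p₁) (b := b) hα₁ hb)
  have key := vanishingAverages_of_isCompact (μ := μ) hK
    (κ := -b - ((m : ℝ) + 2 + α₁) / p₁) (C := C * ((36 ^ |-b|) ^ 3) ^ p₂)
    (ENNReal.mul_ne_top hC (ENNReal.rpow_ne_top_of_nonneg hp0.le (by simp))) ?_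
  · convert key using 1
    rw [carlesonExp, hbdef]; ring
  intro a ha
  refine ⟨B (testElt hα₁ hb ha), subset_closure ⟨_, ⟨⟨a, ha⟩, rfl⟩, rfl⟩, ?_⟩
  set X := μ (nbhd a) * erho a ^ (-b - ((m : ℝ) + 2 + α₁) / p₁) with hX
  -- The lower bound for B f_a holds on the whole ball; integrating it over a weighted volume of at
  -- least ρ(a)^(m+2+α₂)/C gives the required local norm.
  have hae : ∀ᵐ z ∂((weightedVolume m α₂).restrict (nbhd a)),
      X ^ p₂ ≤ ((36 ^ |-b|) ^ 3) ^ p₂ * ‖B (testElt hα₁ hb ha) z‖ₑ ^ p₂ := by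
    filter_upwards [ae_restrict_of_ae (hB (testElt hα₁ hb ha)),
      ae_restrict_mem (measurableSet_nbhd a)] with z hz hzn
    rw [← ENNReal.mul_rpow_of_nonneg _ _ hp0.le]
    refine ENNReal.rpow_le_rpow ?_ hp0.le
    have e1 : ‖B (testElt hα₁ hb ha) z‖ₑ = bz μ b (testFn p₁ α₁ b a) z := by
      rw [hz.2, ← ofReal_norm, Complex.norm_real, Real.norm_of_nonneg ENNReal.toReal_nonneg,
        ENNReal.ofReal_toReal hz.1.ne, berezinOp_eq_bz _ _ _ hzn.1]
      exact bz_congr _ _ (rep_testElt hα₁ hb ha) _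
    rw [e1]
    exact bz_testFn_lower μ p₁ α₁ b ha hzn
  calc X ^ p₂ = X ^ p₂ * 1 := (mul_one _).symm
    _ ≤ X ^ p₂ * (C * erho a ^ (-((m : ℝ) + 2 + α₂)) * weightedVolume m α₂ (nbhd a)) := by
        gcongr; exact hvol a ha
    _ = C * erho a ^ (-((m : ℝ) + 2 + α₂)) * ∫⁻ _ in nbhd a, X ^ p₂ ∂(weightedVolume m α₂) := by
        rw [setLIntegral_const]; ring
    _ ≤ C * erho a ^ (-((m : ℝ) + 2 + α₂)) * ∫⁻ z in nbhd a, ((36 ^ |-b|) ^ 3) ^ p₂ *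
          ‖B (testElt hα₁ hb ha) z‖ₑ ^ p₂ ∂(weightedVolume m α₂) := by
        gcongr C * erho a ^ (-((m : ℝ) + 2 + α₂)) * ?_
        exact lintegral_mono_ae hae
    _ = _ := by
        rw [lintegral_const_mul' _ _ (ENNReal.rpow_ne_top_of_nonneg hp0.le (by simp))]; ring

/-- The test function carries the same exponent as the kernel, and ρ(a,w) is the conjugate of
ρ(w,a). At the point a the integrand is therefore nonnegative, and |T f_a(a)| loses nothing against
B f_a(a). -/
theorem enorm_toeplitzOp_testFn_lower {μ : Measure (Cn m)} (p α : ℝ) {ξ : ℝ} {a : Cn m}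
    (ha : a ∈ tube m) {f : Cn m → ℂ} (hf : Set.EqOn f (testFn p α ((m : ℝ) + 2 + ξ) a) (tube m))
    (hint : IntegrableOn (toeplitzIntegrand ξ f a) (tube m) μ) :
    μ (nbhd a) * erho a ^ (-((m : ℝ) + 2 + ξ) - ((m : ℝ) + 2 + α) / p)
      ≤ (36 ^ |-((m : ℝ) + 2 + ξ)|) ^ 3 * ‖toeplitzOp μ ξ f a‖ₑ := by
  set b : ℝ := (m : ℝ) + 2 + ξ with hb
  have hbz : bz μ b (testFn p α b a) a ≤ ‖toeplitzOp μ ξ f a‖ₑ := by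
    set r : Cn m → ℝ := fun w => ‖testFn p α b a w‖ * ‖rho₂ a w‖ ^ (-b) with hr
    have hpos := mem_tube_iff.1 ha
    have hval : ∀ w ∈ tube m, toeplitzIntegrand ξ f a w = (r w : ℂ) := by
      intro w hw
      have hs : (rho₂ w a).arg ≠ Real.pi := Complex.slitPlane_arg_ne_pi (rho₂_mem_slitPlane hw ha)
      have h0 : rho₂ w a ≠ 0 := rho₂_ne_zero hw ha
      have h0' : rho₂ w a ^ (b : ℂ) ≠ 0 := by
        rw [Complex.cpow_ne_zero_iff]; exact Or.inl h0
      have hc : rho₂ a w ^ (b : ℂ) = (starRingEnd ℂ) (rho₂ w a ^ (b : ℂ)) := by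
        rw [rho₂_swap w a, Complex.conj_cpow _ _ hs, Complex.conj_ofReal]
      rw [toeplitzIntegrand, exp_eq, ← hb, hf hw, hr]
      simp only [testFn, norm_mul, Complex.norm_cpow_real, Complex.norm_real]
      rw [hc, norm_rho₂_swap w a, Real.norm_of_nonneg (by positivity), Complex.ofReal_neg,
        Complex.cpow_neg, mul_div_assoc, Complex.ofReal_mul, Complex.ofReal_mul, mul_assoc]
      congr 1
      rw [Real.rpow_neg (norm_nonneg _), ← Complex.norm_cpow_real, Complex.ofReal_inv,
        div_eq_mul_inv, ← mul_inv, Complex.mul_conj, ← mul_inv, Complex.normSq_eq_norm_sq]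
      push_cast; ring
    have hint' : IntegrableOn r (tube m) μ := by
      have h1 : IntegrableOn (fun w => (r w : ℂ)) (tube m) μ :=
        hint.congr_fun hval measurableSet_tube
      exact h1.re
    have e1 : toeplitzOp μ ξ f a = ((∫ w in tube m, r w ∂μ : ℝ) : ℂ) := by
      rw [toeplitzOp, setIntegral_congr_fun measurableSet_tube hval, integral_complex_ofReal]
    have hr0 : ∀ w, 0 ≤ r w := fun w => by positivity
    rw [e1, ← ofReal_norm, Complex.norm_real, Real.norm_of_nonneg (integral_nonneg hr0),
      ofReal_integral_eq_lintegral_ofReal hint' (Eventually.of_forall hr0)]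
    refine (setLIntegral_congr_fun measurableSet_tube fun w hw => ?_).le
    simp only [hr]
    rw [ENNReal.ofReal_mul (norm_nonneg _), ofReal_norm, ek_rpow ha hw]
  refine (bz_testFn_lower μ p α b ha (self_mem_nbhd ha)).trans ?_
  gcongr

theorem ToeplitzCompact.vanishingAverages {μ : Measure (Cn m)} {ξ p₁ α₁ p₂ α₂ : ℝ}
    [hp₁ : Fact (1 < p₁)] [hp₂ : Fact (1 < p₂)] (hα₁ : -1 < α₁)
    (hb : (m : ℝ) + 2 + α₁ < ((m : ℝ) + 2 + ξ) * p₁) (h : ToeplitzCompact μ ξ p₁ α₁ p₂ α₂) :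
    VanishingAverages μ (carlesonExp m p₁ α₁ p₂ α₂ ξ) := by
  have hp0 : 0 < p₂ := by linarith [hp₂.out]
  obtain ⟨T, hT, hTc⟩ := h
  obtain ⟨C, -, hC, hsub⟩ := exists_weighted_submean m α₂
  set b : ℝ := (m : ℝ) + 2 + ξ with hbdef
  have hK := (hTc _ (isBounded_range_testElt (m := m) (p := p₁) (b := b) hα₁ hb)).image
    continuous_subtype_val
  have key := vanishingAverages_of_isCompact (μ := μ) hK
    (κ := -b - ((m : ℝ) + 2 + α₁) / p₁) (C := C * ((36 ^ |-b|) ^ 3) ^ p₂)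
    (ENNReal.mul_ne_top hC (ENNReal.rpow_ne_top_of_nonneg hp0.le (by simp))) ?_
  · convert key using 1
    rw [carlesonExp, hbdef]; ring
  intro a ha
  set F := T (testElt hα₁ hb ha) with hF
  refine ⟨F, ⟨F, subset_closure ⟨_, ⟨⟨a, ha⟩, rfl⟩, rfl⟩, rfl⟩, ?_⟩
  have h1 := enorm_toeplitzOp_testFn_lower p₁ α₁ ha (rep_testElt hα₁ hb ha)
    (hT (testElt hα₁ hb ha) a ha).1
  rw [← (hT (testElt hα₁ hb ha) a ha).2, ← hF, ← hbdef] at h1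
  -- The lower bound is known only at the point a; holomorphy of T f_a turns it into a bound on the
  -- local norm.
  have h2 := hsub (rep F) (rep_differentiableOn F) p₂ hp0 a ha
  rw [← setLIntegral_weightedVolume α₂ _ (measurableSet_nbhd a) (nbhd_subset_tube a)] at h2
  have h3 : ∫⁻ z in nbhd a, ‖(F : weightedLp m p₂ α₂) z‖ₑ ^ p₂ ∂(weightedVolume m α₂)
      = ∫⁻ z in nbhd a, ‖rep F z‖ₑ ^ p₂ ∂(weightedVolume m α₂) := by
    refine lintegral_congr_ae ?_
    filter_upwards [ae_restrict_of_ae (coe_ae_eq_rep F)] with z hz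
    rw [hz]
  rw [h3]
  calc _ ≤ ((36 ^ |-b|) ^ 3 * ‖rep F a‖ₑ) ^ p₂ := ENNReal.rpow_le_rpow h1 hp0.le
    _ = ((36 ^ |-b|) ^ 3) ^ p₂ * ‖rep F a‖ₑ ^ p₂ := ENNReal.mul_rpow_of_nonneg _ _ hp0.le
    _ ≤ ((36 ^ |-b|) ^ 3) ^ p₂ * (C * erho a ^ (-((m : ℝ) + 2 + α₂)) *
          ∫⁻ z in nbhd a, ‖rep F z‖ₑ ^ p₂ ∂(weightedVolume m α₂)) := by gcongr
    _ = _ := by ring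

/-! ### The Carleson condition forces vanishing averages -/

/-- On a compact set |ρ(z,a)| is at least a constant times |ρ(𝐢,a)|, and a outside the k-th
exhausting set means |ρ(𝐢,a)|² > kρ(a). Hence these functions tend to 0 locally uniformly as a
escapes. -/
theorem norm_testFn_le {γ N k : ℝ} (hγ : -1 < γ) (hk : 0 < k) {a z : Cn m} (ha : a ∈ tube m)
    (hak : a ∉ exhaust m k) (hz : z ∈ exhaust m N) :
    ‖testFn 1 γ (2 * ((m : ℝ) + 2 + γ)) a z‖
      ≤ (4 + 64 * N ^ 2) ^ (2 * ((m : ℝ) + 2 + γ)) * k ^ (-((m : ℝ) + 2 + γ)) := by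
  set σ : ℝ := (m : ℝ) + 2 + γ with hσ
  have hσ0 : 0 < σ := by rw [hσ]; have := (Nat.cast_nonneg m : (0 : ℝ) ≤ m); linarith
  have hpos := mem_tube_iff.1 ha
  set R := ‖rho₂ (basePoint m) a‖ with hR
  have hR0 : 0 < R := norm_rho₂_pos basePoint_mem ha
  have hz0 := norm_rho₂_pos hz.1 ha
  have h1 : R ≤ (4 + 64 * N ^ 2) * ‖rho₂ z a‖ := norm_rho₂_basePoint_le hz ha
  have h2 : k * rho a < R ^ 2 := by
    by_contra hc
    push Not at hc
    exact hak ⟨ha, by rw [norm_rho₂_swap]; exact hc⟩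
  have h3 : ‖rho₂ z a‖ ^ (-(2 * σ)) ≤ (4 + 64 * N ^ 2) ^ (2 * σ) * R ^ (-(2 * σ)) := by
    have := Real.rpow_le_rpow_of_nonpos hR0 h1 (by linarith : -(2 * σ) ≤ 0)
    rw [Real.mul_rpow (by positivity) hz0.le, Real.rpow_neg (by positivity)] at this
    rwa [inv_mul_le_iff₀ (by positivity)] at this
  have h4 : rho a ^ σ * R ^ (-(2 * σ)) ≤ k ^ (-σ) := by
    have h5 : R ^ (-(2 * σ)) = (R ^ 2) ^ (-σ) := by
      rw [← Real.rpow_natCast R 2, ← Real.rpow_mul hR0.le]; congr 1; push_cast; ring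
    have h6 := Real.rpow_le_rpow_of_nonpos (by positivity) h2.le (by linarith : -σ ≤ 0)
    rw [Real.mul_rpow hk.le hpos.le] at h6
    rw [h5]
    calc rho a ^ σ * (R ^ 2) ^ (-σ) ≤ rho a ^ σ * (k ^ (-σ) * rho a ^ (-σ)) := by gcongr
      _ = k ^ (-σ) * (rho a ^ σ * rho a ^ (-σ)) := by ring
      _ = _ := by rw [← Real.rpow_add hpos]; simp
  rw [testFn, norm_mul, Complex.norm_cpow_real, Complex.norm_real,
    Real.norm_of_nonneg (by positivity), ← hσ, show 2 * σ - σ / 1 = σ by ring]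
  calc _ ≤ rho a ^ σ * ((4 + 64 * N ^ 2) ^ (2 * σ) * R ^ (-(2 * σ))) := by gcongr
    _ = (4 + 64 * N ^ 2) ^ (2 * σ) * (rho a ^ σ * R ^ (-(2 * σ))) := by ring
    _ ≤ _ := by gcongr

/-- By contradiction, using only the pair p = 1, q = λ: points a_k with large averages escape every
compact set, while the integrals of the test functions over the balls about a_k stay bounded below.
-/
theorem IsVanishingCarleson.vanishingAverages {μ : Measure (Cn m)} {lam γ : ℝ} (hlam : 0 < lam)
    (hγ : -1 < γ) (h : IsVanishingCarleson μ lam γ) :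
    VanishingAverages μ (lam * ((m : ℝ) + 2 + γ)) := by
  set σ : ℝ := (m : ℝ) + 2 + γ with hσ
  have hσ0 : 0 < σ := by rw [hσ]; have := (Nat.cast_nonneg m : (0 : ℝ) ≤ m); linarith
  set b := 2 * σ with hb
  by_contra hcon
  unfold VanishingAverages at hcon
  push Not at hcon
  obtain ⟨ε, hε, hN⟩ := hcon
  choose a ha hak hlt using fun k : ℕ => hN ((k : ℝ) + 1)
  have hbσ : (m : ℝ) + 2 + γ < b * 1 := by linarith
  have hlim := h 1 lam one_pos hlam (div_one _) (fun k => testFn 1 γ b (a k))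
    (fun k => ⟨differentiableOn_testFn 1 γ b (ha k), memLp_of_wint one_pos
      (differentiableOn_testFn 1 γ b (ha k)) (wint_testFn_ne_top one_pos hγ hbσ (ha k))⟩)
    ⟨(frConst m γ (b * 1)).toNNReal, fun k => by
      rw [eLpNorm_eq_wint one_pos, wint_testFn one_pos γ b (ha k), div_one, ENNReal.rpow_one,
        ENNReal.coe_toNNReal (frConst_lt_top hγ hbσ).ne]⟩ ?_
  · have hlow : ∀ k, (36 ^ |-b|) ^ (-lam) * ε
        ≤ ∫⁻ z in tube m, ‖testFn 1 γ b (a k) z‖ₑ ^ lam ∂μ := by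
      intro k
      have hc : (36 : ℝ≥0∞) ^ |-b| ≠ ⊤ := by simp
      have hc0 : (36 : ℝ≥0∞) ^ |-b| ≠ 0 := by simp
      have hpt : ∀ z ∈ nbhd (a k), (36 ^ |-b|) ^ (-lam) * erho (a k) ^ (-(lam * σ))
          ≤ ‖testFn 1 γ b (a k) z‖ₑ ^ lam := by
        intro z hz
        have h1 : erho (a k) ^ (-σ) ≤ 36 ^ |-b| * ‖testFn 1 γ b (a k) z‖ₑ := by
          have h2 := erho_rpow_le_ek (ha k) hz (-b)
          rw [enorm_testFn 1 γ b (ha k) hz.1]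
          calc erho (a k) ^ (-σ) = erho (a k) ^ (b - σ / 1) * erho (a k) ^ (-b) := by
                rw [← erho_rpow_add (ha k)]; congr 1; ring
            _ ≤ erho (a k) ^ (b - σ / 1) * (36 ^ |-b| * ek z (a k) ^ (-b)) := by gcongr
            _ = _ := by ring
        have h3 := ENNReal.rpow_le_rpow h1 hlam.le
        rw [ENNReal.mul_rpow_of_nonneg _ _ hlam.le, ← ENNReal.rpow_mul] at h3
        rw [show -(lam * σ) = -σ * lam by ring]
        calc _ ≤ (36 ^ |-b|) ^ (-lam) * ((36 ^ |-b|) ^ lam * ‖testFn 1 γ b (a k) z‖ₑ ^ lam) := by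
              gcongr
          _ = _ := by
              rw [← mul_assoc, ← ENNReal.rpow_add _ _ hc0 hc]; simp
      calc (36 ^ |-b|) ^ (-lam) * ε
          = (36 ^ |-b|) ^ (-lam) * erho (a k) ^ (-(lam * σ)) * (ε * erho (a k) ^ (lam * σ)) := by
            rw [mul_assoc, mul_left_comm (erho (a k) ^ (-(lam * σ))), ← erho_rpow_add (ha k)]; simp
        _ ≤ (36 ^ |-b|) ^ (-lam) * erho (a k) ^ (-(lam * σ)) * μ (nbhd (a k)) := by
            gcongr; exact (hlt k).le
        _ = ∫⁻ _ in nbhd (a k), (36 ^ |-b|) ^ (-lam) * erho (a k) ^ (-(lam * σ)) ∂μ := by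
            rw [setLIntegral_const]
        _ ≤ ∫⁻ z in nbhd (a k), ‖testFn 1 γ b (a k) z‖ₑ ^ lam ∂μ :=
            setLIntegral_mono' (measurableSet_nbhd _) hpt
        _ ≤ _ := lintegral_mono_set (nbhd_subset_tube _)
    have h0 := ge_of_tendsto' hlim hlow
    have hp : (0 : ℝ≥0∞) < (36 ^ |-b|) ^ (-lam) * ε :=
      ENNReal.mul_pos (ENNReal.rpow_pos (by positivity) (by simp)).ne' hε.ne'
    exact absurd h0 (not_le.2 hp)
  · intro K hK hKc
    obtain ⟨N, -, hKN⟩ := exists_subset_exhaust hK hKc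
    have h1 : Tendsto (fun k : ℕ => (4 + 64 * N ^ 2) ^ b * ((k : ℝ) + 1) ^ (-σ)) atTop (𝓝 0) := by
      have h2 := (tendsto_rpow_neg_atTop hσ0).comp
        (tendsto_atTop_add_const_right atTop (1 : ℝ) tendsto_natCast_atTop_atTop)
      simpa using h2.const_mul ((4 + 64 * N ^ 2) ^ b)
    rw [Metric.tendstoUniformlyOn_iff]
    intro δ hδ
    filter_upwards [h1.eventually_lt_const hδ] with k hk z hz
    rw [Pi.zero_apply, dist_zero_left]
    exact (norm_testFn_le hγ (by positivity) (ha k) (hak k) (hKN hz)).trans_lt hk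

/-! ### Splitting the measure into a compact part and a small outer part -/

/-- The class 𝓜₊ enters only through this finiteness on compact sets and the σ-finiteness that
follows from it: the weight in its definition is bounded below by (2N)^(−t) here. -/
theorem MeasureClass.measure_exhaust_ne_top {μ : Measure (Cn m)} (hμ : MeasureClass μ) (N : ℝ) :
    μ (exhaust m N) ≠ ⊤ := by
  obtain ⟨t, ht, hint⟩ := hμ
  rcases le_or_gt N 0 with hN | hN
  · have : exhaust m N = ∅ := Set.eq_empty_of_forall_notMem fun z hz => (exhaust_pos hz).not_ge hN
    simp [this]
  have h1 : ENNReal.ofReal (1 / (2 * N) ^ t) * μ (exhaust m N) ≤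
      ∫⁻ z in tube m, ENNReal.ofReal (1 / ‖rho₂ z (basePoint m)‖ ^ t) ∂μ := by
    rw [← setLIntegral_const]
    refine (setLIntegral_mono' (measurableSet_exhaust N) fun z hz => ?_).trans
      (lintegral_mono_set (exhaust_subset_tube N))
    have h2 := norm_rho₂_pos hz.1 basePoint_mem
    have h3 := (exhaust_bounds hz).2
    exact ENNReal.ofReal_le_ofReal (one_div_le_one_div_of_le (by positivity) (by gcongr))
  intro hc
  rw [hc, ENNReal.mul_top (by simp; positivity)] at h1
  exact absurd hint (not_lt.2 h1)

theorem MeasureClass.sigmaFinite {μ : Measure (Cn m)} (hμ : MeasureClass μ) :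
    SigmaFinite (μ.restrict (tube m)) := by
  refine ⟨⟨⟨fun N : ℕ => exhaust m N ∪ (tube m)ᶜ, fun _ => trivial, fun N => ?_, ?_⟩⟩⟩
  · refine (measure_union_le _ _).trans_lt (ENNReal.add_lt_top.2 ⟨?_, ?_⟩)
    · exact (Measure.restrict_apply_le _ _).trans_lt
        (lt_top_iff_ne_top.2 (hμ.measure_exhaust_ne_top N))
    · rw [Measure.restrict_apply measurableSet_tube.compl, Set.compl_inter_self, measure_empty]
      exact ENNReal.zero_lt_top
  · refine Set.eq_univ_of_forall fun z => Set.mem_iUnion.2 ?_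
    by_cases hz : z ∈ tube m
    · obtain ⟨N, hN⟩ := exists_mem_exhaust hz
      exact ⟨N, Or.inl hN⟩
    · exact ⟨0, Or.inr hz⟩

/-- The part of a measure that lives near the boundary and near infinity. -/
def outer (μ : Measure (Cn m)) (N : ℝ) : Measure (Cn m) :=
  (μ.restrict (tube m)).restrict (exhaust m N)ᶜ

theorem lintegral_split (μ : Measure (Cn m)) (N : ℝ) (g : Cn m → ℝ≥0∞) :
    ∫⁻ w in tube m, g w ∂μ = ∫⁻ w in exhaust m N, g w ∂μ + ∫⁻ w in tube m, g w ∂(outer μ N) := by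
  rw [← lintegral_add_compl g (measurableSet_exhaust N) (μ := μ.restrict (tube m)),
    Measure.restrict_restrict (measurableSet_exhaust N),
    Set.inter_eq_left.2 (exhaust_subset_tube N), outer,
    Measure.restrict_restrict measurableSet_tube, Measure.restrict_restrict
      (measurableSet_exhaust N).compl, Measure.restrict_restrict
      (measurableSet_tube.inter (measurableSet_exhaust N).compl), Set.inter_comm (tube m),
      Set.inter_assoc, Set.inter_self]

/-- The cut is made beyond N, at 10368·max N 0, so that a ball centred in the N-th set misses the
outer part entirely; every other ball is covered by the hypothesis. -/
theorem VanishingAverages.exists_outer_le {μ : Measure (Cn m)} {c : ℝ} (h : VanishingAverages μ c)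
    {ε : ℝ≥0∞} (hε : 0 < ε) :
    ∃ N : ℝ, ∀ u ∈ tube m, outer μ N (nbhd u) ≤ ε * erho u ^ c := by
  obtain ⟨N, hN⟩ := h ε hε
  refine ⟨10368 * max N 0, fun u hu => ?_⟩
  by_cases hmem : u ∈ exhaust m N
  · have h0 : outer μ (10368 * max N 0) (nbhd u) = 0 := by
      rw [outer, Measure.restrict_apply (measurableSet_nbhd u)]
      have : nbhd u ∩ (exhaust m (10368 * max N 0))ᶜ = ∅ := by
        refine Set.eq_empty_of_forall_notMem fun z hz => hz.2 ?_
        exact mem_exhaust_of_mem_nbhd (le_max_right _ _) hz.1.1 (mem_nbhd_symm hu hz.1)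
          (exhaust_mono (le_max_left _ _) hmem)
      rw [this, measure_empty]
    rw [h0]; exact zero_le
  · refine le_trans ?_ (hN u hu hmem)
    exact (Measure.restrict_apply_le _ _).trans (Measure.restrict_apply_le _ _)

theorem bz_split (μ : Measure (Cn m)) (N b : ℝ) (f : Cn m → ℂ) (z : Cn m) :
    bz μ b f z = ∫⁻ w in exhaust m N, ‖f w‖ₑ * ek z w ^ (-b) ∂μ + bz (outer μ N) b f z :=
  lintegral_split μ N _

theorem ek_rpow_le_of_mem_exhaust {N : ℝ} {z w : Cn m} (hz : z ∈ tube m) (hw : w ∈ exhaust m N)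
    {b : ℝ} (hb : 0 ≤ b) :
    ek z w ^ (-b) ≤ ENNReal.ofReal ((4 + 64 * N ^ 2) ^ b) * ek (basePoint m) z ^ (-b) := by
  rw [ek_rpow hz hw.1, ek_rpow basePoint_mem hz, ← ENNReal.ofReal_mul (by positivity)]
  refine ENNReal.ofReal_le_ofReal ?_
  have h1 := norm_rho₂_basePoint_le hw hz
  have hR0 : 0 < ‖rho₂ (basePoint m) z‖ := norm_rho₂_pos basePoint_mem hz
  have := Real.rpow_le_rpow_of_nonpos hR0 h1 (by linarith : -b ≤ 0)
  rw [Real.mul_rpow (by positivity) (norm_nonneg _), Real.rpow_neg (by positivity),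
    inv_mul_le_iff₀ (by positivity), norm_rho₂_swap] at this
  exact this

theorem inner_part_le (μ : Measure (Cn m)) {N b : ℝ} (hb : 0 ≤ b) {f : Cn m → ℂ} {S : ℝ≥0∞}
    (hS : ∀ w ∈ exhaust m N, ‖f w‖ₑ ≤ S) {z : Cn m} (hz : z ∈ tube m) :
    ∫⁻ w in exhaust m N, ‖f w‖ₑ * ek z w ^ (-b) ∂μ ≤
      (S * (ENNReal.ofReal ((4 + 64 * N ^ 2) ^ b) * μ (exhaust m N))) *
        ek (basePoint m) z ^ (-b) := by
  calc _ ≤ ∫⁻ _ in exhaust m N, S * (ENNReal.ofReal ((4 + 64 * N ^ 2) ^ b) *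
        ek (basePoint m) z ^ (-b)) ∂μ :=
        setLIntegral_mono' (measurableSet_exhaust N) fun w hw =>
          mul_le_mul' (hS w hw) (ek_rpow_le_of_mem_exhaust hz hw hb)
    _ = _ := by rw [setLIntegral_const]; ring

theorem measurable_bz (ν : Measure (Cn m)) [SFinite (ν.restrict (tube m))] (b : ℝ) {f : Cn m → ℂ}
    (hf : DifferentiableOn ℂ f (tube m)) : Measurable (bz ν b f) := by
  have h1 : Measurable ((tube m).indicator fun w => ‖f w‖ₑ) :=
    measurable_indicator_of_continuousOn hf.continuousOn.enorm measurableSet_tube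
  have h2 : Measurable fun p : Cn m × Cn m =>
      (tube m).indicator (fun w => ‖f w‖ₑ) p.2 * ek p.1 p.2 ^ (-b) :=
    (h1.comp measurable_snd).mul (measurable_ek.pow_const _)
  have h3 := h2.lintegral_prod_right' (ν := ν.restrict (tube m))
  convert h3 using 1
  ext z
  refine setLIntegral_congr_fun measurableSet_tube fun w hw => ?_
  simp only [Set.indicator_of_mem hw]

/-- An estimate for `bz μ b f` by the sum of a term that is controlled on a compact set and of a
term with a small constant. -/
def HasSplitBound (μ : Measure (Cn m)) (b p₁ α₁ p₂ α₂ : ℝ) : Prop :=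
  ∃ C : ℝ≥0∞, C ≠ ⊤ ∧ ∀ ε : ℝ≥0∞, 0 < ε → ε ≠ ⊤ → ∃ (N : ℝ) (A : ℝ≥0∞), A ≠ ⊤ ∧
    ∀ f : Cn m → ℂ, DifferentiableOn ℂ f (tube m) → wint p₁ α₁ (fun z => ‖f z‖ₑ) ≠ ⊤ →
    ∀ S : ℝ≥0∞, S ≠ ⊤ → (∀ w ∈ exhaust m N, ‖f w‖ₑ ≤ S) →
    wint p₂ α₂ (bz μ b f)
      ≤ S ^ p₂ * A + C * ε ^ p₂ * wint p₁ α₁ (fun z => ‖f z‖ₑ) ^ (p₂ / p₁)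

theorem VanishingAverages.hasSplitBound {p₁ p₂ α₁ α₂ ξ : ℝ} (hp₁ : 1 < p₁) (hp : p₁ ≤ p₂)
    (hα₂ : -1 < α₂) (hξ : -1 < ξ) (h : 1 + α₂ < p₂ * (1 + ξ))
    (hb : (m : ℝ) + 2 + α₂ < ((m : ℝ) + 2 + ξ) * p₂) {μ : Measure (Cn m)} (hμ : MeasureClass μ)
    (hv : VanishingAverages μ (carlesonExp m p₁ α₁ p₂ α₂ ξ)) :
    HasSplitBound μ ((m : ℝ) + 2 + ξ) p₁ α₁ p₂ α₂ := by
  have hp₂0 : 0 < p₂ := by linarith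
  have hσf := hμ.sigmaFinite
  obtain ⟨C, hC, hbd⟩ := exists_bz_bound m (α₁ := α₁) hp₁ hp hα₂ hξ h
  set b : ℝ := (m : ℝ) + 2 + ξ with hbdef
  have hb0 : 0 ≤ b := by rw [hbdef]; have := (Nat.cast_nonneg m : (0 : ℝ) ≤ m); linarith
  have h2t : (2 : ℝ≥0∞) ^ (p₂ - 1) ≠ ⊤ := ENNReal.rpow_ne_top_of_nonneg (by linarith) (by simp)
  refine ⟨2 ^ (p₂ - 1) * C, ENNReal.mul_ne_top h2t hC, fun ε hε hεt => ?_⟩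
  obtain ⟨N, hN⟩ := hv.exists_outer_le hε
  have hsf : SFinite (outer μ N) := by unfold outer; infer_instance
  set D : ℝ≥0∞ := ENNReal.ofReal ((4 + 64 * N ^ 2) ^ b) * μ (exhaust m N) with hD
  have hDt : D ≠ ⊤ := ENNReal.mul_ne_top ENNReal.ofReal_ne_top (hμ.measure_exhaust_ne_top N)
  refine ⟨N, 2 ^ (p₂ - 1) * (D ^ p₂ * frConst m α₂ (b * p₂)), ENNReal.mul_ne_top h2t
    (ENNReal.mul_ne_top (ENNReal.rpow_ne_top_of_nonneg hp₂0.le hDt) (frConst_lt_top hα₂ hb).ne),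
    fun f hf hfN S hS hfS => ?_⟩
  have h1 := hbd (outer μ N) f hf ε hεt hN hfN
  have hm : Measurable (bz (outer μ N) b f) := measurable_bz _ _ hf
  have hfr : wint p₂ α₂ (fun z => ek (basePoint m) z ^ (-b)) = frConst m α₂ (b * p₂) := by
    unfold wint frConst
    refine lintegral_congr fun z => ?_
    rw [← ENNReal.rpow_mul, neg_mul]
  calc wint p₂ α₂ (bz μ b f)
      ≤ wint p₂ α₂ (fun z => (S * D) * ek (basePoint m) z ^ (-b) + bz (outer μ N) b f z) := by
        refine wint_mono hp₂0.le fun z hz => ?_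
        rw [bz_split μ N]
        gcongr
        exact inner_part_le μ hb0 hfS hz
    _ ≤ ∫⁻ z in tube m, 2 ^ (p₂ - 1) * (erho z ^ α₂ * ((S * D) * ek (basePoint m) z ^ (-b)) ^ p₂
          + erho z ^ α₂ * bz (outer μ N) b f z ^ p₂) := by
        refine setLIntegral_mono' measurableSet_tube fun z _ => ?_
        rw [← mul_add, mul_left_comm ((2 : ℝ≥0∞) ^ (p₂ - 1))]
        -- Convexity of the power: (x + y)^p₂ ≤ 2^(p₂−1)(x^p₂ + y^p₂).
        exact mul_le_mul_right (ENNReal.rpow_add_le_mul_rpow_add_rpow _ _ (hp₁.le.trans hp)) _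
    _ = 2 ^ (p₂ - 1) * (wint p₂ α₂ (fun z => (S * D) * ek (basePoint m) z ^ (-b))
          + wint p₂ α₂ (bz (outer μ N) b f)) := by
        rw [lintegral_const_mul' _ _ h2t, lintegral_add_right]
        · rfl
        · exact (measurable_erho_rpow _).mul (hm.pow_const _)
    _ = 2 ^ (p₂ - 1) * (S ^ p₂ * D ^ p₂ * frConst m α₂ (b * p₂)
          + wint p₂ α₂ (bz (outer μ N) b f)) := by
        rw [wint_const_mul hp₂0.le (ENNReal.mul_ne_top hS hDt), hfr,
          ENNReal.mul_rpow_of_nonneg _ _ hp₂0.le]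
    _ ≤ 2 ^ (p₂ - 1) * (S ^ p₂ * D ^ p₂ * frConst m α₂ (b * p₂)
          + C * ε ^ p₂ * wint p₁ α₁ (fun z => ‖f z‖ₑ) ^ (p₂ / p₁)) := by gcongr
    _ = _ := by ring

/-! ### Vanishing averages imply the Carleson condition -/

/-- Averaging with G = 1, then |f|^q = |f|^p |f|^(p(λ−1)) with the pointwise bound on the second
factor; λ ≥ 1 makes its exponent nonnegative. -/
theorem exists_carleson_bound {lam γ p q : ℝ} (hp : 0 < p) (hq : 0 < q) (hqp : q / p = lam)
    (hlam : 1 ≤ lam) : ∃ C : ℝ≥0∞, C ≠ ⊤ ∧ ∀ (ν : Measure (Cn m)) [SFinite ν] (f : Cn m → ℂ),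
      DifferentiableOn ℂ f (tube m) → ∀ M : ℝ≥0∞, M ≠ ⊤ →
      (∀ u ∈ tube m, ν (nbhd u) ≤ M * erho u ^ (lam * ((m : ℝ) + 2 + γ))) →
      wint p γ (fun z => ‖f z‖ₑ) ≠ ⊤ →
      ∫⁻ w in tube m, ‖f w‖ₑ ^ q ∂ν ≤ C * M * wint p γ (fun z => ‖f z‖ₑ) ^ lam := by
  obtain ⟨A, -, hA, hav⟩ := exists_averaging m
  obtain ⟨P, -, hP, hpt⟩ := exists_pointwise_bound m γ
  have hl0 : 0 ≤ lam - 1 := by linarith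
  refine ⟨A * P ^ (lam - 1), ENNReal.mul_ne_top hA (ENNReal.rpow_ne_top_of_nonneg hl0 hP), ?_⟩
  intro ν _ f hf M hM hν hN
  set W := wint p γ (fun z => ‖f z‖ₑ) with hW
  have h1 := hav ν f hf q hq (fun _ => 1) 1 measurable_const (by simp) (fun _ _ _ _ => by simp) M _
    hM hν
  simp only [mul_one, one_mul] at h1
  refine h1.trans ?_
  have hqq : q = p + p * (lam - 1) := by rw [← hqp]; field_simp; ring
  have h2 : ∫⁻ u in tube m, ‖f u‖ₑ ^ q * erho u ^ (lam * ((m : ℝ) + 2 + γ) - ((m : ℝ) + 2))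
      ≤ ∫⁻ u in tube m, (P ^ (lam - 1) * W ^ (lam - 1)) * (erho u ^ γ * ‖f u‖ₑ ^ p) := by
    refine setLIntegral_mono' measurableSet_tube fun u hu => ?_
    have h3 := ENNReal.rpow_le_rpow (hpt f hf p hp u hu) hl0
    rw [← ENNReal.rpow_mul, ENNReal.mul_rpow_of_nonneg _ _ hl0,
      ENNReal.mul_rpow_of_nonneg _ _ hl0, ← ENNReal.rpow_mul] at h3
    have h4 : ‖f u‖ₑ ^ q = ‖f u‖ₑ ^ p * ‖f u‖ₑ ^ (p * (lam - 1)) := by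
      rw [← ENNReal.rpow_add_of_nonneg _ _ hp.le (by positivity), ← hqq]
    rw [h4]
    calc _ ≤ ‖f u‖ₑ ^ p * (P ^ (lam - 1) * erho u ^ (-((m : ℝ) + 2 + γ) * (lam - 1)) *
          W ^ (lam - 1)) * erho u ^ (lam * ((m : ℝ) + 2 + γ) - ((m : ℝ) + 2)) := by gcongr
      _ = (P ^ (lam - 1) * W ^ (lam - 1)) * (erho u ^ (-((m : ℝ) + 2 + γ) * (lam - 1) +
          (lam * ((m : ℝ) + 2 + γ) - ((m : ℝ) + 2))) * ‖f u‖ₑ ^ p) := by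
          rw [erho_rpow_add hu]; ring
      _ = _ := by congr 3; ring
  rw [lintegral_const_mul' _ _ (ENNReal.mul_ne_top (ENNReal.rpow_ne_top_of_nonneg hl0 hP)
    (ENNReal.rpow_ne_top_of_nonneg hl0 hN))] at h2
  have hWl : W ^ lam = W ^ (lam - 1) * W := by
    conv_rhs => rw [← ENNReal.rpow_one W, ← ENNReal.rpow_mul, one_mul]
    rw [← ENNReal.rpow_add_of_nonneg _ _ hl0 zero_le_one]; congr 1; ring
  rw [hWl]
  calc _ ≤ A * M * ((P ^ (lam - 1) * W ^ (lam - 1)) * W) := by gcongr; exact h2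
    _ = _ := by ring

theorem VanishingAverages.isVanishingCarleson {μ : Measure (Cn m)} {lam γ : ℝ} (hlam : 1 ≤ lam)
    (hμ : MeasureClass μ) (h : VanishingAverages μ (lam * ((m : ℝ) + 2 + γ))) :
    IsVanishingCarleson μ lam γ := by
  intro p q hp hq hqp f hf hM hunif
  obtain ⟨M, hM⟩ := hM
  obtain ⟨C, hC, hbd⟩ := exists_carleson_bound (m := m) (γ := γ) hp hq hqp hlam
  have hσf := hμ.sigmaFinite
  set R : ℝ≥0∞ := ((M : ℝ≥0∞) ^ p) ^ lam with hR
  have hRt : R ≠ ⊤ := ENNReal.rpow_ne_top_of_nonneg (by linarith)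
    (ENNReal.rpow_ne_top_of_nonneg hp.le ENNReal.coe_ne_top)
  have hW : ∀ k, wint p γ (fun z => ‖f k z‖ₑ) ≤ (M : ℝ≥0∞) ^ p := fun k => by
    rw [wint_eq_eLpNorm hp]; exact ENNReal.rpow_le_rpow (hM k) hp.le
  rw [ENNReal.tendsto_nhds_zero]
  intro δ hδ
  have hδ2 := ENNReal.half_pos hδ.ne'
  have hCR : C * R + 1 ≠ ⊤ := by simpa using ENNReal.mul_ne_top hC hRt
  have hCR0 : C * R + 1 ≠ 0 := by simp
  -- The minimum with 1 keeps ε finite, and C·R + 1 avoids division by zero.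
  obtain ⟨ε, hε0, hε⟩ : ∃ ε : ℝ≥0∞, 0 < ε ∧ ε ≠ ⊤ ∧ C * ε * R ≤ δ / 2 := by
    refine ⟨min (δ / 2 / (C * R + 1)) 1, lt_min (ENNReal.div_pos hδ2.ne' hCR) one_pos,
      ne_top_of_le_ne_top ENNReal.one_ne_top (min_le_right _ _), ?_⟩
    calc C * min (δ / 2 / (C * R + 1)) 1 * R = (C * R) * min (δ / 2 / (C * R + 1)) 1 := by ring
      _ ≤ (C * R + 1) * (δ / 2 / (C * R + 1)) := by
        gcongr
        · exact le_self_add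
        · exact min_le_left _ _
      _ = _ := ENNReal.mul_div_cancel hCR0 hCR
  obtain ⟨N, hN⟩ := h.exists_outer_le hε0
  have hsf : SFinite (outer μ N) := by unfold outer; infer_instance
  have hμN := hμ.measure_exhaust_ne_top N
  have hin : Tendsto (fun k => ∫⁻ w in exhaust m N, ‖f k w‖ₑ ^ q ∂μ) atTop (𝓝 0) := by
    rw [ENNReal.tendsto_nhds_zero]
    intro η hη
    obtain ⟨s, hs0, hs⟩ : ∃ s : ℝ, 0 < s ∧ ENNReal.ofReal s ^ q * μ (exhaust m N) ≤ η := by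
      have h1 : Tendsto (fun s : ℝ => ENNReal.ofReal s ^ q * μ (exhaust m N)) (𝓝[>] 0) (𝓝 0) := by
        have h2 : Tendsto (fun s : ℝ => ENNReal.ofReal s ^ q) (𝓝[>] 0) (𝓝 0) := by
          have h3 : Continuous fun s : ℝ => ENNReal.ofReal s ^ q :=
            ENNReal.continuous_rpow_const.comp ENNReal.continuous_ofReal
          have h4 := (h3.tendsto 0).mono_left (nhdsWithin_le_nhds (s := Set.Ioi 0))
          simpa [ENNReal.zero_rpow_of_pos hq] using h4
        simpa using ENNReal.Tendsto.mul_const h2 (Or.inr hμN)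
      obtain ⟨s, hs1, hs2⟩ :=
        ((h1.eventually_le_const hη).and self_mem_nhdsWithin).exists
      exact ⟨s, hs2, hs1⟩
    have h5 := Metric.tendstoUniformlyOn_iff.1 (hunif _ (exhaust_subset_tube N)
      (isCompact_exhaust N)) s hs0
    filter_upwards [h5] with k hk
    refine le_trans ?_ hs
    rw [← setLIntegral_const]
    refine setLIntegral_mono' (measurableSet_exhaust N) fun w hw => ?_
    refine ENNReal.rpow_le_rpow ?_ hq.le
    have h6 := hk w hw
    rw [Pi.zero_apply, dist_zero_left] at h6
    rw [← ofReal_norm]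
    exact ENNReal.ofReal_le_ofReal h6.le
  filter_upwards [hin.eventually_le_const hδ2] with k hk
  rw [lintegral_split μ N, ← ENNReal.add_halves δ]
  refine add_le_add hk ?_
  refine (hbd (outer μ N) (f k) (hf k).1 ε hε.1 hN
    (ne_top_of_le_ne_top (ENNReal.rpow_ne_top_of_nonneg hp.le ENNReal.coe_ne_top) (hW k))).trans ?_
  refine le_trans ?_ hε.2
  gcongr
  exact ENNReal.rpow_le_rpow (hW k) (by linarith)

/-! ### Cauchy estimates and Montel's theorem -/

theorem mapsTo_closedBall_of_norm_le {E F : Type*} [PseudoMetricSpace E]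
    [NormedAddCommGroup F] {f : E → F} {c : E} {r M : ℝ} (hr : 0 < r)
    (hM : ∀ z ∈ Metric.ball c r, ‖f z‖ ≤ M) :
    Set.MapsTo f (Metric.ball c r) (Metric.closedBall (f c) (2 * M)) := fun z hz => by
  rw [Metric.mem_closedBall, dist_eq_norm]
  linarith [norm_sub_le (f z) (f c), hM z hz, hM c (Metric.mem_ball_self hr)]

section CauchyEstimates

variable {E F : Type*} [NormedAddCommGroup E] [NormedSpace ℂ E] [NormedAddCommGroup F]
  [NormedSpace ℂ F]

theorem dist_le_of_norm_le_ball {f : E → F} {c z : E} {r M : ℝ}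
    (hd : DifferentiableOn ℂ f (Metric.ball c r)) (hM : ∀ z ∈ Metric.ball c r, ‖f z‖ ≤ M)
    (hz : z ∈ Metric.ball c r) : dist (f z) (f c) ≤ 2 * M / r * dist z c :=
  Complex.dist_le_div_mul_dist_of_mapsTo_ball hd
    (mapsTo_closedBall_of_norm_le (Metric.nonempty_ball.1 ⟨z, hz⟩) hM) hz

theorem norm_fderiv_le_of_norm_le_ball {f : E → F} {c : E} {r M : ℝ} (hr : 0 < r)
    (hd : DifferentiableOn ℂ f (Metric.ball c r)) (hM : ∀ z ∈ Metric.ball c r, ‖f z‖ ≤ M) :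
    ‖fderiv ℂ f c‖ ≤ 2 * M / r :=
  Complex.norm_fderiv_le_div_of_mapsTo_ball hd (mapsTo_closedBall_of_norm_le hr hM) hr

/-- A limit of holomorphic functions on an open subset of `ℂⁿ`, uniform on compact subsets, is
holomorphic. -/
theorem differentiableOn_of_tendstoUniformlyOn_isCompact [ProperSpace E] [CompleteSpace F]
    {U : Set E} (hU : IsOpen U)
    {f : ℕ → E → F} {g : E → F} (hf : ∀ n, DifferentiableOn ℂ (f n) U)
    (hfg : ∀ K ⊆ U, IsCompact K → TendstoUniformlyOn f g atTop K) : DifferentiableOn ℂ g U := by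
  intro x hx
  obtain ⟨r, hr, hrV⟩ := Metric.nhds_basis_closedBall.mem_iff.1 (hU.mem_nhds hx)
  have hunif : TendstoUniformlyOn f g atTop (Metric.ball x r) :=
    (hfg _ hrV (isCompact_closedBall x r)).mono Metric.ball_subset_closedBall
  have hrU : Metric.ball x r ⊆ U := Metric.ball_subset_closedBall.trans hrV
  have hsub : ∀ z ∈ Metric.ball x (r / 2), Metric.ball z (r / 2) ⊆ Metric.ball x r := fun z hz =>
    Metric.ball_subset_ball' (by linarith [Metric.mem_ball.1 hz])
  -- On a ball of half the radius, Cauchy estimates applied to the differences make the derivatives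
  -- uniformly Cauchy.
  have hcau : UniformCauchySeqOn (fun n => fderiv ℂ (f n)) atTop (Metric.ball x (r / 2)) := by
    rw [Metric.uniformCauchySeqOn_iff]
    intro ε hε
    obtain ⟨N, hN⟩ := Metric.uniformCauchySeqOn_iff.1 hunif.uniformCauchySeqOn (ε * r / 8)
      (by positivity)
    refine ⟨N, fun k hk n hn z hz => ?_⟩
    have hz' := hrU (Metric.ball_subset_ball (by linarith) hz)
    have hdk := fun n => (hf n z hz').differentiableAt (hU.mem_nhds hz')
    rw [dist_eq_norm, ← fderiv_sub (hdk k) (hdk n)]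
    have := norm_fderiv_le_of_norm_le_ball (f := f k - f n) (M := ε * r / 8) (half_pos hr)
      (((hf k).sub (hf n)).mono ((hsub z hz).trans hrU)) fun w hw => by
        rw [Pi.sub_apply, ← dist_eq_norm]
        exact (hN k hk n hn w (hsub z hz hw)).le
    refine this.trans_lt ?_
    have : 2 * (ε * r / 8) / (r / 2) = ε / 2 := by field_simp; ring
    rw [this]; linarith
  have hlim : ∀ z ∈ Metric.ball x (r / 2), ∃ L, Tendsto (fun n => fderiv ℂ (f n) z) atTop (𝓝 L) :=
    fun z hz => cauchySeq_tendsto_of_complete (hcau.cauchySeq hz)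
  choose! g' hg' using hlim
  refine (hasFDerivAt_of_tendstoUniformlyOn Metric.isOpen_ball
    (hcau.tendstoUniformlyOn_of_tendsto hg') (fun n z hz => ?_)
    (fun z hz => hunif.tendsto_at (Metric.ball_subset_ball (by linarith) hz))
    (Metric.mem_ball_self (half_pos hr))).differentiableAt.differentiableWithinAt
  have hz' := hrU (Metric.ball_subset_ball (by linarith) hz)
  exact ((hf n z hz').differentiableAt (hU.mem_nhds hz')).hasFDerivAt

/-- Montel's theorem, in the form of finite nets for the uniform distance on a compact set. -/
theorem exists_finite_net [ProperSpace E] {X : Type*} {f : X → E → ℂ} {U K : Set E} (hU : IsOpen U)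
    (hK : IsCompact K) (hKU : K ⊆ U) (S : Set X) (hf : ∀ x ∈ S, DifferentiableOn ℂ (f x) U)
    (hb : ∀ K' ⊆ U, IsCompact K' → ∃ M, ∀ x ∈ S, ∀ w ∈ K', ‖f x w‖ ≤ M) {δ : ℝ} (hδ : 0 < δ) :
    ∃ t ⊆ S, t.Finite ∧ ∀ x ∈ S, ∃ y ∈ t, ∀ w ∈ K, ‖f x w - f y w‖ ≤ δ := by
  obtain ⟨r, hr, hrU⟩ := hK.exists_cthickening_subset_open hU hKU
  obtain ⟨M, hM⟩ := hb _ hrU hK.cthickening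
  set L := 2 * max M 0 / r
  have hL : 0 ≤ L := by positivity
  have hball : ∀ w ∈ K, Metric.ball w r ⊆ Metric.cthickening r K := fun w hw =>
    Metric.ball_subset_closedBall.trans (Metric.closedBall_subset_cthickening hw r)
  -- L is a common Lipschitz constant relative to the centres, so no function of the family moves by
  -- more than δ/4 on an η-ball.
  set η := min r (δ / (4 * (L + 1)))
  have hη : 0 < η := by positivity
  obtain ⟨c, hcK, hcfin, hcov⟩ := hK.finite_cover_balls hη
  have := hcfin.to_subtype
  have := Fintype.ofFinite c
  have hlip : ∀ x ∈ S, ∀ z ∈ c, ∀ w ∈ Metric.ball z η, ‖f x w - f x z‖ ≤ δ / 4 := by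
    intro x hx z hz w hw
    have h1 := dist_le_of_norm_le_ball (f := f x) (M := max M 0) (r := r)
      ((hf x hx).mono ((hball z (hcK hz)).trans hrU))
      (fun v hv => (hM x hx v (hball z (hcK hz) hv)).trans (le_max_left _ _))
      (Metric.ball_subset_ball (min_le_left _ _) hw)
    rw [dist_eq_norm] at h1
    have h2 : dist w z ≤ δ / (4 * (L + 1)) := (Metric.mem_ball.1 hw).le.trans (min_le_right _ _)
    calc _ ≤ L * dist w z := h1
      _ ≤ (L + 1) * (δ / (4 * (L + 1))) := by gcongr; linarith
      _ = δ / 4 := by field_simp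
  -- Sampling at the finitely many centres maps the family into a bounded set of a
  -- finite-dimensional space; a finite net there, lifted to S, is the net sought.
  set Φ : X → c → ℂ := fun x z => f x z
  have hbd : Bornology.IsBounded (Φ '' S) := by
    refine isBounded_iff_forall_norm_le.2 ⟨max M 0, ?_⟩
    rintro _ ⟨x, hx, rfl⟩
    refine (pi_norm_le_iff_of_nonneg (le_max_right _ _)).2 fun z => ?_
    exact (hM x hx z (Metric.self_subset_cthickening K (hcK z.2))).trans (le_max_left _ _)
  obtain ⟨t, htS, htfin, htcov⟩ := Metric.finite_approx_of_totallyBounded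
    (hbd.isCompact_closure.totallyBounded.subset subset_closure) (δ / 4) (by positivity)
  obtain ⟨t', ht'S, ht'fin, rfl⟩ := Set.exists_subset_image_finite_and.1 ⟨t, htS, htfin, rfl⟩
  refine ⟨t', ht'S, ht'fin, fun x hx => ?_⟩
  obtain ⟨_, hv, hxy⟩ := Set.mem_iUnion₂.1 (htcov ⟨x, hx, rfl⟩)
  obtain ⟨y, hy, rfl⟩ := hv
  refine ⟨y, hy, fun w hw => ?_⟩
  obtain ⟨z, hz, hwz⟩ := Set.mem_iUnion₂.1 (hcov hw)
  have h1 := hlip x hx z hz w hwz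
  have h2 := hlip y (ht'S hy) z hz w hwz
  have h3 : ‖f x z - f y z‖ ≤ δ / 4 := by
    rw [← dist_eq_norm]
    exact (dist_le_pi_dist (Φ x) (Φ y) ⟨z, hz⟩).trans (Metric.mem_ball.1 hxy).le
  have : f x w - f y w = (f x w - f x z) + (f x z - f y z) - (f y w - f y z) := by ring
  rw [this]
  linarith [norm_sub_le ((f x w - f x z) + (f x z - f y z)) (f y w - f y z),
    norm_add_le (f x w - f x z) (f x z - f y z)]

end CauchyEstimates

/-! ### Point evaluations and completeness of the Bergman space -/

theorem rep_sub {p α : ℝ} (f g : bergman m p α) :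
    Set.EqOn (rep (f - g)) (rep f - rep g) (tube m) := by
  refine eqOn_tube_of_ae_eq (α := α) (rep_differentiableOn _)
    ((rep_differentiableOn f).sub (rep_differentiableOn g)) ?_
  have h1 := Lp.coeFn_sub (f : Lp ℂ (ENNReal.ofReal p) (weightedVolume m α)) g
  have h2 := coe_ae_eq_rep (f - g)
  rw [Submodule.coe_sub] at h2
  filter_upwards [h1, h2, coe_ae_eq_rep f, coe_ae_eq_rep g] with z h1 h2 h3 h4
  rw [← h2, h1, Pi.sub_apply, Pi.sub_apply, h3, h4]

theorem exists_norm_rep_le {p : ℝ} [hp : Fact (1 < p)] (α : ℝ) {K : Set (Cn m)} (hK : IsCompact K)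
    (hKt : K ⊆ tube m) :
    ∃ M : ℝ, 0 ≤ M ∧ ∀ f : bergman m p α, ∀ w ∈ K, ‖rep f w‖ ≤ M * ‖f‖ := by
  have hp0 : 0 < p := by linarith [hp.out]
  obtain ⟨C, -, hC, h⟩ := exists_pointwise_bound m α
  obtain ⟨R, hR⟩ := hK.exists_bound_of_continuousOn (f := fun z => rho z ^ (-((m : ℝ) + 2 + α)))
    ((continuous_rho.continuousOn).rpow_const fun z hz => Or.inl (mem_tube_iff.1 (hKt hz)).ne')
  refine ⟨((C * ENNReal.ofReal R) ^ (1 / p)).toReal, ENNReal.toReal_nonneg, fun f w hw => ?_⟩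
  have h1 := h (rep f) (rep_differentiableOn f) p hp0 w (hKt hw)
  rw [wint_rep, erho_rpow (hKt hw)] at h1
  have h2 : ‖rep f w‖ₑ ^ p ≤ (C * ENNReal.ofReal R) * ENNReal.ofReal ‖f‖ ^ p :=
    h1.trans (by gcongr; exact (le_abs_self _).trans (hR w hw))
  have h3 := ENNReal.rpow_le_rpow h2 (by positivity : 0 ≤ 1 / p)
  rw [ENNReal.mul_rpow_of_nonneg _ _ (by positivity), ← ENNReal.rpow_mul, ← ENNReal.rpow_mul,
    mul_one_div_cancel hp0.ne', ENNReal.rpow_one, ENNReal.rpow_one] at h3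
  have h4 := ENNReal.toReal_mono (ENNReal.mul_ne_top (ENNReal.rpow_ne_top_of_nonneg (by positivity)
    (ENNReal.mul_ne_top hC ENNReal.ofReal_ne_top)) ENNReal.ofReal_ne_top) h3
  rwa [toReal_enorm, ENNReal.toReal_mul, ENNReal.toReal_ofReal (norm_nonneg _)] at h4

/-- Norm convergence forces locally uniform convergence of the representatives, so their limit is
holomorphic; an a.e. convergent subsequence identifies it with the norm limit. This makes the target
of T complete, as compactness from total boundedness requires. -/
theorem isClosed_bergman {p : ℝ} [hp : Fact (1 < p)] (α : ℝ) :
    IsClosed (bergman m p α : Set (weightedLp m p α)) := by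
  refine IsSeqClosed.isClosed fun x a hx ha => ?_
  set u : ℕ → bergman m p α := fun n => ⟨x n, hx n⟩
  have hcau : CauchySeq u := by
    have := ha.cauchySeq
    rw [Metric.cauchySeq_iff] at this ⊢
    exact this
  have huc : ∀ K ⊆ tube m, IsCompact K → UniformCauchySeqOn (fun n => rep (u n)) atTop K := by
    intro K hKt hK
    obtain ⟨M, hM0, hM⟩ := exists_norm_rep_le (p := p) α hK hKt
    rw [Metric.uniformCauchySeqOn_iff]
    intro ε hε
    obtain ⟨N, hN⟩ := Metric.cauchySeq_iff.1 hcau (ε / (M + 1)) (by positivity)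
    refine ⟨N, fun k hk n hn z hz => ?_⟩
    have h1 := hM (u k - u n) z hz
    rw [rep_sub _ _ (hKt hz), Pi.sub_apply, ← dist_eq_norm, ← dist_eq_norm] at h1
    calc _ ≤ M * dist (u k) (u n) := h1
      _ ≤ (M + 1) * dist (u k) (u n) := by gcongr; linarith
      _ < (M + 1) * (ε / (M + 1)) := by gcongr; exact hN k hk n hn
      _ = ε := by field_simp
  have hlim : ∀ z ∈ tube m, ∃ L, Tendsto (fun n => rep (u n) z) atTop (𝓝 L) := fun z hz =>
    cauchySeq_tendsto_of_complete
      ((huc {z} (Set.singleton_subset_iff.2 hz) isCompact_singleton).cauchySeq rfl)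
  choose! g hg using hlim
  refine ⟨g, differentiableOn_of_tendstoUniformlyOn_isCompact isOpen_tube
    (fun n => rep_differentiableOn (u n)) fun K hKt hK =>
      (huc K hKt hK).tendstoUniformlyOn_of_tendsto fun z hz => hg z (hKt hz), ?_⟩
  obtain ⟨ns, hns, hae⟩ := (tendstoInMeasure_of_tendsto_Lp ha).exists_seq_tendsto_ae
  filter_upwards [hae, ae_mem_tube α, ae_all_iff.2 fun n => coe_ae_eq_rep (u n)] with z h1 h2 h3
  refine tendsto_nhds_unique h1 (((hg z h2).comp hns.tendsto_atTop).congr fun n => ?_)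
  exact (h3 (ns n)).symm

/-! ### From the split bound to compactness of B -/

theorem exists_mul_rpow_le {D ε : ℝ≥0∞} (hD : D ≠ ⊤) (hε : 0 < ε) (hεt : ε ≠ ⊤)
    {p : ℝ} (hp : 0 < p) :
    ∃ η : ℝ≥0∞, 0 < η ∧ η ≠ ⊤ ∧ η ^ p * D ≤ ε := by
  have hD1 : D + 1 ≠ ⊤ := by simpa using hD
  have h0 : ε / (D + 1) ≠ ⊤ := ENNReal.div_ne_top hεt (by simp)
  have h1 : ε / (D + 1) ≠ 0 := (ENNReal.div_pos hε.ne' hD1).ne'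
  refine ⟨(ε / (D + 1)) ^ (1 / p), ENNReal.rpow_pos (pos_iff_ne_zero.2 h1) h0,
    ENNReal.rpow_ne_top_of_nonneg (by positivity) h0, ?_⟩
  rw [← ENNReal.rpow_mul, one_div_mul_cancel hp.ne', ENNReal.rpow_one]
  calc ε / (D + 1) * D ≤ ε / (D + 1) * (D + 1) := by gcongr; exact le_self_add
    _ ≤ ε := (ENNReal.div_mul_cancel (by simp) hD1).le

theorem aemeasurable_bz_integrand (μ : Measure (Cn m)) (b : ℝ) {f : Cn m → ℂ}
    (hf : DifferentiableOn ℂ f (tube m)) (z : Cn m) :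
    AEMeasurable (fun w => ‖f w‖ₑ * ek z w ^ (-b)) (μ.restrict (tube m)) :=
  (hf.continuousOn.aestronglyMeasurable measurableSet_tube).enorm.mul
    ((measurable_ek_right z).pow_const _).aemeasurable

theorem bz_le_add (μ : Measure (Cn m)) (b : ℝ) {f g h : Cn m → ℂ} (hg : DifferentiableOn ℂ g (tube m))
    (hfgh : ∀ w ∈ tube m, ‖f w‖ₑ ≤ ‖g w‖ₑ + ‖h w‖ₑ) (z : Cn m) :
    bz μ b f z ≤ bz μ b g z + bz μ b h z := by
  unfold bz
  rw [← lintegral_add_left' (aemeasurable_bz_integrand μ b hg z)]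
  refine setLIntegral_mono' measurableSet_tube fun w hw => ?_
  rw [← add_mul]
  exact mul_le_mul' (hfgh w hw) le_rfl

theorem bz_le_of_mem_nbhd (μ : Measure (Cn m)) (b : ℝ) (f : Cn m → ℂ) {a z : Cn m} (ha : a ∈ tube m)
    (hz : z ∈ nbhd a) : bz μ b f z ≤ 36 ^ |-b| * bz μ b f a := by
  unfold bz
  rw [← lintegral_const_mul' _ _ (ENNReal.rpow_ne_top_of_nonneg (abs_nonneg _) (by simp))]
  refine setLIntegral_mono' measurableSet_tube fun w hw => ?_
  calc ‖f w‖ₑ * ek z w ^ (-b) ≤ ‖f w‖ₑ * (36 ^ |-b| * ek a w ^ (-b)) := by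
        gcongr; exact ek_rpow_le ha hz hw _
    _ = _ := by ring

/-- A Harnack-type argument: if the value at z were infinite, it would be infinite on the whole ball
about z, which has positive volume, against integrability. This gives convergence at every point, as
statement 2 demands. -/
theorem bz_ne_top {μ : Measure (Cn m)} (hμ : MeasureClass μ) {b p α : ℝ} (hp : 0 < p) {f : Cn m → ℂ}
    (hf : DifferentiableOn ℂ f (tube m)) (h : wint p α (bz μ b f) ≠ ⊤) {z : Cn m} (hz : z ∈ tube m) :
    bz μ b f z ≠ ⊤ := by
  have := hμ.sigmaFinite
  have hm : Measurable (bz μ b f) := measurable_bz _ _ hf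
  have h1 := ae_lt_top ((measurable_erho.pow_const α).mul (hm.pow_const p)) h
  rw [ae_restrict_iff' measurableSet_tube] at h1
  intro hzt
  refine ((isOpen_nbhd z).measure_pos volume ⟨z, self_mem_nbhd hz⟩).ne' (measure_mono_null ?_ h1)
  intro v hv hvfin
  have h2 := bz_le_of_mem_nbhd μ b f hv.1 (mem_nbhd_symm hz hv)
  rw [hzt, top_le_iff] at h2
  have h3 : bz μ b f v = ⊤ := by
    by_contra hc
    exact ENNReal.mul_ne_top (ENNReal.rpow_ne_top_of_nonneg (abs_nonneg _) (by simp)) hc h2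
  have h4 := hvfin hv.1
  simp only [Pi.mul_apply] at h4
  rw [h3, ENNReal.top_rpow_of_pos hp, ENNReal.mul_top (erho_rpow_ne_zero hv.1 α)] at h4
  exact lt_irrefl _ h4

section

variable {μ : Measure (Cn m)} {b p₁ α₁ p₂ α₂ : ℝ} [hp₁ : Fact (1 < p₁)] [hp₂ : Fact (1 < p₂)]

theorem HasSplitBound.wint_bz_ne_top (h : HasSplitBound μ b p₁ α₁ p₂ α₂) (f : bergman m p₁ α₁) :
    wint p₂ α₂ (bz μ b (rep f)) ≠ ⊤ := by
  have h1 : 0 < p₁ := by linarith [hp₁.out]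
  have h2 : 0 < p₂ := by linarith [hp₂.out]
  obtain ⟨C, hC, h⟩ := h
  obtain ⟨N, A, hA, h⟩ := h 1 one_pos ENNReal.one_ne_top
  obtain ⟨M, -, hM⟩ := exists_norm_rep_le (p := p₁) α₁ (isCompact_exhaust N)
    (exhaust_subset_tube (m := m) N)
  refine ne_top_of_le_ne_top ?_ (h (rep f) (rep_differentiableOn f) (wint_rep_ne_top f)
    (ENNReal.ofReal (M * ‖f‖)) ENNReal.ofReal_ne_top fun w hw => ?_)
  · have hw := wint_rep_ne_top f
    exact ENNReal.add_ne_top.2 ⟨ENNReal.mul_ne_top (by simp [h2.le]) hA, ENNReal.mul_ne_top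
      (by simpa using hC) (ENNReal.rpow_ne_top_of_nonneg (by positivity) hw)⟩
  · rw [← ofReal_norm]; exact ENNReal.ofReal_le_ofReal (hM f w hw)

theorem HasSplitBound.bz_ne_top (h : HasSplitBound μ b p₁ α₁ p₂ α₂) (hμ : MeasureClass μ)
    (f : bergman m p₁ α₁) {z : Cn m} (hz : z ∈ tube m) : bz μ b (rep f) z ≠ ⊤ :=
  TubeBergman.bz_ne_top hμ (by linarith [hp₂.out]) (rep_differentiableOn f) (h.wint_bz_ne_top f) hz

/-- Differences of elements of S have norm at most 2R, so a small η disposes of the second term of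
the split bound. That choice fixes N and A, and only then is a Montel net chosen, fine enough on the
N-th compact set to dispose of the first. -/
theorem HasSplitBound.exists_finite_net (h : HasSplitBound μ b p₁ α₁ p₂ α₂)
    {S : Set (bergman m p₁ α₁)} (hS : Bornology.IsBounded S) {ε : ℝ≥0∞} (hε : 0 < ε) (hεt : ε ≠ ⊤) :
    ∃ t ⊆ S, t.Finite ∧ ∀ f ∈ S, ∃ g ∈ t, wint p₂ α₂ (bz μ b (rep (f - g))) ≤ ε := by
  have h1 : 0 < p₁ := by linarith [hp₁.out]
  have h2 : 0 < p₂ := by linarith [hp₂.out]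
  obtain ⟨R, hR⟩ := isBounded_iff_forall_norm_le.1 hS
  obtain ⟨C, hC, h⟩ := h
  set W : ℝ≥0∞ := (ENNReal.ofReal (2 * R) ^ p₁) ^ (p₂ / p₁) with hW
  have hWt : W ≠ ⊤ := 
    ENNReal.rpow_ne_top_of_nonneg (div_pos h2 h1).le
      (ENNReal.rpow_ne_top_of_nonneg h1.le ENNReal.ofReal_ne_top)
  have hε2 : 0 < ε / 2 := ENNReal.half_pos hε.ne'
  have hε2t : ε / 2 ≠ ⊤ := ENNReal.div_ne_top hεt (by simp)
  obtain ⟨η, hη, hηt, hηle⟩ := exists_mul_rpow_le (ENNReal.mul_ne_top hC hWt) hε2 hε2t h2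
  obtain ⟨N, A, hA, h⟩ := h η hη hηt
  obtain ⟨δ, hδ, hδt, hδle⟩ := exists_mul_rpow_le hA hε2 hε2t h2
  obtain ⟨t, htS, htfin, ht⟩ := TubeBergman.exists_finite_net isOpen_tube (isCompact_exhaust N)
    (exhaust_subset_tube N) S (f := fun f : bergman m p₁ α₁ => rep f)
    (fun f _ => rep_differentiableOn f) (fun K hK hKc => by
      obtain ⟨M, hM0, hM⟩ := exists_norm_rep_le (p := p₁) α₁ hKc hK
      exact ⟨M * R, fun f hf w hw => (hM f w hw).trans (by gcongr; exact hR f hf)⟩)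
    (ENNReal.toReal_pos hδ.ne' hδt)
  refine ⟨t, htS, htfin, fun f hf => ?_⟩
  obtain ⟨g, hg, hfg⟩ := ht f hf
  refine ⟨g, hg, (h (rep (f - g)) (rep_differentiableOn _) (wint_rep_ne_top _) δ hδt
    fun w hw => ?_).trans ?_⟩
  · rw [rep_sub f g hw.1, ← ofReal_norm, ← ENNReal.ofReal_toReal hδt]
    exact ENNReal.ofReal_le_ofReal (hfg w hw)
  · rw [wint_rep, ← ENNReal.add_halves ε]
    refine add_le_add hδle (le_trans ?_ hηle)
    rw [mul_comm C, mul_assoc, hW]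
    gcongr
    have := norm_sub_le f g
    linarith [hR f hf, hR g (htS hg)]

/-- Linearity of T is not assumed: control of the distance of two images by B(f − g) carries the
nets over, and so covers the sublinear B as well. -/
theorem HasSplitBound.mapsBoundedToRelCompact (h : HasSplitBound μ b p₁ α₁ p₂ α₂) {Y : Type*}
    [MetricSpace Y] [CompleteSpace Y] {T : bergman m p₁ α₁ → Y}
    (hT : ∀ f g, edist (T f) (T g) ^ p₂ ≤ wint p₂ α₂ (bz μ b (rep (f - g)))) :
    MapsBoundedToRelCompact T := by
  have h2 : 0 < p₂ := by linarith [hp₂.out]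
  intro S hS
  refine isCompact_iff_totallyBounded_isComplete.2
    ⟨TotallyBounded.closure ?_, isClosed_closure.isComplete⟩
  rw [Metric.totallyBounded_iff]
  intro ε hε
  obtain ⟨t, -, htfin, ht⟩ := h.exists_finite_net hS (ε := ENNReal.ofReal (ε / 2) ^ p₂)
    (ENNReal.rpow_pos (by simpa using hε) ENNReal.ofReal_ne_top)
    (ENNReal.rpow_ne_top_of_nonneg h2.le ENNReal.ofReal_ne_top)
  refine ⟨T '' t, htfin.image T, ?_⟩
  rintro _ ⟨f, hf, rfl⟩
  obtain ⟨g, hg, hfg⟩ := ht f hf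
  refine Set.mem_iUnion₂.2 ⟨T g, ⟨g, hg, rfl⟩, ?_⟩
  have h3 := (ENNReal.rpow_le_rpow_iff h2).1 ((hT f g).trans hfg)
  rw [edist_dist, ENNReal.ofReal_le_ofReal_iff (by positivity)] at h3
  rw [Metric.mem_ball]
  linarith

theorem enorm_toReal_sub_toReal_le {a c d : ℝ≥0∞} (ha : a ≠ ⊤) (hc : c ≠ ⊤) (h₁ : a ≤ c + d)
    (h₂ : c ≤ a + d) : ‖((a.toReal : ℂ) - (c.toReal : ℂ))‖ₑ ≤ d := by
  rcases eq_or_ne d ⊤ with rfl | hd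
  · exact le_top
  rw [← Complex.ofReal_sub, ← ofReal_norm, Complex.norm_real, Real.norm_eq_abs]
  refine ENNReal.ofReal_le_of_le_toReal (abs_le.2 ⟨?_, ?_⟩)
  · have := ENNReal.toReal_mono (ENNReal.add_ne_top.2 ⟨ha, hd⟩) h₂
    rw [ENNReal.toReal_add ha hd] at this
    linarith
  · have := ENNReal.toReal_mono (ENNReal.add_ne_top.2 ⟨hc, hd⟩) h₁
    rw [ENNReal.toReal_add hc hd] at this
    linarith

theorem eLpNorm_rpow_le_wint {p : ℝ} (hp : 0 < p) (α : ℝ) {f : Cn m → ℂ} {g : Cn m → ℝ≥0∞}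
    (h : ∀ z ∈ tube m, ‖f z‖ₑ ≤ g z) :
    eLpNorm f (ENNReal.ofReal p) (weightedVolume m α) ^ p ≤ wint p α g := by
  rw [← wint_eq_eLpNorm hp]
  exact wint_mono hp.le h

theorem memLp_of_enorm_le {p : ℝ} (hp : 0 < p) {α : ℝ} {f : Cn m → ℂ} {g : Cn m → ℝ≥0∞}
    (hf : AEStronglyMeasurable f (weightedVolume m α)) (h : ∀ z ∈ tube m, ‖f z‖ₑ ≤ g z)
    (hg : wint p α g ≠ ⊤) : MemLp f (ENNReal.ofReal p) (weightedVolume m α) :=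
  ⟨hf, (ENNReal.rpow_lt_top_iff_of_pos hp).1
    ((eLpNorm_rpow_le_wint hp α h).trans_lt (lt_top_iff_ne_top.2 hg))⟩

theorem enorm_rep_le_add {p α : ℝ} (f g : bergman m p α) {w : Cn m} (hw : w ∈ tube m) :
    ‖rep f w‖ₑ ≤ ‖rep g w‖ₑ + ‖rep (f - g) w‖ₑ ∧ ‖rep g w‖ₑ ≤ ‖rep f w‖ₑ + ‖rep (f - g) w‖ₑ := by
  rw [rep_sub f g hw, Pi.sub_apply]
  constructor
  · simpa using enorm_add_le (rep g w) (rep f w - rep g w)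
  · simpa using enorm_sub_le (a := rep f w) (b := rep f w - rep g w)

theorem HasSplitBound.berezinCompact {ξ : ℝ} (h : HasSplitBound μ ((m : ℝ) + 2 + ξ) p₁ α₁ p₂ α₂)
    (hμ : MeasureClass μ) : BerezinCompact μ ξ p₁ α₁ p₂ α₂ := by
  have h2 : 0 < p₂ := by linarith [hp₂.out]
  have := hμ.sigmaFinite
  set b : ℝ := (m : ℝ) + 2 + ξ
  set B : bergman m p₁ α₁ → Cn m → ℂ := fun f z => ((bz μ b (rep f) z).toReal : ℂ) with hB
  have hmem : ∀ f, MemLp (B f) (ENNReal.ofReal p₂) (weightedVolume m α₂) := fun f => by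
    refine memLp_of_enorm_le h2 ?_ (fun z hz => ?_) (h.wint_bz_ne_top f)
    · have hm : Measurable (bz μ b (rep f)) := measurable_bz _ _ (rep_differentiableOn f)
      exact (Complex.measurable_ofReal.comp hm.ennreal_toReal).aestronglyMeasurable
    · simp only [hB]
      rw [← ofReal_norm, Complex.norm_real, Real.norm_of_nonneg ENNReal.toReal_nonneg]
      exact ENNReal.ofReal_toReal_le
  refine ⟨fun f => (hmem f).toLp (B f), fun f => ?_, h.mapsBoundedToRelCompact fun f g => ?_⟩
  · filter_upwards [ae_mem_tube α₂, (hmem f).coeFn_toLp] with z hz hfz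
    rw [hfz, berezinOp_eq_bz μ ξ _ hz]
    exact ⟨lt_top_iff_ne_top.2 (h.bz_ne_top hμ f hz), rfl⟩
  · rw [Lp.edist_toLp_toLp]
    refine eLpNorm_rpow_le_wint h2 α₂ fun z hz => ?_
    exact enorm_toReal_sub_toReal_le (h.bz_ne_top hμ f hz) (h.bz_ne_top hμ g hz)
      (bz_le_add μ b (rep_differentiableOn g) (fun w hw => (enorm_rep_le_add f g hw).1) z)
      (bz_le_add μ b (rep_differentiableOn f) (fun w hw => (enorm_rep_le_add f g hw).2) z)

end

/-! ### Holomorphy and compactness of the Toeplitz operator -/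

theorem enorm_toeplitzIntegrand (ξ : ℝ) (f : Cn m → ℂ) {z w : Cn m} (hz : z ∈ tube m)
    (hw : w ∈ tube m) :
    ‖toeplitzIntegrand ξ f z w‖ₑ = ‖f w‖ₑ * ek z w ^ (-((m : ℝ) + 2 + ξ)) := by
  rw [ek_rpow hz hw, ← ofReal_norm, ← ofReal_norm, ← ENNReal.ofReal_mul (norm_nonneg _),
    toeplitzIntegrand, norm_div, exp_eq, Complex.norm_cpow_real, Real.rpow_neg (norm_nonneg _),
    div_eq_mul_inv]

theorem lintegral_enorm_toeplitzIntegrand (μ : Measure (Cn m)) (ξ : ℝ) (f : Cn m → ℂ) {z : Cn m}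
    (hz : z ∈ tube m) :
    ∫⁻ w in tube m, ‖toeplitzIntegrand ξ f z w‖ₑ ∂μ = bz μ ((m : ℝ) + 2 + ξ) f z :=
  setLIntegral_congr_fun measurableSet_tube fun _ hw => enorm_toeplitzIntegrand ξ f hz hw

theorem continuous_rho₂_right (z : Cn m) : Continuous fun w => rho₂ z w := by
  unfold rho₂; fun_prop

theorem continuousOn_rho₂_cpow (c : ℂ) {z : Cn m} (hz : z ∈ tube m) :
    ContinuousOn (fun w => rho₂ z w ^ c) (tube m) :=
  (continuous_rho₂_right z).continuousOn.cpow_const fun _ hw => rho₂_mem_slitPlane hz hw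

theorem aestronglyMeasurable_toeplitzIntegrand (μ : Measure (Cn m)) (ξ : ℝ) {f : Cn m → ℂ}
    (hf : DifferentiableOn ℂ f (tube m)) {z : Cn m} (hz : z ∈ tube m) :
    AEStronglyMeasurable (toeplitzIntegrand ξ f z) (μ.restrict (tube m)) := by
  refine (hf.continuousOn.div (continuousOn_rho₂_cpow _ hz) fun w hw => ?_).aestronglyMeasurable
    measurableSet_tube
  rw [Complex.cpow_ne_zero_iff]
  exact Or.inl (rho₂_ne_zero hz hw)

theorem integrableOn_toeplitzIntegrand {μ : Measure (Cn m)} {ξ : ℝ} {f : Cn m → ℂ}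
    (hf : DifferentiableOn ℂ f (tube m)) {z : Cn m} (hz : z ∈ tube m)
    (h : bz μ ((m : ℝ) + 2 + ξ) f z ≠ ⊤) : IntegrableOn (toeplitzIntegrand ξ f z) (tube m) μ := by
  refine ⟨aestronglyMeasurable_toeplitzIntegrand μ ξ hf hz, ?_⟩
  rw [hasFiniteIntegral_iff_enorm, lintegral_enorm_toeplitzIntegrand μ ξ f hz]
  exact lt_top_iff_ne_top.2 h

theorem enorm_toeplitzOp_le (μ : Measure (Cn m)) (ξ : ℝ) (f : Cn m → ℂ) {z : Cn m}
    (hz : z ∈ tube m) : ‖toeplitzOp μ ξ f z‖ₑ ≤ bz μ ((m : ℝ) + 2 + ξ) f z :=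
  (enorm_integral_le_lintegral_enorm _).trans_eq (lintegral_enorm_toeplitzIntegrand μ ξ f hz)

/-- The complex derivative of `ρ(·, w)` at `z`. -/
def rho₂Deriv (z w : Cn m) : Cn m →L[ℂ] ℂ :=
  (1 / 4 : ℂ) • ((∑ j : Fin m, (2 * (z j.castSucc - (starRingEnd ℂ) (w j.castSucc))) •
    ContinuousLinearMap.proj (R := ℂ) (φ := fun _ : Fin (m + 1) => ℂ) j.castSucc)
    - (2 * Complex.I) • ContinuousLinearMap.proj (R := ℂ) (φ := fun _ : Fin (m + 1) => ℂ)
      (Fin.last m))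

theorem hasFDerivAt_rho₂ (z w : Cn m) :
    HasFDerivAt (fun z => rho₂ z w) (rho₂Deriv z w) z := by
  have hp : ∀ i : Fin (m + 1), HasFDerivAt (fun z : Cn m => z i - (starRingEnd ℂ) (w i))
      (ContinuousLinearMap.proj (R := ℂ) (φ := fun _ : Fin (m + 1) => ℂ) i) z := fun i =>
    (ContinuousLinearMap.proj (R := ℂ) (φ := fun _ : Fin (m + 1) => ℂ) i).hasFDerivAt.sub_const _
  refine HasFDerivAt.const_mul (HasFDerivAt.sub ?_ ((hp _).const_mul _)) _
  refine HasFDerivAt.fun_sum fun j _ => ?_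
  simpa using (hp j.castSucc).pow 2

theorem continuous_rho₂Deriv (z : Cn m) : Continuous fun w => rho₂Deriv z w := by
  unfold rho₂Deriv
  have hc : ∀ i : Fin (m + 1), Continuous fun w : Cn m => (starRingEnd ℂ) (w i) := fun i =>
    Complex.continuous_conj.comp (continuous_apply i)
  have hs : ∀ j : Fin m, Continuous fun w : Cn m =>
      (2 * (z j.castSucc - (starRingEnd ℂ) (w j.castSucc))) •
        ContinuousLinearMap.proj (R := ℂ) (φ := fun _ : Fin (m + 1) => ℂ) j.castSucc := fun j => by
    have h : Continuous fun w : Cn m => 2 * (z j.castSucc - (starRingEnd ℂ) (w j.castSucc)) :=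
      continuous_const.mul (continuous_const.sub (hc _))
    exact h.smul continuous_const
  exact ((continuous_finsetSum _ fun j _ => hs j).sub continuous_const).const_smul (1 / 4 : ℂ)

theorem differentiableOn_toeplitzIntegrand (ξ : ℝ) (f : Cn m → ℂ) {w : Cn m} (hw : w ∈ tube m) :
    DifferentiableOn ℂ (fun z => toeplitzIntegrand ξ f z w) (tube m) := by
  unfold toeplitzIntegrand
  simp only [div_eq_mul_inv, ← Complex.cpow_neg]
  exact ((differentiable_rho₂ w).differentiableOn.cpow_const fun _ hz =>
    rho₂_mem_slitPlane hz hw).const_mul _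

theorem hasFDerivAt_toeplitzIntegrand (ξ : ℝ) (f : Cn m → ℂ) {z w : Cn m} (hz : z ∈ tube m)
    (hw : w ∈ tube m) :
    HasFDerivAt (fun z => toeplitzIntegrand ξ f z w)
      (f w • ((-((((m + 1 : ℕ) : ℝ) + 1 + ξ : ℝ) : ℂ) *
        rho₂ z w ^ (-((((m + 1 : ℕ) : ℝ) + 1 + ξ : ℝ) : ℂ) - 1)) • rho₂Deriv z w)) z := by
  unfold toeplitzIntegrand
  simp only [div_eq_mul_inv, ← Complex.cpow_neg]
  exact ((Complex.hasStrictDerivAt_cpow_const (rho₂_mem_slitPlane hz hw)).hasDerivAt.comp_hasFDerivAt z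
    (hasFDerivAt_rho₂ z w)).const_mul (f w)

theorem norm_toeplitzIntegrand_le (ξ : ℝ) (f : Cn m → ℂ) {a z w : Cn m} (ha : a ∈ tube m)
    (hz : z ∈ nbhd a) (hw : w ∈ tube m) : ‖toeplitzIntegrand ξ f z w‖ ≤
      ((36 : ℝ≥0∞) ^ |-((m : ℝ) + 2 + ξ)|).toReal * ‖toeplitzIntegrand ξ f a w‖ := by
  have h36 : (36 : ℝ≥0∞) ^ |-((m : ℝ) + 2 + ξ)| ≠ ⊤ :=
    ENNReal.rpow_ne_top_of_nonneg (abs_nonneg _) (by simp)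
  rw [← toReal_enorm, ← toReal_enorm, ← ENNReal.toReal_mul]
  refine ENNReal.toReal_mono (ENNReal.mul_ne_top h36 enorm_ne_top) ?_
  rw [enorm_toeplitzIntegrand ξ f hz.1 hw, enorm_toeplitzIntegrand ξ f ha hw, mul_left_comm]
  gcongr
  exact ek_rpow_le ha hz hw _

/-- Differentiation under the integral. Near a the integrand is at most Q times its modulus at a;
holomorphy in z turns this into a Lipschitz bound relative to a, integrable in w, so no estimate of
the derivative is needed. -/
theorem differentiableOn_toeplitzOp {μ : Measure (Cn m)} {ξ : ℝ} {f : Cn m → ℂ}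
    (hf : DifferentiableOn ℂ f (tube m))
    (h : ∀ z ∈ tube m, IntegrableOn (toeplitzIntegrand ξ f z) (tube m) μ) :
    DifferentiableOn ℂ (toeplitzOp μ ξ f) (tube m) := by
  intro a ha
  obtain ⟨r, hr, hrn⟩ := Metric.isOpen_iff.1 (isOpen_nbhd a) a (self_mem_nbhd ha)
  have hrt : Metric.ball a r ⊆ tube m := fun z hz => (hrn hz).1
  set Q := ((36 : ℝ≥0∞) ^ |-((m : ℝ) + 2 + ξ)|).toReal
  refine (hasFDerivAt_integral_of_dominated_loc_of_lip' (𝕜 := ℂ) (F := toeplitzIntegrand ξ f)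
    (bound := fun w => 2 * (Q * ‖toeplitzIntegrand ξ f a w‖) / r)
    (Metric.ball_mem_nhds a hr) (fun z hz => aestronglyMeasurable_toeplitzIntegrand μ ξ hf (hrt hz))
    (h a ha) ?_ ?_ ((((h a ha).norm.const_mul Q).const_mul 2).div_const r)
    (ae_restrict_of_forall_mem measurableSet_tube fun w hw =>
      hasFDerivAt_toeplitzIntegrand ξ f ha hw)).2.differentiableAt.differentiableWithinAt
  · refine ContinuousOn.aestronglyMeasurable ?_ measurableSet_tube
    exact hf.continuousOn.smul ((continuousOn_const.mul (continuousOn_rho₂_cpow _ ha)).smul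
      (continuous_rho₂Deriv a).continuousOn)
  · refine ae_restrict_of_forall_mem measurableSet_tube fun w hw z hz => ?_
    have := dist_le_of_norm_le_ball ((differentiableOn_toeplitzIntegrand ξ f hw).mono hrt)
      (fun v hv => norm_toeplitzIntegrand_le ξ f ha (hrn hv) hw) hz
    rwa [dist_eq_norm, dist_eq_norm] at this

theorem HasSplitBound.toeplitzCompact {μ : Measure (Cn m)} {ξ p₁ α₁ p₂ α₂ : ℝ}
    [hp₁ : Fact (1 < p₁)] [hp₂ : Fact (1 < p₂)]
    (h : HasSplitBound μ ((m : ℝ) + 2 + ξ) p₁ α₁ p₂ α₂) (hμ : MeasureClass μ) :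
    ToeplitzCompact μ ξ p₁ α₁ p₂ α₂ := by
  have h2 : 0 < p₂ := by linarith [hp₂.out]
  have hint : ∀ (f : bergman m p₁ α₁), ∀ z ∈ tube m,
      IntegrableOn (toeplitzIntegrand ξ (rep f) z) (tube m) μ := fun f z hz =>
    integrableOn_toeplitzIntegrand (rep_differentiableOn f) hz (h.bz_ne_top hμ f hz)
  have hd : ∀ f : bergman m p₁ α₁, DifferentiableOn ℂ (toeplitzOp μ ξ (rep f)) (tube m) := fun f =>
    differentiableOn_toeplitzOp (rep_differentiableOn f) (hint f)
  have hmem : ∀ f : bergman m p₁ α₁,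
      MemLp (toeplitzOp μ ξ (rep f)) (ENNReal.ofReal p₂) (weightedVolume m α₂) := fun f =>
    memLp_of_enorm_le h2 (aestronglyMeasurable_of_differentiableOn (hd f) α₂)
      (fun z hz => enorm_toeplitzOp_le μ ξ (rep f) hz) (h.wint_bz_ne_top f)
  have : CompleteSpace (bergman m p₂ α₂) :=
    (isClosed_bergman (m := m) (p := p₂) α₂).completeSpace_coe
  refine ⟨fun f => mkBergman _ (hd f) (hmem f), fun f z hz =>
    ⟨hint f z hz, rep_mkBergman _ (hd f) (hmem f) hz⟩, h.mapsBoundedToRelCompact fun f g => ?_⟩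
  have hedist : edist (mkBergman _ (hd f) (hmem f)) (mkBergman _ (hd g) (hmem g)) =
      edist ((hmem f).toLp _) ((hmem g).toLp _) := rfl
  rw [hedist, Lp.edist_toLp_toLp]
  refine eLpNorm_rpow_le_wint h2 α₂ fun z hz => ?_
  have hsub : toeplitzOp μ ξ (rep f) z - toeplitzOp μ ξ (rep g) z =
      toeplitzOp μ ξ (rep (f - g)) z := by
    rw [toeplitzOp, toeplitzOp, ← integral_sub (hint f z hz) (hint g z hz)]
    refine setIntegral_congr_fun measurableSet_tube fun w hw => ?_
    simp only [toeplitzIntegrand, rep_sub f g hw, Pi.sub_apply, sub_div]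
  rw [Pi.sub_apply, hsub]
  exact enorm_toeplitzOp_le μ ξ _ hz

/-! ### Matching the exponents and the equivalence -/

theorem lam_mul_eq_carlesonExp {p₁ p₂ α₁ α₂ ξ lam γ : ℝ} (hlam0 : lam ≠ 0)
    (hlam : lam = 1 + 1 / p₁ - 1 / p₂) (hγ : γ = 1 / lam * (ξ + α₁ / p₁ - α₂ / p₂)) :
    lam * ((m : ℝ) + 2 + γ) = carlesonExp m p₁ α₁ p₂ α₂ ξ := by
  have h1 : lam * γ = ξ + α₁ / p₁ - α₂ / p₂ := by rw [hγ]; field_simp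
  rw [mul_add, h1, hlam, carlesonExp]
  ring

end TubeBergman

end

theorem theorem5p2 (m : ℕ) (p₁ p₂ α₁ α₂ ξ : ℝ) [Fact (1 < p₁)] [Fact (1 < p₂)] (hp : p₁ ≤ p₂)
    (hα₁ : -1 < α₁) (hα₂ : -1 < α₂) (hξ : -1 < ξ)
    (μ : MeasureTheory.Measure (TubeBergman.Cn m)) (hμ : TubeBergman.MeasureClass μ)
    (h₁ : ((m + 1 : ℕ) : ℝ) * max 1 (1 / p₁) + (1 + α₁) / p₁ < ((m + 1 : ℕ) : ℝ) + 1 + ξ)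
    (h₂ : ((m + 1 : ℕ) : ℝ) * max 1 (1 / p₂) + (1 + α₂) / p₂ < ((m + 1 : ℕ) : ℝ) + 1 + ξ)
    (lam γ : ℝ) (hlam : lam = 1 + 1 / p₁ - 1 / p₂)
    (hγ : γ = 1 / lam * (ξ + α₁ / p₁ - α₂ / p₂)) :
    List.TFAE
      [TubeBergman.BerezinCompact μ ξ p₁ α₁ p₂ α₂,
       TubeBergman.ToeplitzCompact μ ξ p₁ α₁ p₂ α₂,
       TubeBergman.IsVanishingCarleson μ lam γ] := by
  have h1 : 1 < p₁ := Fact.out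
  have h2 : 1 < p₂ := Fact.out
  have hq₁ : 1 / p₁ < 1 := (div_lt_one (by linarith)).2 h1
  have hq₂ : 1 / p₂ < 1 := (div_lt_one (by linarith)).2 h2
  rw [max_eq_left hq₁.le, mul_one] at h₁
  rw [max_eq_left hq₂.le, mul_one] at h₂
  push_cast at h₁ h₂
  have hm : (0 : ℝ) ≤ m := Nat.cast_nonneg m
  have e₁ : 1 + α₁ < p₁ * (1 + ξ) := by
    have := (div_lt_iff₀ (by linarith : 0 < p₁)).1 (by linarith : (1 + α₁) / p₁ < 1 + ξ)
    linarith
  have e₂ : 1 + α₂ < p₂ * (1 + ξ) := by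
    have := (div_lt_iff₀ (by linarith : 0 < p₂)).1 (by linarith : (1 + α₂) / p₂ < 1 + ξ)
    linarith
  -- b₁ puts the test functions in the source space and b₂ puts |ρ(𝐢,·)|^(−(n+1+ξ)) in the target
  -- space; e₂ is the condition of the Schur test.
  have b₁ : (m : ℝ) + 2 + α₁ < ((m : ℝ) + 2 + ξ) * p₁ := by nlinarith
  have b₂ : (m : ℝ) + 2 + α₂ < ((m : ℝ) + 2 + ξ) * p₂ := by nlinarith
  have hlam1 : 1 ≤ lam := by
    have := one_div_le_one_div_of_le (by linarith) hp
    linarith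
  have hlam0 : 0 < lam := by linarith
  have hexp := TubeBergman.lam_mul_eq_carlesonExp (m := m) hlam0.ne' hlam hγ
  -- Indeed λ(γ + 1) = (1 + ξ) + (1 + α₁)/p₁ − (1 + α₂)/p₂, positive by the hypothesis for i = 2.
  -- This makes the test functions integrable with weight γ.
  have hγ1 : -1 < γ := by
    have h3 : lam * γ = ξ + α₁ / p₁ - α₂ / p₂ := by rw [hγ]; field_simp
    have h4 : 0 < (1 + α₁) / p₁ := div_pos (by linarith) (by linarith)
    have h5 : (1 + α₂) / p₂ < 1 + ξ := by linarith
    rw [add_div] at h4 h5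
    have h6 : 0 < lam * (γ + 1) := by rw [mul_add, h3, hlam]; linarith
    linarith [pos_of_mul_pos_right h6 hlam0.le]
  have hsplit : TubeBergman.VanishingAverages μ (TubeBergman.carlesonExp m p₁ α₁ p₂ α₂ ξ) →
      TubeBergman.HasSplitBound μ ((m : ℝ) + 2 + ξ) p₁ α₁ p₂ α₂ := fun hv =>
    TubeBergman.VanishingAverages.hasSplitBound h1 hp hα₂ hξ e₂ b₂ hμ hv
  have hcar := TubeBergman.VanishingAverages.isVanishingCarleson (lam := lam) (γ := γ) hlam1 hμ
  have hcar' := TubeBergman.IsVanishingCarleson.vanishingAverages (μ := μ) hlam0 hγ1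
  rw [hexp] at hcar hcar'
  tfae_have 1 → 3 := fun h => hcar (h.vanishingAverages hα₁ b₁)
  tfae_have 2 → 3 := fun h => hcar (h.vanishingAverages hα₁ b₁)
  tfae_have 3 → 1 := fun h => (hsplit (hcar' h)).berezinCompact hμ
  tfae_have 3 → 2 := fun h => (hsplit (hcar' h)).toeplitzCompact hμ
  tfae_finish
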